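/- Let $G$ be a finite simple graph on the vertex set $\{0,\dots,n-1\}$ whose edges are each coloured red or blue. For a set $S$ of edges let $R(S)$ and $B(S)$ be the sets of red and of blue edges in $S$; for a perfect matching $M$ let $r(M)=|R(M)|$; and let $M\,\Delta\,M'$ denote the symmetric difference of the edge sets of $M$ and $M'$. There is one deterministic algorithm which, given the coloured graph $G$, a perfect matching $M$ of $G$, and natural numbers $k$ and $L$, always halts within $n^{O(L)}$ steps and has the following property: whenever $M'$ is a perfect matching of $G$ with $r(M')=k$ and $$|B(M\,\Delta\,M')|\le L\quad\text{or}\quad |R(M\,\Delta\,M')|\le L ,$$ the algorithm outputs a perfect matching $M''$ of $G$ with $r(M'')=r(M')$. (The matching $M'$ itself is not given to the algorithm.) Here $n^{O(L)}$ means at most $\max(n,2)^{c\cdot\max(L,1)}$ for an absolute constant $c$. Steps are counted on a deterministic random access machine with unit-cost memory access, comparison, addition and truncated subtraction (but no unit-cost multiplication) on natural numbers. Graphs and matchings are given as adjacency matrices. -/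

import Mathlib

/-! Deterministic random access machines, presented as structured programs.  The memory consists of
two-dimensional arrays of natural numbers.  Every elementary operation (constant, memory access,
addition, truncated subtraction, assignment, test) costs one step.  There is no unit-cost
multiplication, so numbers grow by at most a constant number of bits per step and the machine is
polynomially equivalent to a Turing machine. -/

namespace RAM

/-- `m a i j` is the content of cell `(i, j)` of array number `a`. -/
abbrev Memory : Type := ℕ → ℕ → ℕ → ℕ

/-- Expressions: constants, memory access with computed indices, sum, truncated difference. -/
inductive Expr : Type
  | lit (c : ℕ) : Expr
  | read (a : ℕ) (i j : Expr) : Expr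
  | add (e f : Expr) : Expr
  | sub (e f : Expr) : Expr

/-- The value of an expression. -/
def Expr.eval (m : Memory) : Expr → ℕ
  | .lit c => c
  | .read a i j => m a (i.eval m) (j.eval m)
  | .add e f => e.eval m + f.eval m
  | .sub e f => e.eval m - f.eval m

/-- The number of elementary operations needed to evaluate an expression. -/
def Expr.cost : Expr → ℕ
  | .lit _ => 1
  | .read _ i j => i.cost + j.cost + 1
  | .add e f => e.cost + f.cost + 1
  | .sub e f => e.cost + f.cost + 1

/-- Programs.  A test succeeds when its expression is nonzero. -/
inductive Prog : Type
  | skip : Prog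
  | assign (a : ℕ) (i j e : Expr) : Prog
  | seq (p q : Prog) : Prog
  | ite (e : Expr) (p q : Prog) : Prog
  | while (e : Expr) (p : Prog) : Prog

/-- Write `v` into cell `(i, j)` of array `a`. -/
def Memory.write (m : Memory) (a i j v : ℕ) : Memory :=
  fun a' i' j' => if a' = a ∧ i' = i ∧ j' = j then v else m a' i' j'

/-- `Runs p m t m'`: started on memory `m`, the program `p` halts after exactly `t` steps
with memory `m'`. -/
inductive Runs : Prog → Memory → ℕ → Memory → Prop
  | skip (m : Memory) : Runs .skip m 1 m
  | assign (a : ℕ) (i j e : Expr) (m : Memory) :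
      Runs (.assign a i j e) m (i.cost + j.cost + e.cost + 1)
        (m.write a (i.eval m) (j.eval m) (e.eval m))
  | seq {p q : Prog} {m₀ m₁ m₂ : Memory} {s t : ℕ} :
      Runs p m₀ s m₁ → Runs q m₁ t m₂ → Runs (.seq p q) m₀ (s + t) m₂
  | iteTrue {e : Expr} {p q : Prog} {m m' : Memory} {t : ℕ} :
      e.eval m ≠ 0 → Runs p m t m' → Runs (.ite e p q) m (e.cost + 1 + t) m'
  | iteFalse {e : Expr} {p q : Prog} {m m' : Memory} {t : ℕ} :
      e.eval m = 0 → Runs q m t m' → Runs (.ite e p q) m (e.cost + 1 + t) m'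
  | whileTrue {e : Expr} {p : Prog} {m₀ m₁ m₂ : Memory} {s t : ℕ} :
      e.eval m₀ ≠ 0 → Runs p m₀ s m₁ → Runs (.while e p) m₁ t m₂ →
      Runs (.while e p) m₀ (e.cost + 1 + s + t) m₂
  | whileFalse {e : Expr} {p : Prog} {m : Memory} :
      e.eval m = 0 → Runs (.while e p) m (e.cost + 1) m

/-- The machine is deterministic: the input determines the running time and the result. -/
theorem Runs.deterministic {p : Prog} {m m₁ m₂ : Memory} {s t : ℕ}
    (h₁ : Runs p m s m₁) (h₂ : Runs p m t m₂) : s = t ∧ m₁ = m₂ := by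
  induction h₁ generalizing t m₂ with
  | skip => cases h₂; exact ⟨rfl, rfl⟩
  | assign => cases h₂; exact ⟨rfl, rfl⟩
  | seq _ _ ih ih' =>
    cases h₂ with
    | seq h h' =>
      obtain ⟨rfl, rfl⟩ := ih h
      obtain ⟨rfl, rfl⟩ := ih' h'
      exact ⟨rfl, rfl⟩
  | iteTrue hc _ ih =>
    cases h₂ with
    | iteTrue _ h => obtain ⟨rfl, rfl⟩ := ih h; exact ⟨rfl, rfl⟩
    | iteFalse hc' _ => exact absurd hc' hc
  | iteFalse hc _ ih =>
    cases h₂ with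
    | iteTrue hc' _ => exact absurd hc hc'
    | iteFalse _ h => obtain ⟨rfl, rfl⟩ := ih h; exact ⟨rfl, rfl⟩
  | whileTrue hc _ _ ih ih' =>
    cases h₂ with
    | whileTrue _ h h' =>
      obtain ⟨rfl, rfl⟩ := ih h
      obtain ⟨rfl, rfl⟩ := ih' h'
      exact ⟨rfl, rfl⟩
    | whileFalse hc' => exact absurd hc' hc
  | whileFalse hc =>
    cases h₂ with
    | whileTrue hc' _ _ => exact absurd hc hc'
    | whileFalse _ => exact ⟨rfl, rfl⟩

end RAM

namespace ExactMatching

/-- The two edge colours. -/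
inductive Color : Type
  | red : Color
  | blue : Color

/-- The edges of colour `x` in the edge set `S`. -/
def ofColor {V : Type*} {G : SimpleGraph V} (C : G.EdgeLabeling Color) (x : Color)
    (S : Set (Sym2 V)) : Set (Sym2 V) :=
  S ∩ (C.labelGraph x).edgeSet

/-- `r(M)`, the number of red edges of `M`. -/
noncomputable def redCount {V : Type*} {G : SimpleGraph V} (C : G.EdgeLabeling Color)
    (M : G.Subgraph) : ℕ :=
  (ofColor C .red M.edgeSet).ncard

open Classical in
/-- The adjacency matrix of a relation on `Fin n`, as the content of an array (zero elsewhere). -/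
noncomputable def matrixArray {n : ℕ} (r : Fin n → Fin n → Prop) (i j : ℕ) : ℕ :=
  if ∃ u v : Fin n, (u : ℕ) = i ∧ (v : ℕ) = j ∧ r u v then 1 else 0

/-- The initial memory for the input `(G, C, M, k, L)`: array `0` holds `n`, `k`, `L` in the cells
`(0, 0)`, `(0, 1)`, `(0, 2)`; arrays `1`, `2`, `3` hold the adjacency matrices of `G`, of the graph
of red edges of `G`, and of `M`; all other cells are zero. -/
noncomputable def inputMemory {n : ℕ} (G : SimpleGraph (Fin n)) (C : G.EdgeLabeling Color)
    (M : G.Subgraph) (k L : ℕ) : RAM.Memory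
  | 0, 0, 0 => n
  | 0, 0, 1 => k
  | 0, 0, 2 => L
  | 1, i, j => matrixArray G.Adj i j
  | 2, i, j => matrixArray (C.labelGraph .red).Adj i j
  | 3, i, j => matrixArray M.Adj i j
  | _, _, _ => 0

/-- The output convention: array `4` holds the adjacency matrix of `M`. -/
def Outputs {n : ℕ} {G : SimpleGraph (Fin n)} (m : RAM.Memory) (M : G.Subgraph) : Prop :=
  ∀ u v : Fin n, m 4 u v = matrixArray M.Adj u v

end ExactMatching

/-! The algorithm guesses the small part of the difference. Suppose that the edges of colour x in M
Δ M' form a set S with at most L elements. A guess consists of L ordered pairs of vertices, so there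
are n^(2L) guesses. For the correct guess the x-coloured edges of M' are known: they are the
x-coloured edges of M Δ S. Let H consist of these forced edges and of all edges of the other colour
whose ends are not covered by forced edges. Then M' is a perfect matching of H. Conversely, every
perfect matching of H contains all forced edges and has the other colour elsewhere, so it has as
many red edges as M'. Each guess is tried for both colours, and a matching is output only after it
has been checked, so wrong guesses do no harm (`tryProg_den`, `succeeds_of_lists`,
`searchLoop_runs`).

It remains to find perfect matchings in polynomial time. This is done by Edmonds' search without
contractions: for every outer vertex u a whole matching W u is stored, which exposes u instead of
the root r. The inner vertices I and the blossoms (the classes of `cls`) are never stored; they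
exist only in the invariant `Search`. It says that in W u the inner vertices are matched to outer
ones, that a blossom has at most one vertex matched into I, and none if the blossom contains u.

Let u be outer and uv an edge. If v is another exposed vertex, then W u together with uv is an
augmentation. If v is unmet, it becomes inner and its partner becomes outer (`Search.grow`). If both
ends are outer, the component of u under W u and W v is a path from u to v, which uv closes to an
odd cycle. Rotating W u and W v around this cycle yields a matching exposing any given vertex of it,
so the whole component becomes outer. That the blossoms it meets merge into one is a counting
argument (`Search.merge`): if C meets j inner vertices it meets at most j + 1 blossoms, and in every
W x these inner vertices are matched to j different ones among them.

If no edge extends the search, every edge leaving a blossom ends in I. Blossoms are odd, so a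
perfect matching would send a vertex of each into I, while W r shows that there are more blossoms
than inner vertices (`Search.no_matching`).

The machine part uses programs whose loops are bounded by n or L. They are polynomial by
construction (`ForProg.exists_time_le`) and are verified through a denotational semantics. Only the
outermost loop, over the n^(2L) guesses, is a genuine `while`. -/

namespace ExactMatching

/-! ### Matchings as involutions, and the invariant of the augmenting path search -/

section Matchings

variable {V : Type*}

/-- `f` encodes a matching of the graph `H`: matched vertices are exchanged with their partners,
and the exposed vertices, which are the elements of `E`, are fixed. -/
structure MatchingMap (H : V → V → Prop) (E : Set V) (f : V → V) : Prop where
  invol : ∀ x, f (f x) = x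
  adj : ∀ x, f x ≠ x → H x (f x)
  fixed : ∀ x, f x = x ↔ x ∈ E

/-- The vertices reachable from `u` by applying `f` and `g`. -/
inductive Reach (f g : V → V) (u : V) : V → Prop
  | base : Reach f g u u
  | left {x : V} : Reach f g u x → Reach f g u (f x)
  | right {x : V} : Reach f g u x → Reach f g u (g x)

/-- In characteristic 2 the ones on an orbit {x, f x} cancel. All parity arguments about blossoms
and components rest on this. -/
theorem even_card_of_involution {S : Finset V} {f : V → V} (hS : ∀ x ∈ S, f x ∈ S)
    (hf : ∀ x ∈ S, f (f x) = x) (hne : ∀ x ∈ S, f x ≠ x) : Even S.card := by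
  have h : ∑ _x ∈ S, (1 : ZMod 2) = 0 :=
    Finset.sum_involution (fun x _ => f x) (fun _ _ => by decide) (fun x hx _ => hne x hx) hS hf
  rw [Finset.sum_const, nsmul_eq_mul, mul_one] at h
  exact (ZMod.natCast_eq_zero_iff_even).1 h

theorem odd_card_of_involution [DecidableEq V] {S : Finset V} {f : V → V} {u : V} (hu : u ∈ S)
    (hS : ∀ x ∈ S, x ≠ u → f x ∈ S ∧ f x ≠ u) (hf : ∀ x ∈ S, f (f x) = x)
    (hne : ∀ x ∈ S, x ≠ u → f x ≠ x) : Odd S.card := by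
  have h : Even (S.erase u).card := by
    apply even_card_of_involution (f := f)
    · intro x hx
      rw [Finset.mem_erase] at hx ⊢
      exact (hS x hx.2 hx.1).symm
    · exact fun x hx => hf x (Finset.mem_of_mem_erase hx)
    · intro x hx
      rw [Finset.mem_erase] at hx
      exact hne x hx.2 hx.1
  rw [← Finset.card_erase_add_one hu]
  exact h.add_one

/-- Replace the matching `f`, which misses `z`, by the one that contains `z y` instead of the edge
at `y`. -/
def swapAt [DecidableEq V] (f : V → V) (z y : V) : V → V :=
  fun x => if x = f y then f y else if x = z then y else if x = y then z else f x

theorem MatchingMap.swapAt [DecidableEq V] {H : V → V → Prop} (hH : ∀ x y, H x y → H y x)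
    {X : Set V} {f : V → V}
    {z y : V} (hf : MatchingMap H (insert z X) f) (hzy : H z y) (hz : z ∉ X) (hy : y ∉ X)
    (hne : y ≠ z) : MatchingMap H (insert (f y) X) (swapAt f z y) := by
  have hfz : f z = z := (hf.fixed z).2 (Set.mem_insert _ _)
  have hfy : f y ≠ y := fun h => by
    rcases (hf.fixed y).1 h with h | h
    exacts [hne h, hy h]
  have hi := hf.invol
  have hfyz : f y ≠ z := fun h => hne (by rw [← hi y, h, hfz])
  have hinj : ∀ {a b}, f a = f b → a = b := fun {a b} h => by rw [← hi a, h, hi]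
  have hv1 : ExactMatching.swapAt f z y (f y) = f y := by simp [ExactMatching.swapAt]
  have hv2 : ExactMatching.swapAt f z y z = y := by
    simp [ExactMatching.swapAt, hfyz.symm]
  have hv3 : ExactMatching.swapAt f z y y = z := by
    simp [ExactMatching.swapAt, hfy.symm, hne]
  have hv4 : ∀ x, x ≠ f y → x ≠ z → x ≠ y → ExactMatching.swapAt f z y x = f x := by
    intro x h1 h2 h3; simp [ExactMatching.swapAt, h1, h2, h3]
  refine ⟨fun x => ?_, fun x => ?_, fun x => ?_⟩
  · by_cases h1 : x = f y
    · rw [h1, hv1, hv1]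
    by_cases h2 : x = z
    · rw [h2, hv2, hv3]
    by_cases h3 : x = y
    · rw [h3, hv3, hv2]
    rw [hv4 x h1 h2 h3, hv4, hi]
    · exact fun h => h3 (hinj h)
    · exact fun h => h2 (by rw [← hi x, h, hfz])
    · exact fun h => h1 (by rw [← hi x, h])
  · by_cases h1 : x = f y
    · rw [h1, hv1]; exact fun h => absurd rfl h
    by_cases h2 : x = z
    · rw [h2, hv2]; exact fun _ => hzy
    by_cases h3 : x = y
    · rw [h3, hv3]; exact fun _ => hH _ _ hzy
    rw [hv4 x h1 h2 h3]; exact hf.adj x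
  · by_cases h1 : x = f y
    · rw [h1, hv1]; simp
    by_cases h2 : x = z
    · rw [h2, hv2]; simp [hne, hfyz.symm, hz]
    by_cases h3 : x = y
    · rw [h3, hv3]; simp [hne.symm, hfy.symm, hy]
    rw [hv4 x h1 h2 h3, hf.fixed]
    simp [h1, h2]

/-- Matching the two exposed vertices `u` and `v`. -/
def join [DecidableEq V] (f : V → V) (u v : V) : V → V :=
  fun x => if x = u then v else if x = v then u else f x

theorem MatchingMap.join [DecidableEq V] {H : V → V → Prop} (hH : ∀ x y, H x y → H y x)
    {E : Set V} {f : V → V}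
    {u v : V} (hf : MatchingMap H E f) (huv : H u v) (hu : u ∈ E) (hv : v ∈ E)
    (hne : u ≠ v) : MatchingMap H (E \ {u, v}) (join f u v) := by
  have hfu := (hf.fixed u).2 hu
  have hfv := (hf.fixed v).2 hv
  have hi := hf.invol
  have hv1 : ExactMatching.join f u v u = v := by simp [ExactMatching.join]
  have hv2 : ExactMatching.join f u v v = u := by simp [ExactMatching.join, hne.symm]
  have hv3 : ∀ x, x ≠ u → x ≠ v → ExactMatching.join f u v x = f x := by
    intro x h1 h2; simp [ExactMatching.join, h1, h2]
  refine ⟨fun x => ?_, fun x => ?_, fun x => ?_⟩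
  · by_cases h1 : x = u
    · rw [h1, hv1, hv2]
    by_cases h2 : x = v
    · rw [h2, hv2, hv1]
    rw [hv3 x h1 h2, hv3, hi]
    · exact fun h => h1 (by rw [← hi x, h, hfu])
    · exact fun h => h2 (by rw [← hi x, h, hfv])
  · by_cases h1 : x = u
    · rw [h1, hv1]; exact fun _ => huv
    by_cases h2 : x = v
    · rw [h2, hv2]; exact fun _ => hH _ _ huv
    rw [hv3 x h1 h2]; exact hf.adj x
  · by_cases h1 : x = u
    · rw [h1, hv1]; simp [hne.symm]
    by_cases h2 : x = v
    · rw [h2, hv2]; simp [hne]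
    rw [hv3 x h1 h2, hf.fixed]; simp [h1, h2]

/-- The state of the search for an augmenting path from the exposed vertex `r` of the matching `N`:
`D` is the set of vertices `u` for which a matching `W u` is known that exposes `u` instead of `r`,
`I` is the set of inner vertices, and `cls` partitions `D` into blossoms. -/
structure Search (H : V → V → Prop) (r : V) (X : Set V) (N : V → V) (D I : Finset V) (cls : V → V)
    (W : V → V → V) : Prop where
  matching : ∀ u ∈ D, MatchingMap H (insert u X) (W u)
  root : r ∈ D
  not_exposed : ∀ x ∈ D, x ∉ X
  inner_not_exposed : ∀ x ∈ I, x ∉ X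
  disj : ∀ x ∈ D, x ∉ I
  label : ∀ x ∈ D, cls x ∈ D
  inner : ∀ u ∈ D, ∀ y ∈ I, W u y ∈ D
  outside : ∀ u ∈ D, ∀ x, x ∉ D → x ∉ I → W u x = N x
  blossom : ∀ u ∈ D, ∀ b ∈ D, W u b ∈ I ∨ W u b ∈ D ∧ cls (W u b) = cls b
  uniq : ∀ u ∈ D, ∀ b ∈ D, ∀ b' ∈ D, cls b = cls b' → W u b ∈ I → W u b' ∈ I → b = b'
  base : ∀ u ∈ D, ∀ b ∈ D, cls u = cls b → W u b ∉ I
  -- The two blossoms are the parent and the child of y in the alternating tree.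
  ends : ∀ y ∈ I, ∃ a b, ∀ x ∈ D, cls (W x y) = a ∨ cls (W x y) = b

namespace Search

variable {H : V → V → Prop} {r : V} {X : Set V} {N : V → V} {D I : Finset V} {cls : V → V}
  {W : V → V → V}

theorem start (hN : MatchingMap H (insert r X) N) (hr : r ∉ X) :
    Search H r X N {r} ∅ id (fun _ => N) where
  matching := by simpa using hN
  root := by simp
  not_exposed := by simpa using hr
  inner_not_exposed := by simp
  disj := by simp
  label := by simp
  inner := by simp
  outside := by simp
  blossom := by simpa using (hN.fixed r).2 (by simp)
  uniq := by simp
  base := by simp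
  ends := by simp

theorem congr {W' : V → V → V} (h : Search H r X N D I cls W) (hW : ∀ u ∈ D, W' u = W u) :
    Search H r X N D I cls W' where
  matching u hu := by rw [hW u hu]; exact h.matching u hu
  root := h.root
  not_exposed := h.not_exposed
  inner_not_exposed := h.inner_not_exposed
  disj := h.disj
  label := h.label
  inner u hu := by rw [hW u hu]; exact h.inner u hu
  outside u hu := by rw [hW u hu]; exact h.outside u hu
  blossom u hu := by rw [hW u hu]; exact h.blossom u hu
  uniq u hu := by rw [hW u hu]; exact h.uniq u hu
  base u hu := by rw [hW u hu]; exact h.base u hu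
  ends y hy := by
    obtain ⟨a, b, hab⟩ := h.ends y hy
    exact ⟨a, b, fun x hx => by rw [hW x hx]; exact hab x hx⟩

/-- A vertex that the search has not met is not matched to one that it has met. -/
theorem outside_not_mem (h : Search H r X N D I cls W) {u x : V} (hu : u ∈ D) (hD : x ∉ D)
    (hI : x ∉ I) : W u x ∉ D ∧ W u x ∉ I := by
  have hi := (h.matching u hu).invol x
  constructor
  · intro hx
    have := h.blossom u hu _ hx
    rw [hi] at this
    rcases this with h1 | h1
    exacts [hI h1, hD h1.1]
  · intro hx
    have := h.inner u hu _ hx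
    rw [hi] at this
    exact hD this

variable [DecidableEq V]

/-- An unmet neighbour `v` of `u ∈ D` becomes inner and its partner enters `D`. -/
theorem grow (h : Search H r X N D I cls W) (hH : ∀ x y, H x y → H y x) {u v : V} (hu : u ∈ D)
    (huv : H u v) (hv : v ∉ D) (hvX : v ∉ X) (hw : W u v ∉ D) {W' : V → V → V}
    (hW : ∀ x ∈ D, W' x = W x) (hW' : W' (W u v) = swapAt (W u) u v) :
    ∃ cls', Search H r X N (insert (W u v) D) (insert v I) cls' W' := by
  have hvI : v ∉ I := fun hvI => hw (h.inner u hu v hvI)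
  obtain ⟨-, hwI⟩ := h.outside_not_mem hu hv hvI
  have hM := h.matching u hu
  have huX := h.not_exposed u hu
  have hvu : v ≠ u := fun e => hv (e ▸ hu)
  have hNv : ∀ x ∈ D, W x v = W u v := fun x hx => by
    rw [h.outside x hx v hv hvI, h.outside u hu v hv hvI]
  set w := W u v with hwdef
  have hww : W u w = v := hM.invol v
  have hNw : ∀ x ∈ D, W x w = v := fun x hx => by
    rw [← hNv x hx]; exact (h.matching x hx).invol v
  have hwv : w ≠ v := fun e => by
    rcases (hM.fixed v).1 e with e | e
    exacts [hvu e, hvX e]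
  have hwX : w ∉ X := fun e => by
    have := (hM.fixed w).2 (Set.mem_insert_of_mem _ e)
    rw [hww] at this; exact hwv this.symm
  have hwu : w ≠ u := fun e => hw (e ▸ hu)
  have hWw : W' w = swapAt (W u) u v := hW'
  have e1 : W' w w = w := by rw [hWw]; simp [swapAt, ← hwdef]
  have e2 : W' w u = v := by rw [hWw]; simp [swapAt, ← hwdef, hwu.symm]
  have e3 : W' w v = u := by rw [hWw]; simp [swapAt, ← hwdef, hwv.symm, hvu]
  have e4 : ∀ x, x ≠ w → x ≠ u → x ≠ v → W' w x = W u x := by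
    intro x h1 h2 h3; rw [hWw]; simp [swapAt, ← hwdef, h1, h2, h3]
  have hcD : ∀ x ∈ D, x ≠ w := fun x hx e => hw (e ▸ hx)
  have hcl : ∀ x ∈ D, cls x ≠ w := fun x hx e => hw (e ▸ h.label x hx)
  have hcI : ∀ y ∈ I, y ≠ w ∧ y ≠ u ∧ y ≠ v := fun y hy =>
    ⟨fun e => hwI (e ▸ hy), fun e => h.disj u hu (e ▸ hy), fun e => hvI (e ▸ hy)⟩
  let cls' : V → V := fun x => if x = w then w else cls x
  have hcw : cls' w = w := by simp [cls']
  have hc : ∀ x ∈ D, cls' x = cls x := fun x hx => by simp [cls', hcD x hx]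
  have hcne : ∀ x ∈ D, cls' x ≠ w := fun x hx => by rw [hc x hx]; exact hcl x hx
  have hWb : ∀ x ∈ D, ∀ b ∈ D, W x b ≠ v := fun x hx b hb e => hw (by
    have := (h.matching x hx).invol b
    rw [e, hNv x hx] at this; rw [this]; exact hb)
  have hWw' : ∀ b ∈ D, b ≠ u → W' w b = W u b := fun b hb hbu =>
    e4 b (hcD b hb) hbu (fun e => hv (e ▸ hb))
  refine ⟨cls', ?_⟩
  constructor
  · intro x hx
    rcases Finset.mem_insert.1 hx with rfl | hx
    · rw [hWw]; exact hM.swapAt hH huv huX hvX hvu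
    · rw [hW x hx]; exact h.matching x hx
  · exact Finset.mem_insert_of_mem h.root
  · intro x hx
    rcases Finset.mem_insert.1 hx with rfl | hx
    exacts [hwX, h.not_exposed x hx]
  · intro x hx
    rcases Finset.mem_insert.1 hx with rfl | hx
    exacts [hvX, h.inner_not_exposed x hx]
  · intro x hx
    rw [Finset.mem_insert, not_or]
    rcases Finset.mem_insert.1 hx with rfl | hx
    exacts [⟨hwv, hwI⟩, ⟨fun e => hv (e ▸ hx), h.disj x hx⟩]
  · intro x hx
    rcases Finset.mem_insert.1 hx with rfl | hx
    · rw [hcw]; exact Finset.mem_insert_self _ _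
    · rw [hc x hx]; exact Finset.mem_insert_of_mem (h.label x hx)
  · intro x hx y hy
    rcases Finset.mem_insert.1 hx with hx | hx <;> rcases Finset.mem_insert.1 hy with hy | hy
    · rw [hx, hy, e3]; exact Finset.mem_insert_of_mem hu
    · rw [hx, e4 y (hcI y hy).1 (hcI y hy).2.1 (hcI y hy).2.2]
      exact Finset.mem_insert_of_mem (h.inner u hu y hy)
    · rw [hy, hW x hx, hNv x hx]; exact Finset.mem_insert_self _ _
    · rw [hW x hx]; exact Finset.mem_insert_of_mem (h.inner x hx y hy)
  · intro x hx y hyD hyI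
    rw [Finset.mem_insert, not_or] at hyD hyI
    rcases Finset.mem_insert.1 hx with rfl | hx
    · rw [e4 y hyD.1 (fun e => hyD.2 (e ▸ hu)) hyI.1]
      exact h.outside u hu y hyD.2 hyI.2
    · rw [hW x hx]; exact h.outside x hx y hyD.2 hyI.2
  · intro x hx b hb
    have key : ∀ x ∈ D, ∀ b ∈ D,
        W x b ∈ insert v I ∨ W x b ∈ insert w D ∧ cls' (W x b) = cls' b := by
      intro x hx b hb
      rcases h.blossom x hx b hb with h1 | ⟨h1, h2⟩
      · exact Or.inl (Finset.mem_insert_of_mem h1)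
      · refine Or.inr ⟨Finset.mem_insert_of_mem h1, ?_⟩
        rw [hc _ h1, hc b hb, h2]
    rcases Finset.mem_insert.1 hx with hx | hx <;> rcases Finset.mem_insert.1 hb with hb | hb
    · rw [hx, hb, e1]; exact Or.inr ⟨Finset.mem_insert_self _ _, rfl⟩
    · rw [hx]
      by_cases hbu : b = u
      · rw [hbu, e2]; exact Or.inl (Finset.mem_insert_self _ _)
      · rw [hWw' b hb hbu]; exact key u hu b hb
    · rw [hb, hW x hx, hNw x hx]; exact Or.inl (Finset.mem_insert_self _ _)
    · rw [hW x hx]; exact key x hx b hb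
  · intro x hx b hb b' hb' hbb h1 h2
    rcases Finset.mem_insert.1 hb with rfl | hb <;> rcases Finset.mem_insert.1 hb' with rfl | hb'
    · rfl
    · rw [hcw] at hbb; exact absurd hbb.symm (hcne b' hb')
    · rw [hcw] at hbb; exact absurd hbb (hcne b hb)
    rw [hc b hb, hc b' hb'] at hbb
    have key : ∀ x ∈ D, ∀ b ∈ D, W x b ∈ insert v I → W x b ∈ I := fun x hx b hb h3 =>
      (Finset.mem_insert.1 h3).resolve_left (hWb x hx b hb)
    rcases Finset.mem_insert.1 hx with rfl | hx
    -- In the new row u is matched to the inner vertex v. By `base` the blossom of u had no vertex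
    -- matched to I in `W u`, so u is the only one now.
    · by_cases hbu : b = u <;> by_cases hbu' : b' = u
      · rw [hbu, hbu']
      · rw [hWw' b' hb' hbu'] at h2
        exact absurd (key u hu b' hb' h2) (h.base u hu b' hb' (hbu ▸ hbb))
      · rw [hWw' b hb hbu] at h1
        exact absurd (key u hu b hb h1) (h.base u hu b hb (hbu' ▸ hbb.symm))
      · rw [hWw' b hb hbu] at h1
        rw [hWw' b' hb' hbu'] at h2
        exact h.uniq u hu b hb b' hb' hbb (key u hu b hb h1) (key u hu b' hb' h2)
    · rw [hW x hx] at h1 h2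
      exact h.uniq x hx b hb b' hb' hbb (key x hx b hb h1) (key x hx b' hb' h2)
  · intro x hx b hb hxb hi
    rcases Finset.mem_insert.1 hx with rfl | hx <;> rcases Finset.mem_insert.1 hb with rfl | hb
    · rw [e1] at hi
      rcases Finset.mem_insert.1 hi with e | e
      exacts [hwv e, hwI e]
    · rw [hcw] at hxb; exact hcne b hb hxb.symm
    · rw [hcw] at hxb; exact hcne x hx hxb
    · rw [hW x hx] at hi
      rw [hc x hx, hc b hb] at hxb
      exact h.base x hx b hb hxb ((Finset.mem_insert.1 hi).resolve_left (hWb x hx b hb))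
  · intro y hy
    rcases Finset.mem_insert.1 hy with rfl | hy
    -- The parent blossom of v is that of u, used only in the row of w; its child is the new blossom
    -- {w}.
    · refine ⟨cls u, w, fun x hx => ?_⟩
      rcases Finset.mem_insert.1 hx with rfl | hx
      · rw [e3, hc u hu]; exact Or.inl rfl
      · rw [hW x hx, hNv x hx, hcw]; exact Or.inr rfl
    · obtain ⟨a, b, hab⟩ := h.ends y hy
      refine ⟨a, b, fun x hx => ?_⟩
      rcases Finset.mem_insert.1 hx with rfl | hx
      · rw [e4 y (hcI y hy).1 (hcI y hy).2.1 (hcI y hy).2.2, hc _ (h.inner u hu y hy)]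
        exact hab u hu
      · rw [hW x hx, hc _ (h.inner x hx y hy)]; exact hab x hx

end Search

end Matchings

end ExactMatching

namespace ExactMatching

/-! ### Merging blossoms by counting, and the Tutte violator of a finished search -/

section Blossoms

variable {V : Type*} [DecidableEq V] {H : V → V → Prop} {r : V} {X : Set V} {N : V → V}
  {D I : Finset V} {cls : V → V} {W : V → V → V}

namespace Search

omit [DecidableEq V] in
theorem mem_of_reach (h : Search H r X N D I cls W) {u v x : V} (hu : u ∈ D) (hv : v ∈ D)
    (hx : Reach (W u) (W v) u x) : x ∈ D ∨ x ∈ I := by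
  have key : ∀ w ∈ D, ∀ x, (x ∈ D ∨ x ∈ I) → W w x ∈ D ∨ W w x ∈ I := by
    rintro w hw x (hx | hx)
    · rcases h.blossom w hw x hx with h1 | h1
      exacts [Or.inr h1, Or.inl h1.1]
    · exact Or.inl (h.inner w hw x hx)
  induction hx with
  | base => exact Or.inl hu
  | left _ ih => exact key u hu _ ih
  | right _ ih => exact key v hv _ ih

omit [DecidableEq V] in
-- All other vertices exposed by `W u` lie in X, which the search never meets.
theorem fixed_of_mem (h : Search H r X N D I cls W) {u x : V} (hu : u ∈ D) (hx : x ∈ D ∨ x ∈ I)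
    (hf : W u x = x) : x = u := by
  rcases ((h.matching u hu).fixed x).1 hf with h1 | h1
  · exact h1
  · rcases hx with hx | hx
    exacts [absurd h1 (h.not_exposed x hx), absurd h1 (h.inner_not_exposed x hx)]

/-- The alternating component of `u` contains `v`, by parity. -/
theorem mem_component (h : Search H r X N D I cls W) {u v : V} (hu : u ∈ D) (hv : v ∈ D)
    {C : Finset V} (hC : ∀ x, x ∈ C ↔ Reach (W u) (W v) u x) : v ∈ C := by
  by_contra hvC
  have huC : u ∈ C := (hC u).2 .base
  have hDI : ∀ x ∈ C, x ∈ D ∨ x ∈ I := fun x hx => h.mem_of_reach hu hv ((hC x).1 hx)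
  have h1 : Odd C.card := by
    apply odd_card_of_involution (f := W u) huC
    · intro x hx hxu
      refine ⟨(hC _).2 ((hC x).1 hx).left, fun e => hxu ?_⟩
      have := (h.matching u hu).invol x
      rw [e] at this
      rw [← this]; exact ((h.matching u hu).fixed u).2 (Set.mem_insert _ _)
    · exact fun x _ => (h.matching u hu).invol x
    · exact fun x hx hxu hf => hxu (h.fixed_of_mem hu (hDI x hx) hf)
  have h2 : Even C.card := by
    apply even_card_of_involution (f := W v)
    · exact fun x hx => (hC _).2 ((hC x).1 hx).right
    · exact fun x _ => (h.matching v hv).invol x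
    · exact fun x hx hf => hvC (h.fixed_of_mem hv (hDI x hx) hf ▸ hx)
  exact (Nat.not_even_iff_odd.2 h1) h2

omit [DecidableEq V] in
/-- A set that avoids `u` and is closed in the component of `u` does not meet this component. -/
theorem not_mem_of_closed (h : Search H r X N D I cls W) {u v : V} (hu : u ∈ D) (hv : v ∈ D)
    {C : Finset V} (hC : ∀ x, x ∈ C ↔ Reach (W u) (W v) u x) {S : Set V} (huS : u ∉ S)
    (hl : ∀ x ∈ S, x ∈ C → W u x ∈ S) (hr : ∀ x ∈ S, x ∈ C → W v x ∈ S) :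
    ∀ x ∈ C, x ∉ S := by
  intro x hx
  rw [hC] at hx
  induction hx with
  | base => exact huS
  | @left x hx ih =>
    intro hS
    apply ih
    rw [← (h.matching u hu).invol x]
    exact hl _ hS ((hC _).2 hx.left)
  | @right x hx ih =>
    intro hS
    apply ih
    rw [← (h.matching v hv).invol x]
    exact hr _ hS ((hC _).2 hx.right)

omit [DecidableEq V] in
/-- The two matching edges at an inner vertex of the component lead to different blossoms. -/
theorem cls_ne (h : Search H r X N D I cls W) {u v : V} (hu : u ∈ D) (hv : v ∈ D)
    {C : Finset V} (hC : ∀ x, x ∈ C ↔ Reach (W u) (W v) u x) {y : V} (hy : y ∈ C) (hyI : y ∈ I) :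
    cls (W u y) ≠ cls (W v y) := by
  intro he
  have hMu := (h.matching u hu).invol
  have hMv := (h.matching v hv).invol
  have huy := h.inner u hu y hyI
  have hvy := h.inner v hv y hyI
  have huI : W u (W u y) ∈ I := by rw [hMu]; exact hyI
  have hvI : W v (W v y) ∈ I := by rw [hMv]; exact hyI
  -- If both edges led to the same blossom, this blossom together with y would be closed in the
  -- component, since by `uniq` the edges to y are its only edges into I. But by `base` it does not
  -- contain u.
  apply h.not_mem_of_closed hu hv hC (S := {x | x = y ∨ x ∈ D ∧ cls x = cls (W u y)}) _ _ _ y hy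
    (Or.inl rfl)
  · rintro (e | ⟨-, e⟩)
    · exact h.disj u hu (e ▸ hyI)
    · exact h.base u hu _ huy e huI
  · rintro x (rfl | ⟨hx, e⟩) _
    · exact Or.inr ⟨huy, rfl⟩
    · rcases h.blossom u hu x hx with h1 | h1
      · left; rw [h.uniq u hu x hx _ huy e h1 huI, hMu]
      · exact Or.inr ⟨h1.1, h1.2.trans e⟩
  · rintro x (rfl | ⟨hx, e⟩) _
    · exact Or.inr ⟨hvy, he.symm⟩
    · rcases h.blossom v hv x hx with h1 | h1
      · left; rw [h.uniq v hv x hx _ hvy (e.trans he) h1 hvI, hMv]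
      · exact Or.inr ⟨h1.1, h1.2.trans e⟩

/-- Every blossom met by the component, except that of `u`, is joined by an edge of `W u` to an
inner vertex of the component. -/
theorem exists_inner (h : Search H r X N D I cls W) {u v : V} (hu : u ∈ D) (hv : v ∈ D)
    {C : Finset V} (hC : ∀ x, x ∈ C ↔ Reach (W u) (W v) u x) {p : V} (hp : p ∈ C) (hpD : p ∈ D)
    (hpu : cls p ≠ cls u) : ∃ y ∈ C, y ∈ I ∧ cls (W u y) = cls p := by
  by_contra hno
  push Not at hno
  have hMu := (h.matching u hu).invol
  have hMv := (h.matching v hv).invol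
  let B : Finset V := C.filter (fun x => x ∈ D ∧ cls x = cls p)
  have hB : ∀ x, x ∈ B ↔ x ∈ C ∧ x ∈ D ∧ cls x = cls p := fun x => by simp [B]
  have hvC := h.mem_component hu hv hC
  have hl : ∀ x ∈ B, W u x ∈ B := by
    intro x hx
    rw [hB] at hx ⊢
    have hxC : W u x ∈ C := (hC _).2 ((hC x).1 hx.1).left
    rcases h.blossom u hu x hx.2.1 with h1 | h1
    · exact absurd (by rw [hMu]; exact hx.2.2) (hno _ hxC h1)
    · exact ⟨hxC, h1.1, h1.2.trans hx.2.2⟩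
  -- B is the part of the component in the blossom of p. Under the assumption it is closed under `W
  -- u`, whose only fixed point in the component is u, which is not in B.
  have heven : Even B.card := by
    apply even_card_of_involution (f := W u) hl (fun x _ => hMu x)
    intro x hx hf
    rw [hB] at hx
    have := h.fixed_of_mem hu (Or.inl hx.2.1) hf
    rw [this] at hx
    exact hpu hx.2.2.symm
  -- Under `W v` exactly one vertex of B has no partner in B: either v itself, or the unique vertex
  -- matched to I. The latter exists because otherwise B would be closed in the component without
  -- containing u.
  have hodd : Odd B.card := by
    by_cases hvB : cls v = cls p
    · have hvB' : v ∈ B := (hB v).2 ⟨hvC, hv, hvB⟩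
      have hvv : W v v = v := ((h.matching v hv).fixed v).2 (Set.mem_insert _ _)
      apply odd_card_of_involution (f := W v) hvB' _ (fun x _ => hMv x)
      · exact fun x hx hxv hf => hxv (h.fixed_of_mem hv (Or.inl ((hB x).1 hx).2.1) hf)
      · intro x hx hxv
        refine ⟨?_, fun e => hxv (by rw [← hMv x, e, hvv])⟩
        rw [hB] at hx ⊢
        have hxC : W v x ∈ C := (hC _).2 ((hC x).1 hx.1).right
        rcases h.blossom v hv x hx.2.1 with h1 | h1
        · exact absurd h1 (h.base v hv x hx.2.1 (hvB.trans hx.2.2.symm))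
        · exact ⟨hxC, h1.1, h1.2.trans hx.2.2⟩
    · have hout : ∃ b ∈ B, W v b ∈ I := by
        by_contra hno'
        push Not at hno'
        refine h.not_mem_of_closed hu hv hC (S := {x | x ∈ B}) ?_ (fun x hx _ => hl x hx) ?_ p hp
          ((hB p).2 ⟨hp, hpD, rfl⟩)
        · exact fun e => hpu ((hB u).1 e).2.2.symm
        · intro x hx _
          have hx' := (hB x).1 hx
          rcases h.blossom v hv x hx'.2.1 with h1 | h1
          · exact absurd h1 (hno' x hx)
          · exact (hB _).2 ⟨(hC _).2 ((hC x).1 hx'.1).right, h1.1, h1.2.trans hx'.2.2⟩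
      obtain ⟨b, hb, hbI⟩ := hout
      have hb' := (hB b).1 hb
      apply odd_card_of_involution (f := W v) hb _ (fun x _ => hMv x)
      · intro x hx _ hf
        have := h.fixed_of_mem hv (Or.inl ((hB x).1 hx).2.1) hf
        exact hvB (this ▸ ((hB x).1 hx).2.2)
      · intro x hx hxb
        have hx' := (hB x).1 hx
        have hxI : W v x ∉ I := fun h1 =>
          hxb (h.uniq v hv x hx'.2.1 b hb'.2.1 (hx'.2.2.trans hb'.2.2.symm) h1 hbI)
        have h1 := (h.blossom v hv x hx'.2.1).resolve_left hxI
        refine ⟨(hB _).2 ⟨(hC _).2 ((hC x).1 hx'.1).right, h1.1, h1.2.trans hx'.2.2⟩, ?_⟩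
        intro e
        have : W v b = x := by rw [← e, hMv]
        exact h.disj x hx'.2.1 (this ▸ hbI)
  exact (Nat.not_even_iff_odd.2 hodd) heven

/-- The component of two adjacent elements of `D` is merged into one blossom. -/
theorem merge (h : Search H r X N D I cls W) {u v : V} (hu : u ∈ D) (hv : v ∈ D)
    {C : Finset V} (hC : ∀ x, x ∈ C ↔ Reach (W u) (W v) u x) {W' : V → V → V}
    (hW : ∀ x ∈ D, W' x = W x)
    (hW' : ∀ p ∈ C, p ∉ D → MatchingMap H (insert p X) (W' p) ∧
      ((∀ x, x ∉ C → W' p x = W u x) ∨ (∀ x, x ∉ C → W' p x = W v x))) :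
    ∃ cls', Search H r X N (D ∪ C) (I \ C) cls' W' := by
  have hDI : ∀ x ∈ C, x ∈ D ∨ x ∈ I := fun x hx => h.mem_of_reach hu hv ((hC x).1 hx)
  have huC : u ∈ C := (hC u).2 .base
  have hvC := h.mem_component hu hv hC
  have hMi : ∀ x ∈ D, ∀ y, W x (W x y) = y := fun x hx => (h.matching x hx).invol
  let τ : Finset V := (C.filter (· ∈ D)).image cls
  have hτ : ∀ p ∈ C, p ∈ D → cls p ∈ τ := fun p hp hpD =>
    Finset.mem_image_of_mem _ (Finset.mem_filter.2 ⟨hp, hpD⟩)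
  have huτ : cls u ∈ τ := hτ u huC hu
  let J : Finset V := C.filter (· ∈ I)
  have hJ : ∀ y, y ∈ J ↔ y ∈ C ∧ y ∈ I := fun y => by simp [J]
  -- By `cls_ne` the rows of u and v already realise both blossoms that `ends` allows at y, and both
  -- of them meet C.
  have hends : ∀ x ∈ D, ∀ y ∈ J, cls (W x y) ∈ τ := by
    intro x hx y hy
    obtain ⟨hyC, hyI⟩ := (hJ y).1 hy
    have h1 := hτ _ ((hC _).2 ((hC y).1 hyC).left) (h.inner u hu y hyI)
    have h2 := hτ _ ((hC _).2 ((hC y).1 hyC).right) (h.inner v hv y hyI)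
    have hne := h.cls_ne hu hv hC hyC hyI
    obtain ⟨a, b, hab⟩ := h.ends y hyI
    rcases hab u hu with h3 | h3 <;> rcases hab v hv with h4 | h4
    · exact absurd (h3.trans h4.symm) hne
    · rcases hab x hx with h5 | h5
      exacts [(h5.trans h3.symm) ▸ h1, (h5.trans h4.symm) ▸ h2]
    · rcases hab x hx with h5 | h5
      exacts [(h5.trans h4.symm) ▸ h2, (h5.trans h3.symm) ▸ h1]
    · exact absurd (h3.trans h4.symm) hne
  have hinj : ∀ x ∈ D, Set.InjOn (fun y => cls (W x y)) (J : Set V) := by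
    intro x hx y hy y' hy' e
    have hyI := ((hJ y).1 hy).2
    have hyI' := ((hJ y').1 hy').2
    have := h.uniq x hx _ (h.inner x hx y hyI) _ (h.inner x hx y' hyI') e
      (by rw [hMi x hx]; exact hyI) (by rw [hMi x hx]; exact hyI')
    rw [← hMi x hx y, this, hMi x hx]
  have hbase : ∀ x ∈ D, ∀ y ∈ J, cls (W x y) ≠ cls x := by
    intro x hx y hy e
    have hyI := ((hJ y).1 hy).2
    exact h.base x hx _ (h.inner x hx y hyI) e.symm (by rw [hMi x hx]; exact hyI)
  have hcard : τ.card ≤ J.card + 1 := by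
    have : τ ⊆ insert (cls u) (J.image (fun y => cls (W u y))) := by
      intro t ht
      obtain ⟨p, hp, rfl⟩ := Finset.mem_image.1 ht
      obtain ⟨hpC, hpD⟩ := Finset.mem_filter.1 hp
      by_cases e : cls p = cls u
      · rw [e]; exact Finset.mem_insert_self _ _
      · obtain ⟨y, hy, hyI, hyp⟩ := h.exists_inner hu hv hC hpC hpD e
        exact Finset.mem_insert_of_mem (Finset.mem_image.2 ⟨y, (hJ y).2 ⟨hy, hyI⟩, hyp⟩)
    calc τ.card ≤ _ := Finset.card_le_card this
      _ ≤ _ := Finset.card_insert_le _ _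
      _ ≤ _ := Nat.add_le_add_right Finset.card_image_le 1
  have hout : ∀ x ∈ D, ∀ b ∈ D, W x b ∈ I → W x b ∉ C → ∀ y ∈ J, cls (W x y) ≠ cls b := by
    intro x hx b hb h1 h2 y hy e
    have hyI := ((hJ y).1 hy).2
    have := h.uniq x hx _ (h.inner x hx y hyI) b hb e (by rw [hMi x hx]; exact hyI) h1
    rw [← this, hMi x hx] at h2
    exact h2 ((hJ y).1 hy).1
  -- Every `W x` induces an injection of J into τ, and τ has at most one element more than J. So at
  -- most one blossom of τ is left without an edge of `W x` to J; this is why the union behaves like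
  -- a single blossom.
  have hsub : ∀ x ∈ D, ∀ t₁ ∈ τ, ∀ t₂ ∈ τ, (∀ y ∈ J, cls (W x y) ≠ t₁) →
      (∀ y ∈ J, cls (W x y) ≠ t₂) → t₁ = t₂ := by
    intro x hx t₁ h₁ t₂ h₂ hn₁ hn₂
    by_contra hne
    have h3 : J.image (fun y => cls (W x y)) ⊆ (τ.erase t₁).erase t₂ := by
      intro t ht
      obtain ⟨y, hy, rfl⟩ := Finset.mem_image.1 ht
      exact Finset.mem_erase.2 ⟨hn₂ y hy, Finset.mem_erase.2 ⟨hn₁ y hy, hends x hx y hy⟩⟩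
    have h4 := Finset.card_le_card h3
    rw [Finset.card_image_of_injOn (hinj x hx)] at h4
    have h5 := Finset.card_erase_add_one h₁
    have h6 := Finset.card_erase_add_one (Finset.mem_erase.2 ⟨Ne.symm hne, h₂⟩)
    omega
  -- By `base` the exceptional blossom is that of x, which has no edge of `W x` into I at all. A
  -- blossom of τ with such an edge leaving C would be exceptional too, by `uniq`.
  have claimA : ∀ x ∈ D, cls x ∈ τ → ∀ b ∈ D, cls b ∈ τ → W x b ∈ I → W x b ∈ C := by
    intro x hx hxτ b hb hbτ h1
    by_contra h2
    have := hsub x hx _ hxτ _ hbτ (hbase x hx) (hout x hx b hb h1 h2)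
    exact h.base x hx b hb this h1
  have claimB : ∀ x ∈ D, ∀ b ∈ D, ∀ b' ∈ D, cls b ∈ τ → cls b' ∈ τ → W x b ∈ I → W x b' ∈ I →
      W x b ∉ C → W x b' ∉ C → b = b' := by
    intro x hx b hb b' hb' h1 h2 h3 h4 h5 h6
    exact h.uniq x hx b hb b' hb'
      (hsub x hx _ h1 _ h2 (hout x hx b hb h3 h5) (hout x hx b' hb' h4 h6)) h3 h4
  let g : V → V := fun t => if t ∈ τ then cls u else t
  let cls' : V → V := fun x => if x ∈ C then cls u else g (cls x)
  have hg : ∀ t ∈ τ, g t = cls u := fun t ht => by simp [g, ht]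
  have hg' : ∀ t, t ∉ τ → g t = t := fun t ht => by simp [g, ht]
  have hcC : ∀ x ∈ C, cls' x = cls u := fun x hx => by simp [cls', hx]
  have hcD : ∀ x ∈ D, cls' x = g (cls x) := by
    intro x hx
    by_cases hxC : x ∈ C
    · rw [hcC x hxC, hg _ (hτ x hxC hx)]
    · simp [cls', hxC]
  have hgu : ∀ t, g t = cls u → t ∈ τ := fun t ht => by
    by_contra hn; rw [hg' t hn] at ht; exact hn (ht ▸ huτ)
  have hgg : ∀ t t', g t = g t' → t = t' ∨ t ∈ τ ∧ t' ∈ τ := fun t t' e => by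
    by_cases h1 : t ∈ τ
    · rw [hg t h1] at e; exact Or.inr ⟨h1, hgu t' e.symm⟩
    · by_cases h2 : t' ∈ τ
      · rw [hg t' h2] at e; exact Or.inr ⟨hgu t e, h2⟩
      · rw [hg' t h1, hg' t' h2] at e; exact Or.inl e
  -- A new row preserves C, and outside of C it agrees with the row of u or of v, which belong to
  -- the same merged blossom. So everything proved for old rows carries over to it.
  have hrow : ∀ p ∈ C, p ∉ D → (∀ x ∈ C, W' p x ∈ C) ∧
      ∃ w ∈ C, w ∈ D ∧ ∀ x, x ∉ C → W' p x = W w x := by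
    intro p hp hpD
    obtain ⟨hM, hoff⟩ := hW' p hp hpD
    have hex : ∃ w ∈ C, w ∈ D ∧ (∀ x ∈ C, W w x ∈ C) ∧ ∀ x, x ∉ C → W' p x = W w x := by
      rcases hoff with h1 | h1
      · exact ⟨u, huC, hu, fun x hx => (hC _).2 ((hC x).1 hx).left, h1⟩
      · exact ⟨v, hvC, hv, fun x hx => (hC _).2 ((hC x).1 hx).right, h1⟩
    obtain ⟨w, hwC, hwD, hcl, hw⟩ := hex
    refine ⟨fun x hx => ?_, w, hwC, hwD, hw⟩
    by_contra hn
    have h1 := hM.invol x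
    rw [hw _ hn] at h1
    have h2 : W' p x = W w x := by rw [← h1, hMi w hwD, h1]
    exact hn (h2 ▸ hcl x hx)
  have hDC : ∀ {x}, x ∈ D ∪ C → x ∈ D ∨ x ∈ C ∧ x ∉ D ∧ x ∈ I := fun {x} hx => by
    by_cases hxD : x ∈ D
    · exact Or.inl hxD
    · have hxC := (Finset.mem_union.1 hx).resolve_left hxD
      exact Or.inr ⟨hxC, hxD, (hDI x hxC).resolve_left hxD⟩
  have toD : ∀ {x}, x ∈ D → x ∈ D ∪ C := fun hx => Finset.mem_union_left _ hx
  have hIC : ∀ {y}, y ∈ I \ C → y ∈ I ∧ y ∉ C := fun hy => Finset.mem_sdiff.1 hy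
  refine ⟨cls', ?_⟩
  constructor
  · intro x hx
    rcases hDC hx with hx | ⟨hx, hxD, -⟩
    · rw [hW x hx]; exact h.matching x hx
    · exact (hW' x hx hxD).1
  · exact toD h.root
  · intro x hx
    rcases hDC hx with hx | ⟨hx, hxD, hxI⟩
    exacts [h.not_exposed x hx, h.inner_not_exposed x hxI]
  · exact fun x hx => h.inner_not_exposed x (hIC hx).1
  · intro x hx hxI
    rcases hDC hx with hx | ⟨hx, -, -⟩
    exacts [h.disj x hx (hIC hxI).1, (hIC hxI).2 hx]
  · intro x hx
    rcases hDC hx with hx | ⟨hx, -, -⟩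
    · rw [hcD x hx]
      by_cases ht : cls x ∈ τ
      · rw [hg _ ht]; exact toD (h.label u hu)
      · rw [hg' _ ht]; exact toD (h.label x hx)
    · rw [hcC x hx]; exact toD (h.label u hu)
  · intro x hx y hy
    rcases hDC hx with hx | ⟨hx, hxD, -⟩
    · rw [hW x hx]; exact toD (h.inner x hx y (hIC hy).1)
    · obtain ⟨-, w, -, hwD, hw⟩ := hrow x hx hxD
      rw [hw y (hIC hy).2]; exact toD (h.inner w hwD y (hIC hy).1)
  · intro x hx y hyD hyI
    have hyC : y ∉ C := fun e => hyD (Finset.mem_union_right _ e)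
    have hyD' : y ∉ D := fun e => hyD (toD e)
    have hyI' : y ∉ I := fun e => hyI (Finset.mem_sdiff.2 ⟨e, hyC⟩)
    rcases hDC hx with hx | ⟨hx, hxD, -⟩
    · rw [hW x hx]; exact h.outside x hx y hyD' hyI'
    · obtain ⟨-, w, -, hwD, hw⟩ := hrow x hx hxD
      rw [hw y hyC]; exact h.outside w hwD y hyD' hyI'
  · intro x hx b hb
    have key : ∀ x ∈ D, ∀ b ∈ D ∪ C,
        W x b ∈ I \ C ∨ W x b ∈ D ∪ C ∧ cls' (W x b) = cls' b := by
      intro x hx b hb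
      rcases hDC hb with hb | ⟨hb, -, hbI⟩
      · rcases h.blossom x hx b hb with h1 | ⟨h1, h2⟩
        · by_cases h3 : W x b ∈ C
          · refine Or.inr ⟨Finset.mem_union_right _ h3, ?_⟩
            have := hends x hx _ ((hJ _).2 ⟨h3, h1⟩)
            rw [hMi x hx] at this
            rw [hcC _ h3, hcD b hb, hg _ this]
          · exact Or.inl (Finset.mem_sdiff.2 ⟨h1, h3⟩)
        · exact Or.inr ⟨toD h1, by rw [hcD _ h1, hcD b hb, h2]⟩
      · have h1 := h.inner x hx b hbI
        refine Or.inr ⟨toD h1, ?_⟩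
        rw [hcD _ h1, hcC b hb, hg _ (hends x hx b ((hJ b).2 ⟨hb, hbI⟩))]
    rcases hDC hx with hx | ⟨hx, hxD, -⟩
    · rw [hW x hx]; exact key x hx b hb
    · obtain ⟨hcl, w, -, hwD, hw⟩ := hrow x hx hxD
      by_cases hbC : b ∈ C
      · refine Or.inr ⟨Finset.mem_union_right _ (hcl b hbC), ?_⟩
        rw [hcC b hbC, hcC _ (hcl b hbC)]
      · rw [hw b hbC]; exact key w hwD b hb
  · have key : ∀ x ∈ D, ∀ b ∈ D ∪ C, ∀ b' ∈ D ∪ C, cls' b = cls' b' → W x b ∈ I \ C →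
        W x b' ∈ I \ C → b = b' := by
      intro x hx b hb b' hb' e h1 h2
      have aux : ∀ b ∈ D ∪ C, W x b ∈ I \ C → b ∈ D := by
        intro b hb h1
        rcases hDC hb with hb | ⟨hb, -, hbI⟩
        · exact hb
        · exact absurd (hIC h1).1 (h.disj _ (h.inner x hx b hbI))
      have hbD := aux b hb h1
      have hbD' := aux b' hb' h2
      rw [hcD b hbD, hcD b' hbD'] at e
      rcases hgg _ _ e with e | ⟨e, e'⟩
      · exact h.uniq x hx b hbD b' hbD' e (hIC h1).1 (hIC h2).1
      · exact claimB x hx b hbD b' hbD' e e' (hIC h1).1 (hIC h2).1 (hIC h1).2 (hIC h2).2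
    intro x hx b hb b' hb' e h1 h2
    rcases hDC hx with hx | ⟨hx, hxD, -⟩
    · rw [hW x hx] at h1 h2; exact key x hx b hb b' hb' e h1 h2
    · obtain ⟨hcl, w, -, hwD, hw⟩ := hrow x hx hxD
      have hbC : b ∉ C := fun hbC => (hIC h1).2 (hcl b hbC)
      have hbC' : b' ∉ C := fun hbC => (hIC h2).2 (hcl b' hbC)
      rw [hw b hbC] at h1
      rw [hw b' hbC'] at h2
      exact key w hwD b hb b' hb' e h1 h2
  · have key : ∀ x ∈ D, ∀ b ∈ D ∪ C, cls' x = cls' b → W x b ∉ I \ C := by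
      intro x hx b hb e h1
      rcases hDC hb with hb | ⟨hb, -, hbI⟩
      · rw [hcD x hx, hcD b hb] at e
        rcases hgg _ _ e with e | ⟨e, e'⟩
        · exact h.base x hx b hb e (hIC h1).1
        · exact (hIC h1).2 (claimA x hx e b hb e' (hIC h1).1)
      · exact h.disj _ (h.inner x hx b hbI) (hIC h1).1
    intro x hx b hb e
    rcases hDC hx with hx | ⟨hx, hxD, -⟩
    · rw [hW x hx]; exact key x hx b hb e
    · obtain ⟨hcl, w, hwC, hwD, hw⟩ := hrow x hx hxD
      by_cases hbC : b ∈ C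
      · exact fun h1 => (hIC h1).2 (hcl b hbC)
      · rw [hw b hbC]
        exact key w hwD b hb (by rw [← e, hcC x hx, hcC w hwC])
  · intro y hy
    obtain ⟨a, b, hab⟩ := h.ends y (hIC hy).1
    have key : ∀ x ∈ D, cls' (W x y) = g a ∨ cls' (W x y) = g b := by
      intro x hx
      rw [hcD _ (h.inner x hx y (hIC hy).1)]
      rcases hab x hx with e | e
      exacts [Or.inl (by rw [e]), Or.inr (by rw [e])]
    refine ⟨g a, g b, fun x hx => ?_⟩
    rcases hDC hx with hx | ⟨hx, hxD, -⟩
    · rw [hW x hx]; exact key x hx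
    · obtain ⟨-, w, -, hwD, hw⟩ := hrow x hx hxD
      rw [hw y (hIC hy).2]; exact key w hwD

/-- If no edge extends the search, the blossoms and the inner vertices form a Tutte violator, so
that there is no perfect matching. -/
theorem no_matching (h : Search H r X N D I cls W)
    (hstuck : ∀ u ∈ D, ∀ v, H u v → v ∈ I ∨ v ∈ D ∧ ∀ x, Reach (W u) (W v) u x → x ∈ D)
    {g : V → V} (hg : ∀ x, g (g x) = x) (hgD : ∀ x ∈ D, H x (g x)) (hne : ∀ x ∈ D, g x ≠ x) :
    False := by
  classical
  -- A component without inner vertices cannot change its blossom, and it contains v.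
  have hsame : ∀ u ∈ D, ∀ v, H u v → v ∈ I ∨ v ∈ D ∧ cls v = cls u := by
    intro u hu v huv
    rcases hstuck u hu v huv with h1 | ⟨hv, hR⟩
    · exact Or.inl h1
    refine Or.inr ⟨hv, ?_⟩
    let C : Finset V := D.filter (fun x => Reach (W u) (W v) u x)
    have hC : ∀ x, x ∈ C ↔ Reach (W u) (W v) u x := fun x => by
      simp only [C, Finset.mem_filter]; exact ⟨And.right, fun hx => ⟨hR x hx, hx⟩⟩
    have key : ∀ x, Reach (W u) (W v) u x → cls x = cls u := by
      intro x hx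
      induction hx with
      | base => rfl
      | left hx ih =>
        rcases h.blossom u hu _ (hR _ hx) with h1 | h1
        exacts [absurd h1 (h.disj _ (hR _ hx.left)), h1.2.trans ih]
      | right hx ih =>
        rcases h.blossom v hv _ (hR _ hx) with h1 | h1
        exacts [absurd h1 (h.disj _ (hR _ hx.right)), h1.2.trans ih]
    exact key v ((hC v).1 (h.mem_component hu hv hC))
  -- For u in the blossom, `W u` pairs up all its other vertices, so the blossom is odd. Hence g
  -- does not preserve it, and by `hsame` it can be left only towards I.
  have hex : ∀ t ∈ D.image cls, ∃ b ∈ D, cls b = t ∧ g b ∈ I := by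
    intro t ht
    by_contra hno
    push Not at hno
    obtain ⟨u, hu, rfl⟩ := Finset.mem_image.1 ht
    let B : Finset V := D.filter (fun x => cls x = cls u)
    have hB : ∀ x, x ∈ B ↔ x ∈ D ∧ cls x = cls u := fun x => by simp [B]
    have h1 : Even B.card := by
      apply even_card_of_involution (f := g) _ (fun x _ => hg x)
      · exact fun x hx => hne x ((hB x).1 hx).1
      · intro x hx
        rw [hB] at hx ⊢
        rcases hsame x hx.1 _ (hgD x hx.1) with h1 | h1
        · exact absurd h1 (hno x hx.1 hx.2)
        · exact ⟨h1.1, h1.2.trans hx.2⟩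
    have h2 : Odd B.card := by
      have hM := h.matching u hu
      apply odd_card_of_involution (f := W u) ((hB u).2 ⟨hu, rfl⟩) _ (fun x _ => hM.invol x)
      · exact fun x hx hxu hf => hxu (h.fixed_of_mem hu (Or.inl ((hB x).1 hx).1) hf)
      · intro x hx hxu
        rw [hB] at hx
        refine ⟨?_, fun e => hxu ?_⟩
        · rcases h.blossom u hu x hx.1 with h1 | h1
          · exact absurd h1 (h.base u hu x hx.1 hx.2.symm)
          · exact (hB _).2 ⟨h1.1, h1.2.trans hx.2⟩
        · rw [← hM.invol x, e]; exact (hM.fixed u).2 (Set.mem_insert _ _)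
    exact (Nat.not_even_iff_odd.2 h2) h1
  choose! β hβD hβc hβI using hex
  have hle : (D.image cls).card ≤ I.card := by
    apply Finset.card_le_card_of_injOn (fun t => g (β t)) (fun t ht => hβI t ht)
    intro t ht t' ht' e
    have e' : β t = β t' := by
      have := congrArg g e
      simpa only [hg] using this
    rw [← hβc t ht, e', hβc t' ht']
  have hMr := (h.matching r h.root).invol
  -- In `W r` the inner vertices are matched to pairwise different blossoms, none of which is that
  -- of r.
  have hlt : I.card ≤ ((D.image cls).erase (cls r)).card := by
    apply Finset.card_le_card_of_injOn (fun y => cls (W r y))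
    · intro y hy
      have hy' := h.inner r h.root y hy
      refine Finset.mem_erase.2 ⟨fun e => ?_, Finset.mem_image_of_mem _ hy'⟩
      exact h.base r h.root _ hy' e.symm (by rw [hMr]; exact hy)
    · intro y hy y' hy' e
      have := h.uniq r h.root _ (h.inner r h.root y hy) _ (h.inner r h.root y' hy') e
        (by rw [hMr]; exact hy) (by rw [hMr]; exact hy')
      rw [← hMr y, this, hMr]
  have := Finset.card_erase_add_one (Finset.mem_image_of_mem cls h.root)
  omega

end Search

end Blossoms

end ExactMatching

namespace ExactMatching

/-! ### Rotating the matchings around the odd cycle -/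

section Tracing

variable {V : Type*} [DecidableEq V]

/-- The data of a search together with a current matching `cur`, which misses the vertex `z`. -/
@[ext]
structure TraceState (V : Type*) where
  D : Finset V
  W : V → V → V
  cur : V → V
  z : V

/-- Match `z` with `y`, so that the partner of `y` becomes exposed and enters `D`. -/
def TraceState.step (s : TraceState V) (y : V) : TraceState V where
  D := insert (s.cur y) s.D
  W := if s.cur y ∈ s.D then s.W else Function.update s.W (s.cur y) (swapAt s.cur s.z y)
  cur := swapAt s.cur s.z y
  z := s.cur y

omit [DecidableEq V] in
theorem MatchingMap.ne_of_mem {H : V → V → Prop} {E : Set V} {f : V → V} (hf : MatchingMap H E f)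
    {C : V → Prop} (hC : ∀ x, ¬ C x → ¬ C (f x)) {x : V} (hx : C x) : C (f x) := by
  by_contra hn
  have := hC _ hn
  rw [hf.invol] at this
  exact this hx

variable (H : V → V → Prop) (X : Set V) (D : Finset V) (W : V → V → V) (u v : V)
  (C E : Finset V)

/-- The invariant of tracing the component `C` of `u` under `W u` and `W v`, starting with
the matching `W w`: all new rows agree outside of `C` with `W u` or `W v`. -/
structure Rotation (w : V) (s : TraceState V) : Prop where
  sub : D ⊆ s.D
  low : E ⊆ s.D
  upper : s.D ⊆ D ∪ C
  rows : ∀ x ∈ D, s.W x = W x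
  new_rows : ∀ p ∈ s.D, p ∉ D → MatchingMap H (insert p X) (s.W p) ∧
    ((∀ x, x ∉ C → s.W p x = W u x) ∨ (∀ x, x ∉ C → s.W p x = W v x))
  matching : MatchingMap H (insert s.z X) s.cur
  z_mem : s.z ∈ C
  off : ∀ x, x ∉ C → s.cur x = W w x
  z_mem_D : s.z ∈ s.D

/-- The vertices at even distance from `u` on the alternating path. -/
def evenVertex (s : ℕ) : V := (fun x => W u (W v x))^[s] u

/-- The vertices of the alternating path that precede the `s`-th even vertex. -/
def Visited (s : ℕ) (x : V) : Prop :=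
  ∃ j < s, x = evenVertex W u v j ∨ x = W v (evenVertex W u v j)

/-- Invariant of the trace along the even vertices, the last of which is `evenVertex l`. -/
structure EvenTrace (l i : ℕ) (s : TraceState V) : Prop extends Rotation H X D W u v C E u s where
  z_eq : s.z = evenVertex W u v (min i l)
  cur_eq : ∀ x, ¬ Visited W u v (min i l) x → x ≠ s.z → s.cur x = W u x
  mem : ∀ j ≤ min i l, evenVertex W u v j ∈ s.D

/-- Invariant of the trace along the odd vertices. -/
structure OddTrace (l i : ℕ) (s : TraceState V) : Prop extends Rotation H X D W u v C E v s where
  z_eq : i < l → s.z = W v (evenVertex W u v i)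
  z_eq' : l ≤ i → s.z = u
  cur_eq : i < l → ∀ x, ¬ Visited W u v (i + 1) x → x ≠ v → s.cur x = W v x
  cur_v : i < l → s.cur v = u
  mem : ∀ j ≤ i, j < l → W v (evenVertex W u v j) ∈ s.D

variable {H X D W u v C E} {r : V} {N : V → V} {I : Finset V} {cls : V → V}

omit [DecidableEq V] in
@[simp] theorem evenVertex_zero : evenVertex W u v 0 = u := rfl

omit [DecidableEq V] in
theorem evenVertex_succ (s : ℕ) :
    evenVertex W u v (s + 1) = W u (W v (evenVertex W u v s)) :=
  Function.iterate_succ_apply' _ _ _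

omit [DecidableEq V] in
theorem visited_succ {s : ℕ} {x : V} : Visited W u v (s + 1) x ↔
    Visited W u v s x ∨ x = evenVertex W u v s ∨ x = W v (evenVertex W u v s) := by
  constructor
  · rintro ⟨j, hj, h⟩
    rcases Nat.lt_succ_iff_lt_or_eq.1 hj with hj | rfl
    exacts [Or.inl ⟨j, hj, h⟩, Or.inr h]
  · rintro (⟨j, hj, h⟩ | h)
    exacts [⟨j, by omega, h⟩, ⟨s, by omega, h⟩]

omit [DecidableEq V] in
theorem reach_evenVertex (s : ℕ) : Reach (W u) (W v) u (evenVertex W u v s) := by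
  induction s with
  | zero => exact .base
  | succ s ih => rw [evenVertex_succ]; exact ih.right.left

/-- The alternative `y = s.z` covers the idle steps at the end of a trace: then the rotation does
not change the matching. Otherwise only edges inside C are exchanged, because `W w` preserves the
complement of C. -/
theorem Rotation.step {w y : V} {s : TraceState V} (hs : Rotation H X D W u v C E w s)
    (hH : ∀ x y, H x y → H y x)
    (hw : w = u ∨ w = v) (hCX : ∀ x ∈ C, x ∉ X) (hWC : ∀ x, x ∉ C → W w x ∉ C) (hy : y ∈ C)
    (hzy : y = s.z ∨ H s.z y ∧ y ≠ s.z) : Rotation H X D W u v C E w (s.step y) := by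
  have hM := hs.matching
  have hcl : ∀ x ∈ C, s.cur x ∈ C := fun x hx =>
    hM.ne_of_mem (C := (· ∈ C)) (fun x hx => by rw [hs.off x hx]; exact hWC x hx) hx
  have hz : s.cur s.z = s.z := (hM.fixed _).2 (Set.mem_insert _ _)
  have hM' : MatchingMap H (insert (s.cur y) X) (swapAt s.cur s.z y) := by
    rcases hzy with rfl | ⟨hzy, hne⟩
    · have : swapAt s.cur s.z s.z = s.cur := by
        funext x
        by_cases hx : x = s.z <;> simp [swapAt, hz, hx]
      rw [this, hz]; exact hM
    · exact hM.swapAt hH hzy (hCX _ hs.z_mem) (hCX _ hy) hne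
  have hoff : ∀ x, x ∉ C → swapAt s.cur s.z y x = W w x := by
    intro x hx
    have h1 : x ≠ s.cur y := fun e => hx (e ▸ hcl y hy)
    have h2 : x ≠ s.z := fun e => hx (e ▸ hs.z_mem)
    have h3 : x ≠ y := fun e => hx (e ▸ hy)
    simp [swapAt, h1, h2, h3, hs.off x hx]
  constructor
  · exact hs.sub.trans (Finset.subset_insert _ _)
  · exact hs.low.trans (Finset.subset_insert _ _)
  · exact Finset.insert_subset (Finset.mem_union_right _ (hcl y hy)) hs.upper
  · intro x hx
    simp only [TraceState.step]
    split_ifs with h1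
    · exact hs.rows x hx
    · rw [Function.update_of_ne (fun e : x = s.cur y => h1 (e ▸ hs.sub hx))]; exact hs.rows x hx
  · intro p hp hpD
    simp only [TraceState.step] at hp ⊢
    split_ifs with h1
    · rw [Finset.insert_eq_of_mem h1] at hp; exact hs.new_rows p hp hpD
    · by_cases hpc : p = s.cur y
      · rw [hpc, Function.update_self]
        refine ⟨hM', ?_⟩
        rcases hw with rfl | rfl
        exacts [Or.inl hoff, Or.inr hoff]
      · rw [Function.update_of_ne hpc]
        exact hs.new_rows p ((Finset.mem_insert.1 hp).resolve_left hpc) hpD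
  · exact hM'
  · exact hcl y hy
  · exact hoff
  · exact Finset.mem_insert_self _ _

namespace Search

section

variable (h : Search H r X N D I cls W) (hu : u ∈ D) (hv : v ∈ D)

include h hu hv

omit [DecidableEq V] in
-- Both matching edges at a visited vertex have been used up by the path, so the path runs into new
-- vertices until it reaches v, the only vertex of the component fixed by `W v`.
theorem visited_closed {s : ℕ} (hs : ∀ j < s, evenVertex W u v j ≠ v) :
    ¬ Visited W u v s (evenVertex W u v s) ∧ (∀ x, Visited W u v s x → Visited W u v s (W v x)) ∧
      ∀ x, Visited W u v s x ∨ x = evenVertex W u v s →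
        Visited W u v s (W u x) ∨ W u x = evenVertex W u v s := by
  have hMu := h.matching u hu
  have hMv := h.matching v hv
  have hmem : ∀ s, evenVertex W u v s ∈ D ∨ evenVertex W u v s ∈ I := fun s =>
    h.mem_of_reach hu hv (reach_evenVertex s)
  induction s with
  | zero =>
    refine ⟨?_, ?_, ?_⟩
    · rintro ⟨j, hj, -⟩; omega
    · rintro x ⟨j, hj, -⟩; omega
    · rintro x (⟨j, hj, -⟩ | rfl)
      · omega
      · exact Or.inr ((hMu.fixed _).2 (Set.mem_insert _ _))
  | succ s ih =>
    obtain ⟨h1, h2, h3⟩ := ih fun j hj => hs j (by omega)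
    set z := evenVertex W u v s with hz
    have hzv : z ≠ v := hs s (by omega)
    have hy1 : ¬ Visited W u v s (W v z) := fun hy => h1 (by
      have := h2 _ hy; rwa [hMv.invol] at this)
    have hy2 : W v z ≠ z := fun e => hzv (h.fixed_of_mem hv (hmem s) e)
    have hy : ¬ (Visited W u v s (W v z) ∨ W v z = z) := by tauto
    have hz1 : ¬ (Visited W u v s (W u (W v z)) ∨ W u (W v z) = z) := fun h4 => hy (by
      have := h3 _ h4; rwa [hMu.invol] at this)
    have hu0 : Visited W u v s u ∨ u = z := by
      rcases Nat.eq_zero_or_pos s with h0 | h0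
      · right; rw [hz, h0]; rfl
      · exact Or.inl ⟨0, h0, Or.inl rfl⟩
    have hyu : W v z ≠ u := fun e => hy (by rw [e]; exact hu0)
    have hz2 : W u (W v z) ≠ W v z := fun e => hyu
      (h.fixed_of_mem hu (h.mem_of_reach hu hv (reach_evenVertex s).right) e)
    rw [evenVertex_succ, ← hz]
    simp only [visited_succ, ← hz]
    refine ⟨by tauto, ?_, ?_⟩
    · rintro x (hx | rfl | rfl)
      · exact Or.inl (h2 x hx)
      · exact Or.inr (Or.inr rfl)
      · exact Or.inr (Or.inl (hMv.invol _))
    · rintro x ((hx | rfl | rfl) | rfl)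
      · have := h3 x (Or.inl hx); tauto
      · have := h3 z (Or.inr rfl); tauto
      · exact Or.inr rfl
      · rw [hMu.invol]; tauto

omit [DecidableEq V] in
theorem visited_succ_of_ne {s : ℕ} (hs : ∀ j ≤ s, evenVertex W u v j ≠ v) :
    W u (W v (evenVertex W u v s)) ≠ W v (evenVertex W u v s) ∧
      ¬ Visited W u v s (W v (evenVertex W u v s)) ∧
      W v (evenVertex W u v s) ≠ evenVertex W u v s := by
  obtain ⟨h1, h2, -⟩ := h.visited_closed hu hv (s := s) (fun j hj => hs j hj.le)
  have hMv := h.matching v hv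
  refine ⟨fun e => ?_, fun hy => h1 (by have := h2 _ hy; rwa [hMv.invol] at this), fun e =>
    hs s le_rfl (h.fixed_of_mem hv (h.mem_of_reach hu hv (reach_evenVertex s)) e)⟩
  apply (h.visited_closed hu hv (s := s + 1) (fun j hj => hs j (by omega))).1
  rw [evenVertex_succ, e]
  exact visited_succ.2 (Or.inr (Or.inr rfl))

variable (hC : ∀ x, x ∈ C ↔ Reach (W u) (W v) u x)

include hC

/-- By `visited_closed` the even vertices are distinct as long as v has not been reached, so the
pigeonhole principle in C applies. -/
theorem exists_last : ∃ l < C.card, evenVertex W u v l = v ∧ ∀ j < l, evenVertex W u v j ≠ v := by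
  classical
  have hex : ∃ l, l < C.card ∧ evenVertex W u v l = v := by
    by_contra hno
    push Not at hno
    obtain ⟨i, hi, j, hj, hij, e⟩ := Finset.exists_ne_map_eq_of_card_lt_of_maps_to
      (s := Finset.range (C.card + 1)) (t := C) (f := evenVertex W u v) (by simp)
      (fun s _ => (hC _).2 (reach_evenVertex s))
    have key : ∀ i j, i < j → j < C.card + 1 → evenVertex W u v i ≠ evenVertex W u v j := by
      intro i j hij hj e
      exact (h.visited_closed hu hv (s := j) (fun k hk => hno k (by omega))).1
        ⟨i, hij, Or.inl e.symm⟩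
    rw [Finset.mem_range] at hi hj
    rcases Nat.lt_or_gt_of_ne hij with h1 | h1
    exacts [key i j h1 hj e, key j i h1 hi e.symm]
  refine ⟨Nat.find hex, (Nat.find_spec hex).1, (Nat.find_spec hex).2, fun j hj e => ?_⟩
  exact Nat.find_min hex hj ⟨hj.trans (Nat.find_spec hex).1, e⟩

omit [DecidableEq V] in
-- Since `W v` fixes v, the path ending there is closed under both matchings and exhausts the
-- component.
theorem visited_of_mem {l : ℕ} (hl : evenVertex W u v l = v)
    (hl' : ∀ j < l, evenVertex W u v j ≠ v) {x : V} (hx : x ∈ C) :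
    Visited W u v l x ∨ x = evenVertex W u v l := by
  obtain ⟨-, h2, h3⟩ := h.visited_closed hu hv hl'
  rw [hC] at hx
  induction hx with
  | base =>
    rcases Nat.eq_zero_or_pos l with h0 | h0
    · right; rw [h0]; rfl
    · exact Or.inl ⟨0, h0, Or.inl rfl⟩
  | left _ ih => exact h3 _ ih
  | right _ ih =>
    rcases ih with ih | ih
    · exact Or.inl (h2 _ ih)
    · right
      rw [ih, hl]; exact ((h.matching v hv).fixed v).2 (Set.mem_insert _ _)

omit [DecidableEq V] in
theorem component_facts : (∀ x ∈ C, x ∉ X) ∧ ∀ w, w = u ∨ w = v →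
    (∀ x ∈ C, W w x ∈ C) ∧ ∀ x, x ∉ C → W w x ∉ C := by
  have h1 : ∀ w, w = u ∨ w = v → ∀ x ∈ C, W w x ∈ C := by
    rintro w (rfl | rfl) x hx
    exacts [(hC _).2 ((hC x).1 hx).left, (hC _).2 ((hC x).1 hx).right]
  refine ⟨fun x hx => ?_, fun w hw => ⟨h1 w hw, fun x hx hn => hx ?_⟩⟩
  · rcases h.mem_of_reach hu hv ((hC x).1 hx) with h2 | h2
    exacts [h.not_exposed x h2, h.inner_not_exposed x h2]
  · have hwD : w ∈ D := by rcases hw with rfl | rfl <;> assumption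
    rw [← (h.matching w hwD).invol x]; exact h1 w hw _ hn

/-- Used for both traces. The lower bound E is D for the first trace; for the second it is the set
marked by the first, so that the even vertices are not forgotten. -/
theorem rotation_start {w : V} {s : TraceState V} (hw : w = u ∨ w = v) (hsub : D ⊆ s.D)
    (hlow : E ⊆ s.D) (hup : s.D ⊆ D ∪ C) (hrows : ∀ x ∈ D, s.W x = W x)
    (hnew : ∀ p ∈ s.D, p ∉ D → MatchingMap H (insert p X) (s.W p) ∧
      ((∀ x, x ∉ C → s.W p x = W u x) ∨ (∀ x, x ∉ C → s.W p x = W v x)))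
    (hcur : s.cur = W w) (hz : s.z = w) : Rotation H X D W u v C E w s := by
  have hwD : w ∈ D := by rcases hw with rfl | rfl <;> assumption
  refine ⟨hsub, hlow, hup, hrows, hnew, ?_, ?_, fun x _ => by rw [hcur], ?_⟩
  · rw [hcur, hz]; exact h.matching w hwD
  · rw [hz]
    rcases hw with rfl | rfl
    exacts [(hC _).2 .base, h.mem_component hu hv hC]
  · rw [hz]; exact hsub hwD

variable (hH : ∀ x y, H x y → H y x) {l : ℕ} (hl : evenVertex W u v l = v)
  (hl' : ∀ j < l, evenVertex W u v j ≠ v)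

omit h hv hC in
theorem evenTrace_start {s : TraceState V} (hs : Rotation H X D W u v C E u s)
    (hcur : s.cur = W u) (hz : s.z = u) : EvenTrace H X D W u v C E l 0 s := by
  refine ⟨hs, by simpa using hz, fun x _ _ => by rw [hcur], ?_⟩
  intro j hj
  have : j = 0 := by simpa using hj
  rw [this]; exact hs.sub hu

include hH hl

/-- This is where the edge uv is used: exchanging it into `W v` exposes the partner of u, which is
the first odd vertex. -/
theorem oddTrace_start (huv : u ≠ v) {s : TraceState V} (hs : Rotation H X D W u v C E v s)
    (hvu : H v u) (hcur : s.cur = W v) (hz : s.z = v) :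
    OddTrace H X D W u v C E l 0 (s.step u) := by
  obtain ⟨hCX, hWC⟩ := h.component_facts hu hv hC
  have hMv := h.matching v hv
  have hR := hs.step hH (Or.inr rfl) hCX (hWC v (Or.inr rfl)).2 ((hC u).2 .base)
    (Or.inr ⟨hz ▸ hvu, hz ▸ huv⟩)
  have hvv : W v v = v := (hMv.fixed v).2 (Set.mem_insert _ _)
  have hl0 : 0 < l := Nat.pos_of_ne_zero fun e => huv (by rw [← hl, e]; rfl)
  refine ⟨hR, fun _ => ?_, fun h0 => by omega, fun _ => ?_, fun _ => ?_, ?_⟩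
  · simp [TraceState.step, hcur]
  · intro x hx hxv
    rw [visited_succ, not_or, not_or] at hx
    obtain ⟨-, hx2, hx3⟩ := hx
    rw [evenVertex_zero] at hx2 hx3
    simp [TraceState.step, swapAt, hcur, hz, hx2, hx3, hxv]
  · have : v ≠ W v u := fun e => huv (by rw [← hMv.invol u, ← e, hvv])
    simp [TraceState.step, swapAt, hcur, hz, this]
  · intro j hj _
    obtain rfl : j = 0 := by omega
    simp [TraceState.step, hcur]

include hl'

/-- Before v is reached, the exposed even vertex takes its `W v`-partner away from the next even
vertex. At v nothing happens any more, whence `min i l`; so the program may iterate n times without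
knowing the length l. -/
theorem evenTrace_step {i : ℕ} {s : TraceState V} (hs : EvenTrace H X D W u v C E l i s) :
    EvenTrace H X D W u v C E l (i + 1) (s.step (s.W v s.z)) := by
  obtain ⟨hCX, hWC⟩ := h.component_facts hu hv hC
  have hMv := h.matching v hv
  rw [hs.rows v hv]
  have hy : W v s.z ∈ C := (hWC v (Or.inr rfl)).1 _ hs.z_mem
  have hzy : W v s.z = s.z ∨ H s.z (W v s.z) ∧ W v s.z ≠ s.z := by
    by_cases e : W v s.z = s.z
    exacts [Or.inl e, Or.inr ⟨hMv.adj _ e, e⟩]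
  have hR := hs.toRotation.step hH (Or.inl rfl) hCX (hWC u (Or.inl rfl)).2 hy hzy
  rcases lt_or_ge i l with hi | hi
  · have hz := hs.z_eq
    have hcur := hs.cur_eq
    have hmem := hs.mem
    rw [min_eq_left hi.le] at hz hcur hmem
    obtain ⟨h1, h2, h3⟩ := h.visited_succ_of_ne hu hv (s := i) (fun j hj => hl' j (by omega))
    rw [← hz] at h1 h2 h3
    have hcy : s.cur (W v s.z) = evenVertex W u v (i + 1) := by
      rw [hcur _ h2 h3, evenVertex_succ, hz]
    refine ⟨hR, ?_, ?_, ?_⟩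
    · rw [min_eq_left hi]; exact hcy
    · rw [min_eq_left hi]
      intro x hx hx'
      have hx'' : x ≠ s.cur (W v s.z) := hx'
      rw [visited_succ, not_or, not_or, ← hz] at hx
      obtain ⟨hx1, hx2, hx3⟩ := hx
      simp only [TraceState.step, swapAt, hx'', hx2, hx3, if_false]
      exact hcur x hx1 hx2
    · rw [min_eq_left hi]
      intro j hj
      rcases Nat.le_succ_iff.1 hj with hj | rfl
      · exact Finset.mem_insert_of_mem (hmem j hj)
      · rw [← hcy]; exact Finset.mem_insert_self _ _
  · have hz := hs.z_eq
    have hcur := hs.cur_eq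
    have hmem := hs.mem
    rw [min_eq_right hi] at hz hcur hmem
    have hi' : min (i + 1) l = l := min_eq_right (by omega)
    have hzv : s.z = v := hz.trans hl
    have hvv : W v s.z = s.z := by rw [hzv]; exact (hMv.fixed v).2 (Set.mem_insert _ _)
    have hcz : s.cur s.z = s.z := (hs.matching.fixed _).2 (Set.mem_insert _ _)
    rw [hvv] at hR ⊢
    refine ⟨hR, ?_, ?_, ?_⟩
    · rw [hi', ← hz]; exact hcz
    · rw [hi']
      intro x hx hx'
      have hx'' : x ≠ s.cur s.z := hx'
      have hx3 : x ≠ s.z := hcz ▸ hx''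
      simp only [TraceState.step, swapAt, hx'', hx3, if_false]
      exact hcur x hx hx3
    · rw [hi']
      exact fun j hj => Finset.mem_insert_of_mem (hmem j hj)

/-- The exposed odd vertex is matched along `W u` to the next even vertex, whose `W v`-partner
becomes exposed. When this even vertex is v, its current partner is u, so u becomes exposed; being
fixed by `W u`, it makes all further steps idle. -/
theorem oddTrace_step {i : ℕ} {s : TraceState V} (hs : OddTrace H X D W u v C E l i s) :
    OddTrace H X D W u v C E l (i + 1) (s.step (s.W u s.z)) := by
  obtain ⟨hCX, hWC⟩ := h.component_facts hu hv hC
  have hMu := h.matching u hu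
  have hMv := h.matching v hv
  rw [hs.rows u hu]
  have hy : W u s.z ∈ C := (hWC u (Or.inl rfl)).1 _ hs.z_mem
  have hzy : W u s.z = s.z ∨ H s.z (W u s.z) ∧ W u s.z ≠ s.z := by
    by_cases e : W u s.z = s.z
    exacts [Or.inl e, Or.inr ⟨hMu.adj _ e, e⟩]
  have hR := hs.toRotation.step hH (Or.inr rfl) hCX (hWC v (Or.inr rfl)).2 hy hzy
  have hvv : W v v = v := (hMv.fixed v).2 (Set.mem_insert _ _)
  rcases lt_or_ge i l with hi | hi
  · have hz := hs.z_eq hi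
    have hcur := hs.cur_eq hi
    have hcv := hs.cur_v hi
    have hye : W u s.z = evenVertex W u v (i + 1) := by rw [hz, evenVertex_succ]
    rw [hye] at hR ⊢
    rcases lt_or_ge (i + 1) l with hi' | hi'
    · have hne : evenVertex W u v (i + 1) ≠ v := hl' _ hi'
      have hcy : s.cur (evenVertex W u v (i + 1)) = W v (evenVertex W u v (i + 1)) :=
        hcur _ (h.visited_closed hu hv (fun j hj => hl' j (by omega))).1 hne
      have hnev : ∀ j < l, v ≠ W v (evenVertex W u v j) := fun j hj e => hl' j hj (by
        rw [← hMv.invol (evenVertex W u v j), ← e, hvv])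
      refine ⟨hR, fun _ => hcy, fun h0 => by omega, fun _ => ?_, fun _ => ?_, ?_⟩
      · intro x hx hxv
        rw [visited_succ, not_or, not_or] at hx
        obtain ⟨hx1, hx2, hx3⟩ := hx
        have hx4 : x ≠ s.z := fun e => hx1 (visited_succ.2 (Or.inr (Or.inr (e.trans hz))))
        simp only [TraceState.step, swapAt, hcy, hx2, hx3, hx4, if_false]
        exact hcur x hx1 hxv
      · have h1 := hnev (i + 1) hi'
        have h2 : v ≠ s.z := hz ▸ hnev i hi
        simp only [TraceState.step, swapAt, hcy, h1, h2, hne.symm, if_false]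
        exact hcv
      · intro j hj hjl
        rcases Nat.le_succ_iff.1 hj with hj | rfl
        · exact Finset.mem_insert_of_mem (hs.mem j hj hjl)
        · rw [← hcy]; exact Finset.mem_insert_self _ _
    · have hil : l = i + 1 := by omega
      have hyv : evenVertex W u v (i + 1) = v := hil ▸ hl
      refine ⟨hR, fun h0 => by omega, fun _ => ?_, fun h0 => by omega, fun h0 => by omega, ?_⟩
      · rw [hyv]; exact hcv
      · exact fun j _ hjl => Finset.mem_insert_of_mem (hs.mem j (by omega) hjl)
  · have hz := hs.z_eq' hi
    refine ⟨hR, fun h0 => by omega, fun _ => ?_, fun h0 => by omega, fun h0 => by omega, ?_⟩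
    · have hzz : s.cur s.z = s.z := (hs.matching.fixed _).2 (Set.mem_insert _ _)
      have huu : W u s.z = s.z := by rw [hz]; exact (hMu.fixed u).2 (Set.mem_insert _ _)
      rw [huu]; exact hzz.trans hz
    · exact fun j _ hjl => Finset.mem_insert_of_mem (hs.mem j (by omega) hjl)

omit hH in
/-- After both traces the whole component has entered `D`. -/
theorem search_of_traces {i : ℕ} {s : TraceState V} (hs : OddTrace H X D W u v C E l i s)
    (hi : l ≤ i + 1) (hE : ∀ j ≤ l, evenVertex W u v j ∈ E) :
    C ⊆ s.D ∧ ∃ cls', Search H r X N s.D (I \ C) cls' s.W := by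
  have hD : s.D = D ∪ C := by
    apply subset_antisymm hs.upper
    apply Finset.union_subset hs.sub
    intro x hx
    rcases h.visited_of_mem hu hv hC hl hl' hx with ⟨j, hj, rfl | rfl⟩ | rfl
    · exact hs.low (hE j hj.le)
    · exact hs.mem j (by omega) hj
    · exact hs.low (hE l le_rfl)
  refine ⟨hD ▸ Finset.subset_union_right, ?_⟩
  rw [hD]
  exact h.merge hu hv hC hs.rows fun p hp hpD =>
    hs.new_rows p (hD ▸ Finset.mem_union_right _ hp) hpD

end

end Search

end Tracing

end ExactMatching

/-! ### Programs with bounded loops: semantics, frame rule and polynomial running time -/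

namespace RAM

/-- Programs whose only loops are `for x < b`, where `b` is the content of cell `(0, j)` of the
array `0`, which is never written. -/
inductive ForProg : Type
  | assign (a : ℕ) (i j e : Expr) : ForProg
  | seq (p q : ForProg) : ForProg
  | ite (e : Expr) (p q : ForProg) : ForProg
  | loop (x j : ℕ) (p : ForProg) : ForProg

/-- The scalar variable number `x`, stored in cell `(0, 0)` of array `x`. -/
abbrev Expr.var (x : ℕ) : Expr := .read x (.lit 0) (.lit 0)

namespace ForProg

/-- The machine program. -/
def compile : ForProg → Prog
  | assign a i j e => .assign a i j e
  | seq p q => .seq p.compile q.compile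
  | ite e p q => .ite e p.compile q.compile
  | loop x j p => .seq (.assign x (.lit 0) (.lit 0) (.lit 0))
      (.while (.sub (.read 0 (.lit 0) (.lit j)) (.var x))
        (.seq p.compile (.assign x (.lit 0) (.lit 0) (.add (.var x) (.lit 1)))))

/-- The memory after running the program. -/
def den : ForProg → Memory → Memory
  | assign a i j e, m => m.write a (i.eval m) (j.eval m) (e.eval m)
  | seq p q, m => q.den (p.den m)
  | ite e p q, m => if e.eval m = 0 then q.den m else p.den m
  | loop x j p, m =>
      (fun m' => (p.den m').write x 0 0 (m' x 0 0 + 1))^[m 0 0 j] (m.write x 0 0 0)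

theorem den_seq (p q : ForProg) (m : Memory) : (seq p q).den m = q.den (p.den m) := rfl

theorem den_assign (a : ℕ) (i j e : Expr) (m : Memory) :
    (assign a i j e).den m = m.write a (i.eval m) (j.eval m) (e.eval m) := rfl

theorem den_ite_of_eq {e : Expr} {p q : ForProg} {m : Memory} (h : e.eval m = 0) :
    (ite e p q).den m = q.den m := if_pos h

theorem den_ite_of_ne {e : Expr} {p q : ForProg} {m : Memory} (h : e.eval m ≠ 0) :
    (ite e p q).den m = p.den m := if_neg h

/-- The arrays to which the program may write. -/
def writes : ForProg → List ℕ
  | assign a _ _ _ => [a]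
  | seq p q => p.writes ++ q.writes
  | ite _ p q => p.writes ++ q.writes
  | loop x _ p => x :: p.writes

/-- The program does not write to array `0`, the counter of a loop is not written by the body, and
loop bounds are in the cells `(0, 0)` and `(0, 2)`. -/
def Ok : ForProg → Bool
  | assign a _ _ _ => a != 0
  | seq p q => p.Ok && q.Ok
  | ite _ p q => p.Ok && q.Ok
  | loop x j p => p.Ok && !(p.writes.contains x) && x != 0 && (j == 0 || j == 2)

/-- A bound for the running time if loop bounds are at most `b`. -/
def time (b : ℕ) : ForProg → ℕ
  | assign _ i j e => i.cost + j.cost + e.cost + 1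
  | seq p q => p.time b + q.time b
  | ite e p q => e.cost + 1 + p.time b + q.time b
  | loop _ _ p => b * (p.time b + 16) + 12

theorem write_array_ne (m : Memory) {a a' : ℕ} (i j v : ℕ) (h : a' ≠ a) :
    m.write a i j v a' = m a' := by
  funext i' j'; simp [Memory.write, h]

theorem den_eq_of_not_mem_writes (p : ForProg) (m : Memory) {a : ℕ} (ha : a ∉ p.writes) :
    p.den m a = m a := by
  induction p generalizing m with
  | assign a' i j e =>
    simp only [writes, List.mem_singleton] at ha
    exact write_array_ne m _ _ _ ha
  | seq p q ihp ihq =>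
    simp only [writes, List.mem_append, not_or] at ha
    rw [den, ihq _ ha.2, ihp _ ha.1]
  | ite e p q ihp ihq =>
    simp only [writes, List.mem_append, not_or] at ha
    rw [den]; split_ifs
    exacts [ihq _ ha.2, ihp _ ha.1]
  | loop x j p ih =>
    simp only [writes, List.mem_cons, not_or] at ha
    rw [den]
    have key : ∀ k m', ((fun m' => (p.den m').write x 0 0 (m' x 0 0 + 1))^[k] m') a = m' a := by
      intro k
      induction k with
      | zero => intro m'; rfl
      | succ k ihk =>
        intro m'
        rw [Function.iterate_succ_apply, ihk, write_array_ne _ _ _ _ ha.1, ih _ ha.2]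
    rw [key, write_array_ne _ _ _ _ ha.1]

theorem zero_not_mem_writes (p : ForProg) (hp : p.Ok = true) : 0 ∉ p.writes := by
  induction p with
  | assign a i j e =>
    simp only [Ok, bne_iff_ne] at hp
    simpa [writes] using hp.symm
  | seq p q ihp ihq =>
    simp only [Ok, Bool.and_eq_true] at hp
    simpa [writes] using ⟨ihp hp.1, ihq hp.2⟩
  | ite e p q ihp ihq =>
    simp only [Ok, Bool.and_eq_true] at hp
    simpa [writes] using ⟨ihp hp.1, ihq hp.2⟩
  | loop x j p ih =>
    simp only [Ok, Bool.and_eq_true, bne_iff_ne] at hp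
    simpa [writes] using ⟨hp.1.2.symm, ih hp.1.1.1⟩

theorem den_zero (p : ForProg) (hp : p.Ok = true) (m : Memory) : p.den m 0 = m 0 :=
  p.den_eq_of_not_mem_writes m (p.zero_not_mem_writes hp)

/-- The invariant rule for loops. -/
theorem loop_rule {x j : ℕ} {p : ForProg} (Inv : ℕ → Memory → Prop)
    {m : Memory} {b : ℕ} (hb : m 0 0 j = b)
    (h0 : Inv 0 (m.write x 0 0 0))
    (hs : ∀ i m', i < b → Inv i m' → m' x 0 0 = i → (∀ a ∉ (loop x j p).writes, m' a = m a) →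
      Inv (i + 1) ((p.den m').write x 0 0 (i + 1))) :
    Inv b ((loop x j p).den m) := by
  have key : ∀ k ≤ b, ∃ m', ((fun m' => (p.den m').write x 0 0 (m' x 0 0 + 1))^[k]
      (m.write x 0 0 0)) = m' ∧ Inv k m' ∧ m' x 0 0 = k ∧
      ∀ a ∉ (loop x j p).writes, m' a = m a := by
    intro k
    induction k with
    | zero =>
      refine fun _ => ⟨_, rfl, h0, by simp [Memory.write], fun a ha => ?_⟩
      simp only [writes, List.mem_cons, not_or] at ha
      exact write_array_ne _ _ _ _ ha.1
    | succ k ih =>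
      intro hk
      obtain ⟨m', h1, h2, h3, h4⟩ := ih (by omega)
      refine ⟨_, rfl, ?_, ?_, ?_⟩
      · rw [Function.iterate_succ_apply', h1]
        simp only [h3]
        exact hs k m' (by omega) h2 h3 h4
      · rw [Function.iterate_succ_apply', h1]
        simp only [h3]
        simp [Memory.write]
      · intro a ha
        rw [Function.iterate_succ_apply', h1, ← h4 a ha]
        simp only [writes, List.mem_cons, not_or] at ha
        rw [write_array_ne _ _ _ _ ha.1, den_eq_of_not_mem_writes _ _ ha.2]
  obtain ⟨m', h1, h2, -, -⟩ := key b le_rfl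
  rw [den, hb, h1]
  exact h2

theorem runs_compile (p : ForProg) (hp : p.Ok = true) {b : ℕ} (m : Memory) (h0 : m 0 0 0 ≤ b)
    (h2 : m 0 0 2 ≤ b) : ∃ t, Runs p.compile m t (p.den m) ∧ t ≤ p.time b := by
  induction p generalizing m with
  | assign a i j e => exact ⟨_, Runs.assign a i j e m, le_rfl⟩
  | seq p q ihp ihq =>
    simp only [Ok, Bool.and_eq_true] at hp
    obtain ⟨s, hs, hs'⟩ := ihp hp.1 m h0 h2
    have e := p.den_zero hp.1 m
    obtain ⟨t, ht, ht'⟩ := ihq hp.2 (p.den m) (by rw [e]; exact h0) (by rw [e]; exact h2)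
    exact ⟨_, hs.seq ht, Nat.add_le_add hs' ht'⟩
  | ite e p q ihp ihq =>
    simp only [Ok, Bool.and_eq_true] at hp
    by_cases he : e.eval m = 0
    · obtain ⟨t, ht, ht'⟩ := ihq hp.2 m h0 h2
      refine ⟨e.cost + 1 + t, ?_, ?_⟩
      · rw [den, if_pos he]; exact Runs.iteFalse he ht
      · simp only [time]; omega
    · obtain ⟨t, ht, ht'⟩ := ihp hp.1 m h0 h2
      refine ⟨e.cost + 1 + t, ?_, ?_⟩
      · rw [den, if_neg he]; exact Runs.iteTrue he ht
      · simp only [time]; omega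
  | loop x j p ih =>
    simp only [Ok, Bool.and_eq_true, bne_iff_ne, Bool.not_eq_true', Bool.or_eq_true,
      beq_iff_eq] at hp
    obtain ⟨⟨⟨hpok, hx⟩, hx0⟩, hj⟩ := hp
    have hx' : x ∉ p.writes := by
      intro hmem; rw [List.contains_iff_mem.2 hmem] at hx; exact absurd hx (by simp)
    -- Here k is the number of passes left. A pass costs 8 steps for the test and 8 for the
    -- increment besides the body, and the final test costs 8; together with 4 steps for clearing
    -- the counter this gives the constants 16 and 12 in `time`.
    have key : ∀ k (m' : Memory), m' 0 0 0 ≤ b → m' 0 0 2 ≤ b → m' 0 0 j = m' x 0 0 + k →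
        ∃ t, Runs (.while (.sub (.read 0 (.lit 0) (.lit j)) (.var x))
          (.seq p.compile (.assign x (.lit 0) (.lit 0) (.add (.var x) (.lit 1))))) m' t
          ((fun m' => (p.den m').write x 0 0 (m' x 0 0 + 1))^[k] m') ∧
          t ≤ k * (p.time b + 16) + 8 := by
      intro k
      induction k with
      | zero =>
        intro m' _ _ hk
        refine ⟨_, Runs.whileFalse ?_, ?_⟩
        · simp [Expr.eval, hk]
        · simp [Expr.cost]
      | succ k ihk =>
        intro m' h0 h2 hk
        obtain ⟨s, hs, hs'⟩ := ih hpok m' h0 h2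
        have hw := Runs.assign x (.lit 0) (.lit 0) (.add (.var x) (.lit 1)) (p.den m')
        have e1 : p.den m' x = m' x := p.den_eq_of_not_mem_writes m' hx'
        have e0 := p.den_zero hpok m'
        simp only [Expr.eval, e1] at hw
        have e2 : ((p.den m').write x 0 0 (m' x 0 0 + 1)) 0 = m' 0 := by
          rw [write_array_ne _ _ _ _ hx0.symm, e0]
        obtain ⟨t, ht, ht'⟩ := ihk ((p.den m').write x 0 0 (m' x 0 0 + 1))
          (by rw [e2]; exact h0) (by rw [e2]; exact h2) (by
            rw [e2, hk]; simp [Memory.write]; omega)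
        refine ⟨_, Runs.whileTrue ?_ (hs.seq hw) ht, ?_⟩
        · simp [Expr.eval, hk]
        · simp only [Expr.cost, Nat.add_mul, one_mul]
          omega
    have hz := Runs.assign x (.lit 0) (.lit 0) (.lit 0) m
    simp only [Expr.eval] at hz
    have e : (m.write x 0 0 0) 0 = m 0 := write_array_ne _ _ _ _ hx0.symm
    obtain ⟨t, ht, ht'⟩ := key (m 0 0 j) (m.write x 0 0 0) (by rw [e]; exact h0)
      (by rw [e]; exact h2) (by rw [e]; simp [Memory.write])
    refine ⟨_, hz.seq ht, ?_⟩
    have hjb : m 0 0 j ≤ b := by rcases hj with rfl | rfl <;> assumption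
    have := Nat.mul_le_mul_right (p.time b + 16) hjb
    simp only [Expr.cost, time]
    omega

/-- A base of at least 2 turns constants into powers and absorbs the factor 2 of a sum, so powers of
b + 2 suffice throughout. -/
theorem exists_time_le (p : ForProg) : ∃ c, ∀ b, p.time b ≤ (b + 2) ^ c := by
  have hone : ∀ b c : ℕ, 1 ≤ (b + 2) ^ c := fun b c => Nat.one_le_pow _ _ (by omega)
  have hconst : ∀ k b : ℕ, k ≤ (b + 2) ^ k := fun k b =>
    (Nat.lt_two_pow_self (n := k)).le.trans (Nat.pow_le_pow_left (by omega) k)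
  have hadd : ∀ b c d : ℕ, (b + 2) ^ c + (b + 2) ^ d ≤ (b + 2) ^ (c + d + 1) := by
    intro b c d
    have h1 := Nat.pow_le_pow_right (n := b + 2) (by omega) (Nat.le_add_right c d)
    have h2 := Nat.pow_le_pow_right (n := b + 2) (by omega) (Nat.le_add_left d c)
    calc _ ≤ (b + 2) ^ (c + d) * 2 := by omega
      _ ≤ (b + 2) ^ (c + d) * (b + 2) := Nat.mul_le_mul_left _ (by omega)
      _ = _ := (pow_succ _ _).symm
  induction p with
  | assign a i j e => exact ⟨_, fun b => hconst _ b⟩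
  | seq p q ihp ihq =>
    obtain ⟨c, hc⟩ := ihp
    obtain ⟨d, hd⟩ := ihq
    exact ⟨_, fun b => (Nat.add_le_add (hc b) (hd b)).trans (hadd b c d)⟩
  | ite e p q ihp ihq =>
    obtain ⟨c, hc⟩ := ihp
    obtain ⟨d, hd⟩ := ihq
    exact ⟨_, fun b => (Nat.add_le_add ((Nat.add_le_add (hconst (e.cost + 1) b) (hc b)).trans
      (hadd b _ c)) (hd b)).trans (hadd b _ d)⟩
  | loop x j p ih =>
    obtain ⟨c, hc⟩ := ih
    refine ⟨1 + (c + 16 + 1) + 12 + 1, fun b => ?_⟩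
    have h1 : p.time b + 16 ≤ (b + 2) ^ (c + 16 + 1) :=
      (Nat.add_le_add (hc b) (hconst 16 b)).trans (hadd b c 16)
    have h2 : b * (p.time b + 16) ≤ (b + 2) ^ (1 + (c + 16 + 1)) := by
      rw [pow_add, pow_one]; exact Nat.mul_le_mul (by omega) h1
    exact (Nat.add_le_add h2 (hconst 12 b)).trans (hadd b _ 12)

end ForProg

end RAM

/-! ### The elementary steps of the search as programs -/

namespace ExactMatching

open RAM RAM.ForProg

/-- No operation (a scratch variable is cleared). -/
def skipProg : ForProg := .assign 13 (.lit 0) (.lit 0) (.lit 0)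

/-- An expression that is nonzero if and only if the two values differ. -/
def neExpr (e f : Expr) : Expr := .add (.sub e f) (.sub f e)

theorem neExpr_eval (m : Memory) (e f : Expr) : (neExpr e f).eval m = 0 ↔ e.eval m = f.eval m := by
  simp only [neExpr, Expr.eval]; omega

/-- Copy row `i` of array `a` to row `j` of array `b`. -/
def copyRow (a : ℕ) (i : Expr) (b : ℕ) (j : Expr) : ForProg :=
  .loop 10 0 (.assign b j (.var 10) (.read a i (.var 10)))

/-- Exchange the matching edge at the vertex in variable `12` of the current matching (array `9`)
for the edge to the exposed vertex, which is in variable `11`. -/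
def swapProg : ForProg :=
  .seq (.assign 13 (.lit 0) (.lit 0) (.read 9 (.lit 0) (.var 12)))
    (.seq (.assign 9 (.lit 0) (.var 12) (.var 11))
      (.seq (.assign 9 (.lit 0) (.var 11) (.var 12))
        (.seq (.assign 9 (.lit 0) (.var 13) (.var 13))
          (.assign 11 (.lit 0) (.lit 0) (.var 13)))))

/-- Perform `TraceState.step`.  Array `7` marks the vertices of `D`, and array `8` holds the rows
`W u`. -/
def stepProg : ForProg :=
  .seq swapProg (.ite (.read 7 (.lit 0) (.var 11)) skipProg
    (.seq (.assign 7 (.lit 0) (.var 11) (.lit 1)) (copyRow 9 (.lit 0) 8 (.var 11))))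

/-- Trace an alternating component along the matching of the vertex in variable `w`. -/
def traceProg (w : ℕ) : ForProg :=
  .loop 17 0 (.seq (.assign 12 (.lit 0) (.lit 0) (.read 8 (.var w) (.var 11))) stepProg)

/-- Make the matching of the vertex in variable `w` the current one. -/
def loadProg (w : ℕ) : ForProg :=
  .seq (copyRow 8 (.var w) 9 (.lit 0)) (.assign 11 (.lit 0) (.lit 0) (.var w))

/-- Load the matching of the vertex in variable `w` and step to the vertex in variable `w'`. -/
def growProg (w w' : ℕ) : ForProg :=
  .seq (loadProg w) (.seq (.assign 12 (.lit 0) (.lit 0) (.var w')) stepProg)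

/-- Trace the component of the vertices in variables `14` and `15`. -/
def blossomProg : ForProg :=
  .seq (.seq (loadProg 14) (traceProg 15)) (.seq (growProg 15 14) (traceProg 14))

/-- Augment the matching in array `6`, and record this in variable `16`. -/
def augmentProg : ForProg :=
  .seq (copyRow 8 (.var 14) 6 (.lit 0))
    (.seq (.assign 6 (.lit 0) (.var 14) (.var 15))
      (.seq (.assign 6 (.lit 0) (.var 15) (.var 14)) (.assign 16 (.lit 0) (.lit 0) (.lit 1))))

/-- Treat the edge between the vertices in variables `14` and `15` of the graph in array `5`. -/
def edgeProg : ForProg :=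
  .ite (.var 16) skipProg
    (.ite (.read 7 (.lit 0) (.var 14))
      (.ite (.read 5 (.var 14) (.var 15))
        (.ite (.read 7 (.lit 0) (.var 15)) blossomProg
          (.ite (neExpr (.read 8 (.var 14) (.var 15)) (.var 15)) (growProg 14 15) augmentProg))
        skipProg)
      skipProg)

/-- The row `i` of array `a`, extended by the identity. -/
def row (n : ℕ) (m : Memory) (a i : ℕ) : ℕ → ℕ := fun x => if x < n then m a i x else x

/-- The set of indices of nonzero entries of row `0` of array `7`. -/
def markedSet (n : ℕ) (m : Memory) : Finset ℕ := (Finset.range n).filter (fun x => m 7 0 x ≠ 0)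

theorem mem_markedSet {n : ℕ} {m : Memory} {x : ℕ} : x ∈ markedSet n m ↔ x < n ∧ m 7 0 x ≠ 0 := by
  simp [markedSet]

/-- The state of the search that is stored in the memory. -/
def traceState (n : ℕ) (m : Memory) : TraceState ℕ where
  D := markedSet n m
  W := row n m 8
  cur := row n m 9 0
  z := m 11 0 0

theorem copyRow_den {n a b I J : ℕ} {i j : Expr} {m : Memory} (hn : m 0 0 0 = n) (hab : a ≠ b)
    (ha : a ≠ 10) (hb : b ≠ 10)
    (hij : ∀ m' : Memory, (∀ c, c ≠ 10 → c ≠ b → m' c = m c) → i.eval m' = I ∧ j.eval m' = J)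
    (i' x : ℕ) : (copyRow a i b j).den m b i' x =
      if i' = J ∧ x < n then m a I x else m b i' x := by
  have key := loop_rule (x := 10) (j := 0) (p := .assign b j (.var 10) (.read a i (.var 10)))
    (fun k m' => ∀ i' x, m' b i' x = if i' = J ∧ x < k then m a I x else m b i' x) hn
    (m := m) (by intro i' x; simp [Memory.write, hb]) (by
      intro k m' hk hI hx hfr i' x
      have hfr' : ∀ c, c ≠ 10 → c ≠ b → m' c = m c := fun c h1 h2 => hfr c (by
        simp [writes, h1, h2])
      obtain ⟨e1, e2⟩ := hij m' hfr'
      simp only [den, Expr.eval, e1, e2, hx, hfr' a ha hab]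
      simp only [Memory.write, hb, hI, false_and, if_false]
      by_cases h1 : i' = J
      · by_cases h2 : x = k
        · simp [h1, h2]
        · have : x < k + 1 ↔ x < k := by omega
          simp [h1, h2, this]
      · simp [h1])
  exact key i' x

theorem row_copyRow {n a b I J : ℕ} {i j : Expr} {m : Memory} (hn : m 0 0 0 = n) (hab : a ≠ b)
    (ha : a ≠ 10) (hb : b ≠ 10)
    (hij : ∀ m' : Memory, (∀ c, c ≠ 10 → c ≠ b → m' c = m c) → i.eval m' = I ∧ j.eval m' = J) :
    row n ((copyRow a i b j).den m) b = Function.update (row n m b) J (row n m a I) := by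
  funext i' x
  by_cases hi : i' = J
  · subst hi
    simp only [row, copyRow_den hn hab ha hb hij, Function.update_self]
    by_cases hx : x < n <;> simp [hx]
  · simp only [row, copyRow_den hn hab ha hb hij, Function.update_of_ne hi]
    by_cases hx : x < n <;> simp [hx, hi]

theorem row_congr {n : ℕ} {m m' : Memory} {a : ℕ} (h : m' a = m a) : row n m' a = row n m a := by
  funext i x; simp [row, h]

theorem markedSet_congr {n : ℕ} {m m' : Memory} (h : m' 7 = m 7) :
    markedSet n m' = markedSet n m := by
  simp [markedSet, h]

/-- Later writes win, so the order of the writes reproduces the order of the cases of `swapAt`, even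
when some of the vertices coincide. -/
theorem swapProg_den (m : Memory) (x : ℕ) : swapProg.den m 9 0 x =
    (if x = m 9 0 (m 12 0 0) then m 9 0 (m 12 0 0) else if x = m 11 0 0 then m 12 0 0
      else if x = m 12 0 0 then m 11 0 0 else m 9 0 x) ∧
    swapProg.den m 11 0 0 = m 9 0 (m 12 0 0) := by
  simp [swapProg, den, Expr.eval, Memory.write]

theorem stepProg_den {n : ℕ} {m : Memory} (hn : m 0 0 0 = n) (hy : m 12 0 0 < n)
    (hz : m 11 0 0 < n) (hc : row n m 9 0 (m 12 0 0) < n) :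
    traceState n (stepProg.den m) = (traceState n m).step (m 12 0 0) := by
  obtain ⟨-, hw2⟩ := swapProg_den m 0
  have hw1 := fun x => (swapProg_den m x).1
  have hfr : ∀ a, a ∉ swapProg.writes → swapProg.den m a = m a := fun a ha =>
    den_eq_of_not_mem_writes _ _ ha
  have f7 := hfr 7 (by decide)
  have f8 := hfr 8 (by decide)
  have f0 := hfr 0 (by decide)
  set m₁ := swapProg.den m with hm₁
  have hcy : row n m 9 0 (m 12 0 0) = m 9 0 (m 12 0 0) := by simp [row, hy]
  rw [hcy] at hc
  set t := m 9 0 (m 12 0 0) with ht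
  have hcur : row n m₁ 9 0 = swapAt (row n m 9 0) (m 11 0 0) (m 12 0 0) := by
    funext x
    simp only [swapAt, hcy]
    by_cases hx : x < n
    · simp only [row, hx, if_true, hw1]
    · have h1 : x ≠ t := by omega
      have h2 : x ≠ m 11 0 0 := by omega
      have h3 : x ≠ m 12 0 0 := by omega
      simp [row, hx, h1, h2, h3]
  have hmem : t ∈ markedSet n m ↔ m 7 0 t ≠ 0 := by simp [mem_markedSet, hc]
  simp only [stepProg, den, ← hm₁, Expr.eval, hw2, f7]
  by_cases h7 : m 7 0 t = 0
  · rw [if_pos h7]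
    set m₂ := m₁.write 7 0 t 1 with hm₂
    have g0 : m₂ 0 0 0 = n := by rw [hm₂, write_array_ne _ _ _ _ (by decide), f0, hn]
    have g9 : m₂ 9 = m₁ 9 := write_array_ne _ _ _ _ (by decide)
    have g8 : m₂ 8 = m 8 := by rw [hm₂, write_array_ne _ _ _ _ (by decide), f8]
    have g11 : m₂ 11 = m₁ 11 := write_array_ne _ _ _ _ (by decide)
    have hfr₂ : ∀ a, a ≠ 10 → a ≠ 8 → (copyRow 9 (.lit 0) 8 (.var 11)).den m₂ a = m₂ a :=
      fun a h1 h2 => den_eq_of_not_mem_writes _ _ (by simp [copyRow, writes, h1, h2])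
    have hrow := row_copyRow (n := n) (a := 9) (b := 8) (I := 0) (J := t) (i := .lit 0)
      (j := .var 11) (m := m₂) g0 (by decide) (by decide) (by decide) (fun m' hm' => by
        simp [Expr.eval, hm' 11 (by decide) (by decide), g11, hw2])
    ext1
    · simp only [traceState, TraceState.step, hcy]
      ext x
      rw [Finset.mem_insert, mem_markedSet, mem_markedSet, hfr₂ 7 (by decide) (by decide)]
      simp only [hm₂, Memory.write, f7]
      by_cases hx : x = t
      · simp [hx, hc]
      · simp [hx]
    · simp only [traceState, TraceState.step, hcy, if_neg (fun h => (hmem.1 h) h7)]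
      rw [hrow, row_congr g8, row_congr g9, hcur]
    · simp only [traceState, TraceState.step]
      rw [row_congr (hfr₂ 9 (by decide) (by decide)), row_congr g9, hcur]
    · simp only [traceState, TraceState.step, hcy]
      rw [hfr₂ 11 (by decide) (by decide), g11, hw2]
  · rw [if_neg h7]
    have hfr₂ : ∀ a, a ≠ 13 → skipProg.den m₁ a = m₁ a :=
      fun a h1 => den_eq_of_not_mem_writes _ _ (by simp [skipProg, writes, h1])
    ext1
    · simp only [traceState, TraceState.step, hcy]
      rw [markedSet_congr (hfr₂ 7 (by decide)), markedSet_congr f7,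
        Finset.insert_eq_of_mem (hmem.2 h7)]
    · simp only [traceState, TraceState.step, hcy, if_pos (hmem.2 h7)]
      rw [row_congr (hfr₂ 8 (by decide)), row_congr f8]
    · simp only [traceState, TraceState.step]
      rw [row_congr (hfr₂ 9 (by decide)), hcur]
    · simp only [traceState, TraceState.step, hcy]
      rw [hfr₂ 11 (by decide), hw2]

theorem traceState_congr {n : ℕ} {m m' : Memory} (h7 : m' 7 = m 7) (h8 : m' 8 = m 8)
    (h9 : m' 9 = m 9) (h11 : m' 11 = m 11) : traceState n m' = traceState n m := by
  simp only [traceState, row_congr h8, row_congr h9, markedSet_congr h7, h11]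

theorem loadProg_den {n w : ℕ} {m : Memory} (hn : m 0 0 0 = n) (hw : 11 < w) :
    traceState n ((loadProg w).den m) =
      ⟨markedSet n m, row n m 8, row n m 8 (m w 0 0), m w 0 0⟩ := by
  have hw1 : w ≠ 10 := by omega
  have hw2 : w ≠ 9 := by omega
  have hrow := row_copyRow (n := n) (a := 8) (b := 9) (I := m w 0 0) (J := 0) (i := .var w)
    (j := .lit 0) (m := m) hn (by decide) (by decide) (by decide) (fun m' hm' => by
      simp [Expr.eval, hm' w hw1 hw2])
  have hfr : ∀ a, a ≠ 10 → a ≠ 9 → (copyRow 8 (.var w) 9 (.lit 0)).den m a = m a :=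
    fun a h1 h2 => den_eq_of_not_mem_writes _ _ (by simp [copyRow, writes, h1, h2])
  simp only [loadProg, den, Expr.eval, traceState]
  ext1
  · simp only
    rw [markedSet_congr (write_array_ne _ _ _ _ (by decide)),
      markedSet_congr (hfr 7 (by decide) (by decide))]
  · simp only
    rw [row_congr (write_array_ne _ _ _ _ (by decide)),
      row_congr (hfr 8 (by decide) (by decide))]
  · simp only
    rw [row_congr (write_array_ne _ _ _ _ (by decide)), hrow, Function.update_self]
  · simp [Memory.write, hfr w hw1 hw2]

theorem growProg_den {n w w' : ℕ} {m : Memory} (hn : m 0 0 0 = n) (hw : 13 < w) (hw' : 13 < w')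
    (hu : m w 0 0 < n) (hv : m w' 0 0 < n) (huv : row n m 8 (m w 0 0) (m w' 0 0) < n) :
    traceState n ((growProg w w').den m) = TraceState.step
      ⟨markedSet n m, row n m 8, row n m 8 (m w 0 0), m w 0 0⟩ (m w' 0 0) := by
  have h1 := loadProg_den hn (show 11 < w by omega)
  have hfr : ∀ a, a ≠ 10 → a ≠ 9 → a ≠ 11 → (loadProg w).den m a = m a :=
    fun a h1 h2 h3 => den_eq_of_not_mem_writes _ _ (by simp [loadProg, copyRow, writes, h1, h2, h3])
  simp only [growProg, den, Expr.eval]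
  set m₁ := (loadProg w).den m with hm₁
  have e' : m₁ w' 0 0 = m w' 0 0 := by rw [hfr w' (by omega) (by omega) (by omega)]
  rw [e']
  set m₂ := m₁.write 12 0 0 (m w' 0 0) with hm₂
  have g : ∀ a, a ≠ 12 → m₂ a = m₁ a := fun a ha => write_array_ne _ _ _ _ ha
  have h2 : traceState n m₂ = traceState n m₁ := traceState_congr (g 7 (by decide))
    (g 8 (by decide)) (g 9 (by decide)) (g 11 (by decide))
  have h12 : m₂ 12 0 0 = m w' 0 0 := by simp [hm₂, Memory.write]
  rw [h1] at h2
  have h9 : row n m₂ 9 0 = row n m 8 (m w 0 0) := congrArg TraceState.cur h2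
  have h11 : m₂ 11 0 0 = m w 0 0 := congrArg TraceState.z h2
  rw [stepProg_den (by rw [g 0 (by decide), hfr 0 (by decide) (by decide) (by decide), hn])
    (by rw [h12]; exact hv) (by rw [h11]; exact hu) (by rw [h12, h9]; exact huv), h2, h12]

end ExactMatching

/-! ### Tracing a blossom and treating one edge in memory -/

namespace ExactMatching

open RAM RAM.ForProg

theorem traceProg_den {n w : ℕ} {m : Memory} (hn : m 0 0 0 = n) (hw : 13 < w) (hw' : w < 17)
    (J : ℕ → TraceState ℕ → Prop)
    (hJ : ∀ i s, J i s → s.z < n ∧ s.W (m w 0 0) s.z < n ∧ s.cur (s.W (m w 0 0) s.z) < n ∧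
      J (i + 1) (s.step (s.W (m w 0 0) s.z)))
    (h0 : J 0 (traceState n m)) : J n (traceState n ((traceProg w).den m)) := by
  refine loop_rule (fun i m' => J i (traceState n m')) hn ?_ ?_
  · rw [traceState_congr] <;> first | exact h0 | exact write_array_ne _ _ _ _ (by decide)
  · intro i m' _ hi hx hfr
    have f0 : m' 0 = m 0 := hfr 0 (by
      simp [writes, stepProg, swapProg, skipProg, copyRow])
    have fw : m' w = m w := hfr w (by
      simp [writes, stepProg, swapProg, skipProg, copyRow]; omega)
    obtain ⟨h1, h2, h3, h4⟩ := hJ i _ hi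
    have hz : (traceState n m').z = m' 11 0 0 := rfl
    have e : m' 8 (m w 0 0) (m' 11 0 0) = (traceState n m').W (m w 0 0) (traceState n m').z := by
      rw [hz] at h1 ⊢
      simp [traceState, row, h1]
    simp only [den, Expr.eval, fw]
    rw [traceState_congr (write_array_ne _ _ _ _ (by decide)) (write_array_ne _ _ _ _ (by decide))
      (write_array_ne _ _ _ _ (by decide)) (write_array_ne _ _ _ _ (by decide)), e]
    set y := (traceState n m').W (m w 0 0) (traceState n m').z with hy
    set m₂ := m'.write 12 0 0 y with hm₂
    have g : ∀ a, a ≠ 12 → m₂ a = m' a := fun a ha => write_array_ne _ _ _ _ ha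
    have h12 : m₂ 12 0 0 = y := by simp [hm₂, Memory.write]
    have hts : traceState n m₂ = traceState n m' := traceState_congr (g 7 (by decide))
      (g 8 (by decide)) (g 9 (by decide)) (g 11 (by decide))
    rw [stepProg_den (n := n) (by rw [g 0 (by decide), f0, hn]) (by rw [h12]; exact h2)
      (by rw [g 11 (by decide)]; exact h1)
      (by rw [h12, row_congr (g 9 (by decide))]; exact h3), hts, h12]
    exact h4

/-- The memory holds a valid search from `r`. -/
def SearchMem (n : ℕ) (H : ℕ → ℕ → Prop) (r : ℕ) (X : Set ℕ) (N : ℕ → ℕ) (m : Memory) : Prop :=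
  ∃ I cls, Search H r X N (markedSet n m) I cls (row n m 8)

/-- The rows of `D` are still present. -/
def Extends (D D' : Finset ℕ) (W W' : ℕ → ℕ → ℕ) : Prop := D ⊆ D' ∧ ∀ x ∈ D, W' x = W x

/-- The edge `u v` does not extend the search. -/
def Stuck (D : Finset ℕ) (W : ℕ → ℕ → ℕ) (u v : ℕ) : Prop :=
  (v ∉ D → W u v ∈ D) ∧ (v ∈ D → ∀ x, Reach (W u) (W v) u x → x ∈ D)

theorem Extends.refl (D : Finset ℕ) (W : ℕ → ℕ → ℕ) : Extends D D W W :=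
  ⟨subset_rfl, fun _ _ => rfl⟩

theorem Extends.trans {D D' D'' : Finset ℕ} {W W' W'' : ℕ → ℕ → ℕ} (h : Extends D D' W W')
    (h' : Extends D' D'' W' W'') : Extends D D'' W W'' :=
  ⟨h.1.trans h'.1, fun x hx => (h'.2 x (h.1 hx)).trans (h.2 x hx)⟩

theorem Stuck.congr {D : Finset ℕ} {W W' : ℕ → ℕ → ℕ} {u v : ℕ} (hu : u ∈ D)
    (hW : ∀ x ∈ D, W' x = W x) (h : Stuck D W' u v) : Stuck D W u v := by
  refine ⟨fun hv => ?_, fun hv => ?_⟩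
  · rw [← hW u hu]; exact h.1 hv
  · rw [← hW u hu, ← hW v hv]; exact h.2 hv

section

variable {n : ℕ} {H : ℕ → ℕ → Prop} {r : ℕ} {X : Set ℕ} {N : ℕ → ℕ}

theorem MatchingMap.lt {E : Set ℕ} {f : ℕ → ℕ} (hf : MatchingMap H E f)
    (hlt : ∀ x y, H x y → x < n ∧ y < n) {x : ℕ} (hx : x < n) : f x < n := by
  by_cases h : f x = x
  · rw [h]; exact hx
  · exact (hlt _ _ (hf.adj x h)).2

theorem Search.inner_lt {D I : Finset ℕ} {cls : ℕ → ℕ} {W : ℕ → ℕ → ℕ}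
    (h : Search H r X N D I cls W) (hlt : ∀ x y, H x y → x < n ∧ y < n) {y : ℕ} (hy : y ∈ I) :
    y < n := by
  have h1 := h.inner r h.root y hy
  have h2 : W r y ≠ y := fun e => h.disj _ h1 (e.symm ▸ hy)
  exact (hlt _ _ ((h.matching r h.root).adj y h2)).1

/-- The program does not test whether the component contains an inner vertex. It marks the whole
component in any case, so if no mark was added the component was contained in D before, which is the
last clause. -/
theorem blossomProg_den {m : Memory} (hn : m 0 0 0 = n) (hH : ∀ x y, H x y → H y x)
    (hlt : ∀ x y, H x y → x < n ∧ y < n) (h : SearchMem n H r X N m)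
    (hu : m 14 0 0 ∈ markedSet n m) (hv : m 15 0 0 ∈ markedSet n m)
    (huv : H (m 14 0 0) (m 15 0 0)) (hne : m 14 0 0 ≠ m 15 0 0) :
    SearchMem n H r X N (blossomProg.den m) ∧
      Extends (markedSet n m) (markedSet n (blossomProg.den m)) (row n m 8)
        (row n (blossomProg.den m) 8) ∧
      (markedSet n (blossomProg.den m) = markedSet n m →
        ∀ x, Reach (row n m 8 (m 14 0 0)) (row n m 8 (m 15 0 0)) (m 14 0 0) x →
          x ∈ markedSet n m) := by
  classical
  obtain ⟨I, cls, h⟩ := h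
  set D := markedSet n m with hD
  set W := row n m 8 with hW
  set u := m 14 0 0 with hu'
  set v := m 15 0 0 with hv'
  let C : Finset ℕ := (D ∪ I).filter (Reach (W u) (W v) u)
  have hC : ∀ x, x ∈ C ↔ Reach (W u) (W v) u x := fun x => by
    simp only [C, Finset.mem_filter, Finset.mem_union]
    exact ⟨And.right, fun hx => ⟨h.mem_of_reach hu hv hx, hx⟩⟩
  have hClt : ∀ x ∈ C, x < n := fun x hx => by
    rcases h.mem_of_reach hu hv ((hC x).1 hx) with h1 | h1
    exacts [(mem_markedSet.1 h1).1, h.inner_lt hlt h1]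
  have hCcard : C.card ≤ n := by
    have := Finset.card_le_card (fun x hx => Finset.mem_range.2 (hClt x hx) : C ⊆ Finset.range n)
    simpa using this
  obtain ⟨hCX, hWC⟩ := h.component_facts hu hv hC
  obtain ⟨l, hlC, hl, hl'⟩ := h.exists_last hu hv hC
  -- Hence n iterations complete either trace.
  have hln : l < n := by omega
  have hvC := h.mem_component hu hv hC
  have huC : u ∈ C := (hC u).2 .base
  have hbd : ∀ {E : Finset ℕ} {w b : ℕ} {s : TraceState ℕ},
      Rotation H X D W u v C E w s → (w = u ∨ w = v) → (b = u ∨ b = v) → b ∈ D →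
      s.z < n ∧ s.W b s.z < n ∧ s.cur (s.W b s.z) < n := by
    intro E w b s hs hw hb hbD
    have h1 : s.W b s.z ∈ C := by rw [hs.rows b hbD]; exact (hWC b hb).1 _ hs.z_mem
    exact ⟨hClt _ hs.z_mem, hClt _ h1, hs.matching.lt hlt (hClt _ h1)⟩
  -- the trace along the even vertices
  set m₁ := (loadProg 14).den m with hm₁
  have t₁ : traceState n m₁ = ⟨D, W, W u, u⟩ := loadProg_den hn (by decide)
  have f₁ : ∀ a, a ∉ (loadProg 14).writes → m₁ a = m a := fun a ha =>
    den_eq_of_not_mem_writes _ _ ha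
  have R₁ : Rotation H X D W u v C D u (traceState n m₁) := by
    rw [t₁]
    exact h.rotation_start hu hv hC (Or.inl rfl) subset_rfl subset_rfl Finset.subset_union_left
      (fun _ _ => rfl) (fun p hp hpD => absurd hp hpD) rfl rfl
  have E₁ : EvenTrace H X D W u v C D l 0 (traceState n m₁) :=
    Search.evenTrace_start hu R₁ (by rw [t₁]) (by rw [t₁])
  set m₂ := (traceProg 15).den m₁ with hm₂
  have e15 : m₁ 15 0 0 = v := by rw [f₁ 15 (by decide)]
  have E₂ : EvenTrace H X D W u v C D l n (traceState n m₂) := by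
    refine traceProg_den (w := 15) (by rw [f₁ 0 (by decide), hn]) (by decide) (by decide)
      (EvenTrace H X D W u v C D l) (fun i s hs => ?_) E₁
    rw [e15]
    obtain ⟨b1, b2, b3⟩ := hbd hs.toRotation (Or.inl rfl) (Or.inr rfl) hv
    exact ⟨b1, b2, b3, h.evenTrace_step hu hv hC hH hl hl' hs⟩
  have f₂ : ∀ a, a ∉ (traceProg 15).writes → m₂ a = m₁ a := fun a ha =>
    den_eq_of_not_mem_writes _ _ ha
  -- the trace along the odd vertices
  have e14 : m₂ 14 0 0 = u := by rw [f₂ 14 (by decide), f₁ 14 (by decide)]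
  have e15' : m₂ 15 0 0 = v := by rw [f₂ 15 (by decide), e15]
  have e0 : m₂ 0 0 0 = n := by rw [f₂ 0 (by decide), f₁ 0 (by decide), hn]
  have hWv : row n m₂ 8 v = W v := E₂.rows v hv
  have un : u < n := hClt u huC
  have vn : v < n := hClt v hvC
  set m₃ := (growProg 15 14).den m₂ with hm₃
  have t₃ : traceState n m₃ = TraceState.step ⟨markedSet n m₂, row n m₂ 8, W v, v⟩ u := by
    have := growProg_den (n := n) (w := 15) (w' := 14) (m := m₂) e0 (by decide) (by decide)
      (by rw [e15']; exact vn) (by rw [e14]; exact un)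
      (by rw [e15', e14, hWv]; exact (h.matching v hv).lt hlt un)
    rwa [e15', e14, hWv] at this
  have R₃ : Rotation H X D W u v C (markedSet n m₂) v ⟨markedSet n m₂, row n m₂ 8, W v, v⟩ :=
    h.rotation_start hu hv hC (Or.inr rfl) E₂.sub subset_rfl E₂.upper E₂.rows E₂.new_rows rfl rfl
  have O₃ : OddTrace H X D W u v C (markedSet n m₂) l 0 (traceState n m₃) := by
    rw [t₃]
    exact h.oddTrace_start hu hv hC hH hl hne R₃ (hH _ _ huv) rfl rfl
  have f₃ : ∀ a, a ∉ (growProg 15 14).writes → m₃ a = m₂ a := fun a ha =>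
    den_eq_of_not_mem_writes _ _ ha
  have e14' : m₃ 14 0 0 = u := by rw [f₃ 14 (by decide), e14]
  have O₄ : OddTrace H X D W u v C (markedSet n m₂) l n (traceState n (blossomProg.den m)) := by
    refine traceProg_den (m := m₃) (w := 14) (by rw [f₃ 0 (by decide), e0]) (by decide) (by decide)
      (OddTrace H X D W u v C (markedSet n m₂) l) (fun i s hs => ?_) O₃
    rw [e14']
    obtain ⟨b1, b2, b3⟩ := hbd hs.toRotation (Or.inr rfl) (Or.inl rfl) hu
    exact ⟨b1, b2, b3, h.oddTrace_step hu hv hC hH hl hl' hs⟩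
  have hE : ∀ j ≤ l, evenVertex W u v j ∈ markedSet n m₂ := by
    intro j hj
    exact E₂.mem j (by rw [min_eq_right hln.le]; exact hj)
  obtain ⟨hCs, cls', hS⟩ := h.search_of_traces hu hv hC hl hl' O₄ (by omega) hE
  refine ⟨⟨_, _, hS⟩, ⟨O₄.sub, O₄.rows⟩, fun he x hx => ?_⟩
  rw [← he]
  exact hCs ((hC x).2 hx)

/-- The matching in array `6` has been improved: the vertex `r` is covered now. -/
def Improved (n : ℕ) (H : ℕ → ℕ → Prop) (r : ℕ) (N : ℕ → ℕ) (m : Memory) : Prop :=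
  m 16 0 0 ≠ 0 ∧ MatchingMap H {x | row n m 6 0 x = x} (row n m 6 0) ∧
    (∀ x, row n m 6 0 x = x → N x = x) ∧ row n m 6 0 r ≠ r

theorem augmentProg_den {m : Memory} (hn : m 0 0 0 = n) (hun : m 14 0 0 < n) (hvn : m 15 0 0 < n)
    (hne : m 14 0 0 ≠ m 15 0 0) :
    row n (augmentProg.den m) 6 0 = join (row n m 8 (m 14 0 0)) (m 14 0 0) (m 15 0 0) ∧
      augmentProg.den m 16 0 0 = 1 := by
  have hrow := row_copyRow (n := n) (a := 8) (b := 6) (I := m 14 0 0) (J := 0) (i := .var 14)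
    (j := .lit 0) (m := m) hn (by decide) (by decide) (by decide) (fun m' hm' => by
      simp [Expr.eval, hm' 14 (by decide) (by decide)])
  have hfr : ∀ a, a ≠ 10 → a ≠ 6 → (copyRow 8 (.var 14) 6 (.lit 0)).den m a = m a :=
    fun a h1 h2 => den_eq_of_not_mem_writes _ _ (by simp [copyRow, writes, h1, h2])
  simp only [augmentProg, den, Expr.eval]
  set m₁ := (copyRow 8 (.var 14) 6 (.lit 0)).den m with hm₁
  have h14 := hfr 14 (by decide) (by decide)
  have h15 := hfr 15 (by decide) (by decide)
  refine ⟨?_, by simp [Memory.write]⟩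
  funext x
  have hx := congrFun (congrFun hrow 0) x
  rw [Function.update_self] at hx
  rw [join, ← hx]
  by_cases hxn : x < n
  · simp only [row, hxn, if_true]
    by_cases h1 : x = m 14 0 0
    · simp [Memory.write, h14, h15, h1, hne]
    · by_cases h2 : x = m 15 0 0 <;> simp [Memory.write, h14, h15, h1, h2, hne.symm]
  · have h1 : x ≠ m 14 0 0 := by omega
    have h2 : x ≠ m 15 0 0 := by omega
    simp [row, hxn, h1, h2]

/-- What is achieved by treating the edge `u v`. -/
theorem edgeProg_den {m : Memory} (hn : m 0 0 0 = n) (hH : ∀ x y, H x y → H y x)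
    (hirr : ∀ x, ¬ H x x) (hHm : ∀ x y, H x y ↔ x < n ∧ y < n ∧ m 5 x y ≠ 0)
    (hX : ∀ x ∈ X, N x = x) (h : SearchMem n H r X N m) (h16 : m 16 0 0 = 0)
    (hun : m 14 0 0 < n) (hvn : m 15 0 0 < n) :
    Improved n H r N (edgeProg.den m) ∨
      edgeProg.den m 16 0 0 = 0 ∧ edgeProg.den m 6 = m 6 ∧ SearchMem n H r X N (edgeProg.den m) ∧
      Extends (markedSet n m) (markedSet n (edgeProg.den m)) (row n m 8)
        (row n (edgeProg.den m) 8) ∧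
      (markedSet n (edgeProg.den m) = markedSet n m → m 14 0 0 ∈ markedSet n m →
        H (m 14 0 0) (m 15 0 0) → Stuck (markedSet n m) (row n m 8) (m 14 0 0) (m 15 0 0)) := by
  have hlt : ∀ x y, H x y → x < n ∧ y < n := fun x y hxy =>
    ⟨((hHm x y).1 hxy).1, ((hHm x y).1 hxy).2.1⟩
  have hskip : ∀ a, a ≠ 13 → skipProg.den m a = m a := fun a ha =>
    den_eq_of_not_mem_writes _ _ (by simp [skipProg, writes, ha])
  have hskipMem : SearchMem n H r X N (skipProg.den m) := by
    unfold SearchMem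
    rw [markedSet_congr (hskip 7 (by decide)), row_congr (hskip 8 (by decide))]
    exact h
  have hskipExt : Extends (markedSet n m) (markedSet n (skipProg.den m)) (row n m 8)
        (row n (skipProg.den m) 8) := by
    rw [markedSet_congr (hskip 7 (by decide)), row_congr (hskip 8 (by decide))]
    exact Extends.refl _ _
  have hmem : ∀ x < n, (x ∈ markedSet n m ↔ m 7 0 x ≠ 0) := fun x hx => by
    simp [mem_markedSet, hx]
  rw [edgeProg, den_ite_of_eq (by simpa [Expr.eval] using h16)]
  by_cases hu : m 7 0 (m 14 0 0) = 0
  · rw [den_ite_of_eq (by simpa [Expr.eval] using hu)]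
    exact Or.inr ⟨by rw [hskip 16 (by decide), h16], hskip 6 (by decide), hskipMem, hskipExt,
      fun _ hu' => absurd hu ((hmem _ hun).1 hu')⟩
  rw [den_ite_of_ne (by simpa [Expr.eval] using hu)]
  by_cases huv : m 5 (m 14 0 0) (m 15 0 0) = 0
  · rw [den_ite_of_eq (by simpa [Expr.eval] using huv)]
    exact Or.inr ⟨by rw [hskip 16 (by decide), h16], hskip 6 (by decide), hskipMem, hskipExt,
      fun _ _ huv' => absurd huv ((hHm _ _).1 huv').2.2⟩
  rw [den_ite_of_ne (by simpa [Expr.eval] using huv)]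
  have hu' := (hmem _ hun).2 hu
  have huv' : H (m 14 0 0) (m 15 0 0) := (hHm _ _).2 ⟨hun, hvn, huv⟩
  have hne : m 14 0 0 ≠ m 15 0 0 := fun e => hirr _ (by rw [← e] at huv'; exact huv')
  by_cases hv : m 7 0 (m 15 0 0) = 0
  · have hv' : m 15 0 0 ∉ markedSet n m := fun hmem' => (hmem _ hvn).1 hmem' hv
    rw [den_ite_of_eq (by simpa [Expr.eval] using hv)]
    obtain ⟨I, cls, hS⟩ := h
    have hM := hS.matching _ hu'
    have hrow : m 8 (m 14 0 0) (m 15 0 0) = row n m 8 (m 14 0 0) (m 15 0 0) := by simp [row, hvn]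
    have hcond : (neExpr (.read 8 (.var 14) (.var 15)) (.var 15)).eval m = 0 ↔
        row n m 8 (m 14 0 0) (m 15 0 0) = m 15 0 0 := by
      rw [neExpr_eval, ← hrow]; rfl
    by_cases hc : row n m 8 (m 14 0 0) (m 15 0 0) = m 15 0 0
    · rw [den_ite_of_eq (hcond.2 hc)]
      left
      obtain ⟨h6, h16'⟩ := augmentProg_den hn hun hvn hne
      -- A vertex other than u that `W u` fixes is an exposed vertex of the original matching.
      -- Joining it to u leaves only vertices of X exposed, and r is not among them.
      have hvX : m 15 0 0 ∈ X := ((hM.fixed _).1 hc).resolve_left hne.symm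
      have hJ := hM.join hH huv' (Set.mem_insert _ _) (Set.mem_insert_of_mem _ hvX) hne
      have key : ∀ x, join (row n m 8 (m 14 0 0)) (m 14 0 0) (m 15 0 0) x = x → x ∈ X := by
        intro x hx
        have := (hJ.fixed x).1 hx
        simp only [Set.mem_sdiff, Set.mem_insert_iff, Set.mem_singleton_iff, not_or] at this
        tauto
      refine ⟨by rw [h16']; decide, ?_, ?_, ?_⟩
      · rw [h6]; exact ⟨hJ.invol, hJ.adj, fun x => Iff.rfl⟩
      · rw [h6]; exact fun x hx => hX x (key x hx)
      · rw [h6]; exact fun hr => hS.not_exposed r hS.root (key r hr)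
    · rw [den_ite_of_ne (fun hh => hc (hcond.1 hh))]
      right
      have hvX : m 15 0 0 ∉ X := fun hx => hc ((hM.fixed _).2 (Set.mem_insert_of_mem _ hx))
      have hfr : ∀ a, a ∉ (growProg 14 15).writes → (growProg 14 15).den m a = m a := fun a ha =>
        den_eq_of_not_mem_writes _ _ ha
      have hg := growProg_den (n := n) (w := 14) (w' := 15) hn (by decide) (by decide) hun hvn
        (hM.lt hlt hvn)
      have hgD : markedSet n ((growProg 14 15).den m) = _ := congrArg TraceState.D hg
      have hgW : row n ((growProg 14 15).den m) 8 = _ := congrArg TraceState.W hg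
      simp only [TraceState.step] at hgD hgW
      have hExt : Extends (markedSet n m) (markedSet n ((growProg 14 15).den m)) (row n m 8)
          (row n ((growProg 14 15).den m) 8) := by
        rw [hgD, hgW]
        refine ⟨Finset.subset_insert _ _, fun x hx => ?_⟩
        split_ifs with hw
        · rfl
        · rw [Function.update_of_ne]
          rintro rfl; exact hw hx
      refine ⟨by rw [hfr 16 (by decide), h16], hfr 6 (by decide), ?_, hExt, ?_⟩
      -- If the partner of v is already outer, as happens for inner v, the program stores no new row
      -- and the search is unchanged.
      · by_cases hw : row n m 8 (m 14 0 0) (m 15 0 0) ∈ markedSet n m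
        · unfold SearchMem
          rw [hgD, hgW, if_pos hw, Finset.insert_eq_of_mem hw]
          exact ⟨I, cls, hS⟩
        · have hgr := hS.grow hH hu' huv' hv' hvX hw (W' := row n ((growProg 14 15).den m) 8)
            hExt.2 (by rw [hgW, if_neg hw, Function.update_self])
          rw [← hgD] at hgr
          exact ⟨_, hgr⟩
      · intro hD _ _
        refine ⟨fun _ => ?_, fun hh => absurd hh hv'⟩
        rw [← hD, hgD]; exact Finset.mem_insert_self _ _
  · have hv' := (hmem _ hvn).2 hv
    rw [den_ite_of_ne (by simpa [Expr.eval] using hv)]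
    right
    have hfr : ∀ a, a ∉ blossomProg.writes → blossomProg.den m a = m a := fun a ha =>
      den_eq_of_not_mem_writes _ _ ha
    obtain ⟨h1, h2, h3⟩ := blossomProg_den hn hH hlt h hu' hv' huv' hne
    exact ⟨by rw [hfr 16 (by decide), h16], hfr 6 (by decide), h1, h2,
      fun hD _ _ => ⟨fun hh => absurd hv' hh, fun _ => h3 hD⟩⟩

end

end ExactMatching

/-! ### Perfect matchings by repeated augmentation -/

namespace ExactMatching

open RAM RAM.ForProg

/-- One pass over all edges, unless the matching has already been augmented. -/
def roundProg : ForProg := .ite (.var 16) skipProg (.loop 14 0 (.loop 15 0 edgeProg))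

/-- Search for an augmenting path from the vertex in variable `19`. -/
def searchProg : ForProg :=
  .seq (.seq (.assign 16 (.lit 0) (.lit 0) (.lit 0))
      (.seq (.loop 10 0 (.assign 7 (.lit 0) (.var 10) (.lit 0)))
        (.seq (.assign 7 (.lit 0) (.var 19) (.lit 1)) (copyRow 6 (.lit 0) 8 (.var 19)))))
    (.loop 18 0 roundProg)

/-- Find a perfect matching of the graph in array `5`, if there is one. -/
def matchProg : ForProg :=
  .seq (.loop 10 0 (.assign 6 (.lit 0) (.var 10) (.var 10)))
    (.loop 19 0 (.ite (neExpr (.read 6 (.lit 0) (.var 19)) (.var 19)) skipProg searchProg))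

/-- The graph `H` on the vertices below `n` has a perfect matching. -/
def HasPerfectMatching (n : ℕ) (H : ℕ → ℕ → Prop) : Prop :=
  ∃ g : ℕ → ℕ, (∀ x, g (g x) = x) ∧ ∀ x < n, H x (g x)

section

variable {n : ℕ} {H : ℕ → ℕ → Prop} {r : ℕ} {X : Set ℕ} {N : ℕ → ℕ}

/-- An unmarked vertex v whose partner is outer must be inner, by `blossom` at this partner; so the
test that the program can make without storing I yields the hypothesis of `Search.no_matching`. -/
theorem SearchMem.not_hasPerfectMatching {m : Memory} (h : SearchMem n H r X N m)
    (hirr : ∀ x, ¬ H x x) (hstuck : ∀ u ∈ markedSet n m, ∀ v, H u v →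
      Stuck (markedSet n m) (row n m 8) u v) : ¬ HasPerfectMatching n H := by
  rintro ⟨g, hg, hgH⟩
  obtain ⟨I, cls, h⟩ := h
  have hlt : ∀ x ∈ markedSet n m, x < n := fun x hx => (mem_markedSet.1 hx).1
  refine h.no_matching (fun u hu v huv => ?_) hg (fun x hx => hgH x (hlt x hx)) (fun x hx e => ?_)
  · obtain ⟨h1, h2⟩ := hstuck u hu v huv
    by_cases hv : v ∈ markedSet n m
    · exact Or.inr ⟨hv, h2 hv⟩
    · left
      have := h.blossom u hu _ (h1 hv)
      rw [(h.matching u hu).invol] at this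
      exact this.resolve_right fun hh => hv hh.1
  · have := hgH x (hlt x hx)
    rw [e] at this; exact hirr x this

/-- The invariant of a pass: either the matching has been improved, or the search goes on, and if
nothing has changed then the edges in `P` are stuck. -/
def RoundInv (n : ℕ) (H : ℕ → ℕ → Prop) (r : ℕ) (X : Set ℕ) (N : ℕ → ℕ) (m₀ : Memory)
    (P : ℕ → ℕ → Prop) (m : Memory) : Prop :=
  Improved n H r N m ∨ m 16 0 0 = 0 ∧ m 6 = m₀ 6 ∧ SearchMem n H r X N m ∧
    Extends (markedSet n m₀) (markedSet n m) (row n m₀ 8) (row n m 8) ∧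
    (markedSet n m = markedSet n m₀ → ∀ u v, P u v → u ∈ markedSet n m₀ → H u v →
      Stuck (markedSet n m₀) (row n m₀ 8) u v)

theorem Improved.congr {m m' : Memory} (h : Improved n H r N m) (h6 : m' 6 = m 6)
    (h16 : m' 16 = m 16) : Improved n H r N m' := by
  unfold Improved at h ⊢
  rwa [row_congr h6, h16]

theorem SearchMem.congr {m m' : Memory} (h : SearchMem n H r X N m) (h7 : m' 7 = m 7)
    (h8 : m' 8 = m 8) : SearchMem n H r X N m' := by
  unfold SearchMem at h ⊢
  rwa [markedSet_congr h7, row_congr h8]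

theorem RoundInv.congr {m₀ m m' : Memory} {P P' : ℕ → ℕ → Prop} (h : RoundInv n H r X N m₀ P m)
    (hP : ∀ u v, H u v → P' u v → P u v) (hm : ∀ a, a < 9 → m' a = m a) (h16 : m' 16 = m 16) :
    RoundInv n H r X N m₀ P' m' := by
  have h6 := hm 6 (by decide)
  have h7 := hm 7 (by decide)
  have h8 := hm 8 (by decide)
  rcases h with h | ⟨h1, h2, h3, h4, h5⟩
  · exact Or.inl (h.congr h6 h16)
  · refine Or.inr ⟨by rw [h16, h1], h6.trans h2, h3.congr h7 h8, ?_, ?_⟩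
    · rwa [markedSet_congr h7, row_congr h8]
    · rw [markedSet_congr h7]
      exact fun hD u v hP' hu huv => h5 hD u v (hP u v huv hP') hu huv

/-- D only grows and its old rows persist. If a pass leaves D unchanged, all its edges were
therefore found stuck with respect to one and the same search, which excludes a perfect matching. -/
theorem roundProg_den {m : Memory} (hn : m 0 0 0 = n) (hH : ∀ x y, H x y → H y x)
    (hirr : ∀ x, ¬ H x x) (hHm : ∀ x y, H x y ↔ x < n ∧ y < n ∧ m 5 x y ≠ 0)
    (hX : ∀ x ∈ X, N x = x) (h : SearchMem n H r X N m) (h16 : m 16 0 0 = 0) :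
    Improved n H r N (roundProg.den m) ∨
      roundProg.den m 16 0 0 = 0 ∧ roundProg.den m 6 = m 6 ∧
      SearchMem n H r X N (roundProg.den m) ∧
      ((markedSet n m).card < (markedSet n (roundProg.den m)).card ∨
        ¬ HasPerfectMatching n H) := by
  have hlt : ∀ x y, H x y → x < n ∧ y < n := fun x y hxy =>
    ⟨((hHm x y).1 hxy).1, ((hHm x y).1 hxy).2.1⟩
  rw [roundProg, den_ite_of_eq (by simpa [Expr.eval] using h16)]
  have hw : ∀ a ∈ edgeProg.writes, a = 6 ∨ a = 7 ∨ a = 8 ∨ a = 9 ∨ a = 10 ∨ a = 11 ∨ a = 12 ∨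
      a = 13 ∨ a = 16 ∨ a = 17 := by decide
  have key : RoundInv n H r X N m (fun u _ => u < n) ((loop 14 0 (.loop 15 0 edgeProg)).den m) := by
    refine loop_rule (fun i m' => RoundInv n H r X N m (fun u _ => u < i) m') hn ?_ ?_
    · exact Or.inr ⟨h16, rfl, h, Extends.refl _ _, fun _ u v hu => by omega⟩
    · intro i m₁ hi hI h14 hfr₁
      have hfr₁' : ∀ a, a < 6 → m₁ a = m a := fun a ha => hfr₁ a (fun hmem => by
        simp only [writes, List.mem_cons] at hmem
        rcases hmem with h1 | h1 | h1
        · omega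
        · omega
        · have := hw a h1; omega)
      have inner : RoundInv n H r X N m (fun u v => u < i ∨ u = i ∧ v < n)
          ((loop 15 0 edgeProg).den m₁) := by
        refine loop_rule (fun j m' => RoundInv n H r X N m (fun u v => u < i ∨ u = i ∧ v < j) m')
          (by rw [hfr₁' 0 (by decide), hn]) ?_ ?_
        · exact hI.congr (fun u v _ hP => by omega)
            (fun a ha => write_array_ne _ _ _ _ (by omega)) (write_array_ne _ _ _ _ (by decide))
        · intro j m₂ hj hJ h15 hfr₂
          have hfr₂' : ∀ a, a < 6 ∨ a = 14 → m₂ a = m₁ a := fun a ha => hfr₂ a (fun hmem => by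
            simp only [writes, List.mem_cons] at hmem
            rcases hmem with h1 | h1
            · omega
            · have := hw a h1; omega)
          have g : ∀ a, a ≠ 15 → ((edgeProg.den m₂).write 15 0 0 (j + 1)) a = edgeProg.den m₂ a :=
            fun a ha => write_array_ne _ _ _ _ ha
          have g14 : m₂ 14 0 0 = i := by rw [hfr₂' 14 (by decide), h14]
          have hstep : RoundInv n H r X N m (fun u v => u < i ∨ u = i ∧ v < j + 1)
              (edgeProg.den m₂) := by
            rcases hJ with hJ | ⟨h1, h2, h3, h4, h5⟩
            · have hs : ∀ a, a ≠ 13 → edgeProg.den m₂ a = m₂ a := fun a ha => by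
                rw [edgeProg, den_ite_of_ne (by simpa [Expr.eval] using hJ.1)]
                exact den_eq_of_not_mem_writes _ _ (by simp [skipProg, writes, ha])
              exact Or.inl (hJ.congr (hs 6 (by decide)) (hs 16 (by decide)))
            · have h0 : m₂ 0 = m 0 := by rw [hfr₂' 0 (by decide), hfr₁' 0 (by decide)]
              have h5' : m₂ 5 = m 5 := by rw [hfr₂' 5 (by decide), hfr₁' 5 (by decide)]
              rcases edgeProg_den (n := n) (by rw [h0, hn]) hH hirr (by rw [h5']; exact hHm) hX h3 h1
                (by rw [g14]; exact hi) (by rw [h15]; exact hj) with e1 | ⟨e1, e2, e3, e4, e5⟩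
              · exact Or.inl e1
              · refine Or.inr ⟨e1, e2.trans h2, e3, h4.trans e4, fun hD u v hP hu huv => ?_⟩
                have hD₂ : markedSet n m₂ = markedSet n m :=
                  subset_antisymm (hD ▸ e4.1) h4.1
                by_cases hold : u < i ∨ u = i ∧ v < j
                · exact h5 hD₂ u v hold hu huv
                · obtain ⟨rfl, rfl⟩ : u = i ∧ v = j := by omega
                  rw [g14, h15, hD₂] at e5
                  exact (e5 hD hu huv).congr hu h4.2
          exact hstep.congr (fun _ _ _ hP => hP) (fun a ha => g a (by omega)) (g 16 (by decide))
      exact inner.congr (fun u v huv hP => by have := hlt u v huv; omega)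
        (fun a ha => write_array_ne _ _ _ _ (by omega)) (write_array_ne _ _ _ _ (by decide))
  rcases key with key | ⟨h1, h2, h3, h4, h5⟩
  · exact Or.inl key
  · refine Or.inr ⟨h1, h2, h3, ?_⟩
    rcases (Finset.card_le_card h4.1).lt_or_eq with hc | hc
    · exact Or.inl hc
    · right
      have hD := Finset.eq_of_subset_of_card_le h4.1 hc.ge
      exact h.not_hasPerfectMatching hirr fun u hu v huv =>
        h5 hD.symm u v (hlt u v huv).1 hu huv

theorem searchProg_den {m : Memory} (hn : m 0 0 0 = n) (hH : ∀ x y, H x y → H y x)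
    (hirr : ∀ x, ¬ H x x) (hHm : ∀ x y, H x y ↔ x < n ∧ y < n ∧ m 5 x y ≠ 0)
    (hN : MatchingMap H {x | row n m 6 0 x = x} (row n m 6 0)) (hr : m 19 0 0 < n)
    (hrN : row n m 6 0 (m 19 0 0) = m 19 0 0) :
    MatchingMap H {x | row n (searchProg.den m) 6 0 x = x} (row n (searchProg.den m) 6 0) ∧
      (∀ x, row n (searchProg.den m) 6 0 x = x → row n m 6 0 x = x) ∧
      (row n (searchProg.den m) 6 0 (m 19 0 0) ≠ m 19 0 0 ∨ ¬ HasPerfectMatching n H) := by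
  rw [searchProg, den]
  set r := m 19 0 0 with hr'
  set N := row n m 6 0 with hN'
  set X : Set ℕ := {x | x ≠ r ∧ N x = x} with hX'
  have hX : ∀ x ∈ X, N x = x := fun x hx => hx.2
  set init : ForProg := .seq (.assign 16 (.lit 0) (.lit 0) (.lit 0))
      (.seq (.loop 10 0 (.assign 7 (.lit 0) (.var 10) (.lit 0)))
        (.seq (.assign 7 (.lit 0) (.var 19) (.lit 1)) (copyRow 6 (.lit 0) 8 (.var 19)))) with hinit
  have hwi : ∀ a ∈ init.writes, a = 16 ∨ a = 10 ∨ a = 7 ∨ a = 8 := by decide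
  have hfri : ∀ a, a ≠ 16 → a ≠ 10 → a ≠ 7 → a ≠ 8 → init.den m a = m a :=
    fun a h1 h2 h3 h4 => den_eq_of_not_mem_writes _ _ (fun hmem => by
      have := hwi a hmem; omega)
  have hst : SearchMem n H r X N (init.den m) ∧ init.den m 16 0 0 = 0 ∧
      (markedSet n (init.den m)).card = 1 := by
    simp only [hinit, den_seq, den_assign, Expr.eval]
    set m₁ := m.write 16 0 0 0 with hm₁
    have g₁ : ∀ a, a ≠ 16 → m₁ a = m a := fun a ha => write_array_ne _ _ _ _ ha
    have hclear := loop_rule (x := 10) (j := 0) (p := .assign 7 (.lit 0) (.var 10) (.lit 0))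
      (m := m₁) (b := n) (fun i m' => ∀ x < i, m' 7 0 x = 0) (by rw [g₁ 0 (by decide), hn])
      (fun x hx => by omega) (fun i m' hi hI hx _ x hxi => by
        simp only [den, Expr.eval, hx]
        by_cases e : x = i
        · simp [Memory.write, e]
        · simp only [Memory.write]; simp [e, hI x (by omega)])
    set m₂ := (loop 10 0 (.assign 7 (.lit 0) (.var 10) (.lit 0))).den m₁ with hm₂
    have g₂ : ∀ a, a ≠ 10 → a ≠ 7 → m₂ a = m₁ a := fun a h1 h2 =>
      den_eq_of_not_mem_writes _ _ (by simp [writes, h1, h2])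
    have e19 : m₂ 19 0 0 = r := by rw [g₂ 19 (by decide) (by decide), g₁ 19 (by decide)]
    rw [e19]
    set m₃ := m₂.write 7 0 r 1 with hm₃
    have g₃ : ∀ a, a ≠ 7 → m₃ a = m₂ a := fun a ha => write_array_ne _ _ _ _ ha
    have e19' : m₃ 19 0 0 = r := by rw [g₃ 19 (by decide), e19]
    have e6 : m₃ 6 = m 6 := by
      rw [g₃ 6 (by decide), g₂ 6 (by decide) (by decide), g₁ 6 (by decide)]
    have hrow := row_copyRow (n := n) (a := 6) (b := 8) (I := 0) (J := r) (i := .lit 0)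
      (j := .var 19) (m := m₃)
      (by rw [g₃ 0 (by decide), g₂ 0 (by decide) (by decide), g₁ 0 (by decide), hn])
      (by decide) (by decide) (by decide) (fun m' hm' => by
        simp [Expr.eval, hm' 19 (by decide) (by decide), e19'])
    have g₄ : ∀ a, a ≠ 10 → a ≠ 8 → (copyRow 6 (.lit 0) 8 (.var 19)).den m₃ a = m₃ a :=
      fun a h1 h2 => den_eq_of_not_mem_writes _ _ (by simp [copyRow, writes, h1, h2])
    have hD : markedSet n ((copyRow 6 (.lit 0) 8 (.var 19)).den m₃) = {r} := by
      rw [markedSet_congr (g₄ 7 (by decide) (by decide))]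
      ext x
      rw [mem_markedSet, Finset.mem_singleton]
      constructor
      · rintro ⟨hx, hx'⟩
        by_contra e
        apply hx'
        simp only [hm₃, Memory.write]
        simp [e, hclear x hx]
      · rintro rfl
        exact ⟨hr, by simp [hm₃, Memory.write]⟩
    refine ⟨⟨∅, id, ?_⟩, ?_, by rw [hD]; rfl⟩
    · rw [hD]
      refine (Search.start (N := N) ?_ ?_).congr (fun x hx => ?_)
      · have hset : insert r X = {x | N x = x} := by
          ext x
          simp only [hX', Set.mem_insert_iff, Set.mem_ofPred_eq]
          by_cases e : x = r
          · simp [e, hrN]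
          · simp [e]
        rw [hset]; exact hN
      · simp [hX']
      · rw [Finset.mem_singleton.1 hx, hrow, Function.update_self, row_congr e6]
    · rw [g₄ 16 (by decide) (by decide), g₃ 16 (by decide), g₂ 16 (by decide) (by decide)]
      simp [hm₁, Memory.write]
  set m₁ := init.den m with hm₁
  have e0 : m₁ 0 = m 0 := hfri 0 (by decide) (by decide) (by decide) (by decide)
  have e5 : m₁ 5 = m 5 := hfri 5 (by decide) (by decide) (by decide) (by decide)
  have e6 : m₁ 6 = m 6 := hfri 6 (by decide) (by decide) (by decide) (by decide)
  have hwr : ∀ a ∈ roundProg.writes, 5 < a := by decide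
  -- D starts with one element and grows in each pass that neither augments nor excludes a perfect
  -- matching. After n such passes it would have more than n elements.
  have key := loop_rule (x := 18) (j := 0) (p := roundProg) (m := m₁) (b := n)
    (fun i m' => Improved n H r N m' ∨ m' 16 0 0 = 0 ∧ m' 6 = m 6 ∧ SearchMem n H r X N m' ∧
      (i < (markedSet n m').card ∨ ¬ HasPerfectMatching n H)) (by rw [e0, hn]) (by
      have g : ∀ a, a ≠ 18 → m₁.write 18 0 0 0 a = m₁ a := fun a ha => write_array_ne _ _ _ _ ha
      refine Or.inr ⟨by rw [g 16 (by decide), hst.2.1], by rw [g 6 (by decide), e6],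
        hst.1.congr (g 7 (by decide)) (g 8 (by decide)), Or.inl ?_⟩
      rw [markedSet_congr (g 7 (by decide)), hst.2.2]; exact Nat.one_pos) (by
      intro i m' hi hI hx hfr
      have g : ∀ a, a ≠ 18 → (roundProg.den m').write 18 0 0 (i + 1) a = roundProg.den m' a :=
        fun a ha => write_array_ne _ _ _ _ ha
      have hfr' : ∀ a, a < 6 → m' a = m₁ a := fun a ha => hfr a (fun hmem => by
        simp only [writes, List.mem_cons] at hmem
        rcases hmem with h1 | h1
        · omega
        · have := hwr a h1; omega)
      have h0 : m' 0 = m 0 := by rw [hfr' 0 (by decide), e0]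
      have h5 : m' 5 = m 5 := by rw [hfr' 5 (by decide), e5]
      rcases hI with hI | ⟨i1, i2, i3, i4⟩
      · have hs : ∀ a, a ≠ 13 → roundProg.den m' a = m' a := fun a ha => by
          rw [roundProg, den_ite_of_ne (by simpa [Expr.eval] using hI.1)]
          exact den_eq_of_not_mem_writes _ _ (by simp [skipProg, writes, ha])
        exact Or.inl (hI.congr (by rw [g 6 (by decide), hs 6 (by decide)])
          (by rw [g 16 (by decide), hs 16 (by decide)]))
      · rcases roundProg_den (n := n) (by rw [h0, hn]) hH hirr (by rw [h5]; exact hHm) hX i3 i1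
          with r1 | ⟨r1, r2, r3, r4⟩
        · exact Or.inl (r1.congr (g 6 (by decide)) (g 16 (by decide)))
        · refine Or.inr ⟨by rw [g 16 (by decide), r1], by rw [g 6 (by decide), r2, i2],
            r3.congr (g 7 (by decide)) (g 8 (by decide)), ?_⟩
          rw [markedSet_congr (g 7 (by decide))]
          rcases i4 with i4 | i4
          · rcases r4 with r4 | r4
            · left; omega
            · exact Or.inr r4
          · exact Or.inr i4)
  rcases key with ⟨-, k2, k3, k4⟩ | ⟨-, k2, -, k4⟩
  · exact ⟨k2, k3, Or.inl k4⟩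
  · rw [row_congr k2]
    refine ⟨hN, fun _ hx => hx, Or.inr (k4.resolve_left ?_)⟩
    have : (markedSet n ((loop 18 0 roundProg).den m₁)).card ≤ n :=
      (Finset.card_filter_le _ _).trans_eq (Finset.card_range n)
    omega

/-- One search per vertex suffices: an augmentation exposes no covered vertex, and a single failed
search already shows that there is no perfect matching. -/
theorem matchProg_den {m : Memory} (hn : m 0 0 0 = n) (hH : ∀ x y, H x y → H y x)
    (hirr : ∀ x, ¬ H x x) (hHm : ∀ x y, H x y ↔ x < n ∧ y < n ∧ m 5 x y ≠ 0) :
    MatchingMap H {x | row n (matchProg.den m) 6 0 x = x} (row n (matchProg.den m) 6 0) ∧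
      ((∀ x < n, row n (matchProg.den m) 6 0 x ≠ x) ∨ ¬ HasPerfectMatching n H) := by
  rw [matchProg, den]
  have hinit := loop_rule (x := 10) (j := 0) (p := .assign 6 (.lit 0) (.var 10) (.var 10))
      (m := m) (b := n) (fun i m' => ∀ x < i, m' 6 0 x = x) hn
      (fun x hx => by omega) (fun i m' hi hI hx _ x hxi => by
        simp only [den, Expr.eval, hx]
        by_cases e : x = i
        · simp [Memory.write, e]
        · simp only [Memory.write]; simp [e, hI x (by omega)])
  set m₁ := (loop 10 0 (.assign 6 (.lit 0) (.var 10) (.var 10))).den m with hm₁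
  have hfr₁ : ∀ a, a < 6 → m₁ a = m a := fun a ha =>
    den_eq_of_not_mem_writes _ _ (by simp [writes]; omega)
  have hid : row n m₁ 6 0 = id := by
    funext x
    by_cases hx : x < n
    · simp [row, hx, hinit x hx]
    · simp [row, hx]
  have hw : ∀ a ∈ (ForProg.ite (neExpr (.read 6 (.lit 0) (.var 19)) (.var 19)) skipProg
      searchProg).writes, 5 < a ∧ a ≠ 19 := by decide
  refine loop_rule (fun i m' => MatchingMap H {x | row n m' 6 0 x = x} (row n m' 6 0) ∧
    ((∀ x < i, row n m' 6 0 x ≠ x) ∨ ¬ HasPerfectMatching n H))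
    (by rw [hfr₁ 0 (by decide), hn]) ?_ ?_
  · rw [row_congr (write_array_ne _ _ _ _ (by decide)), hid]
    exact ⟨⟨fun _ => rfl, fun x hx => absurd rfl hx, fun _ => Iff.rfl⟩,
      Or.inl fun x hx => by omega⟩
  · rintro i m' hi ⟨hM, hor⟩ hx hfr
    have hfr' : ∀ a, a < 6 → m' a = m a := fun a ha => by
      rw [hfr a (fun hmem => ?_), hfr₁ a ha]
      rw [writes, List.mem_cons] at hmem
      rcases hmem with h1 | h1
      · omega
      · have := hw a h1; omega
    rw [row_congr (write_array_ne _ _ _ _ (by decide))]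
    have hcond : (neExpr (.read 6 (.lit 0) (.var 19)) (.var 19)).eval m' = 0 ↔
        row n m' 6 0 i = i := by
      rw [neExpr_eval]; simp [Expr.eval, hx, row, hi]
    by_cases hc : row n m' 6 0 i = i
    · rw [den_ite_of_eq (hcond.2 hc)]
      obtain ⟨s1, s2, s3⟩ := searchProg_den (n := n) (m := m') (by rw [hfr' 0 (by decide), hn]) hH
        hirr (by rw [hfr' 5 (by decide)]; exact hHm) hM (by rw [hx]; exact hi) (by rw [hx]; exact hc)
      refine ⟨s1, ?_⟩
      rw [hx] at s3
      rcases hor with hor | hor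
      · rcases s3 with s3 | s3
        · refine Or.inl fun x hxi => ?_
          rcases Nat.lt_succ_iff_lt_or_eq.1 hxi with h1 | rfl
          · exact fun e => hor x h1 (s2 x e)
          · exact s3
        · exact Or.inr s3
      · exact Or.inr hor
    · rw [den_ite_of_ne (fun h => hc (hcond.1 h))]
      have hs : row n (skipProg.den m') 6 = row n m' 6 :=
        row_congr (den_eq_of_not_mem_writes _ _ (by decide))
      rw [hs]
      refine ⟨hM, hor.imp_left fun hor x hxi => ?_⟩
      rcases Nat.lt_succ_iff_lt_or_eq.1 hxi with h1 | rfl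
      exacts [hor x h1, hc]

end

end ExactMatching

/-! ### From a guess to a graph, and checking the matching found -/

namespace ExactMatching

open RAM RAM.ForProg

/-- Fill the square matrix in array `a` with the values of `e`, which may refer to the row in
variable `26` and the column in variable `27`. -/
def fillProg (a : ℕ) (e : Expr) : ForProg :=
  .loop 26 0 (.loop 27 0 (.assign a (.var 26) (.var 27) e))

/-- The entry of array `a` in the row in variable `26` and the column in variable `27`. -/
abbrev entry (a : ℕ) : Expr := .read a (.var 26) (.var 27)

/-- Mark the guessed pairs, which are in the arrays `24` and `25`, in the matrix `21`. -/
def guessProg : ForProg :=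
  .seq (fillProg 21 (.lit 0)) (.loop 28 2
    (.seq (.assign 21 (.read 24 (.lit 0) (.var 28)) (.read 25 (.lit 0) (.var 28)) (.lit 1))
      (.assign 21 (.read 25 (.lit 0) (.var 28)) (.read 24 (.lit 0) (.var 28)) (.lit 1))))

/-- Compute in array `23` the row sums of array `22`. -/
def rowSumProg : ForProg :=
  .loop 26 0 (.seq (.assign 23 (.lit 0) (.var 26) (.lit 0))
    (.loop 27 0 (.assign 23 (.lit 0) (.var 26) (.add (.read 23 (.lit 0) (.var 26)) (entry 22)))))

/-- Build in array `5` the graph in which the matching is sought.  The expression `e` describes the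
edges of one colour.  The edges of this colour that the matching has to use are put into array
`22`; they are determined by the given matching (array `3`) and the guess (array `21`). -/
def graphProg (e : Expr) : ForProg :=
  .seq (fillProg 20 e)
    (.seq (fillProg 22 (.sub (.add (entry 20) (neExpr (entry 3) (entry 21))) (.lit 1)))
      (.seq rowSumProg
        (fillProg 5 (.add (entry 22) (.sub (.sub (entry 1) (entry 20))
          (.add (.read 23 (.lit 0) (.var 26)) (.read 23 (.lit 0) (.var 27))))))))

/-- Count in variable `29` the red edges of the matching, and record in variable `31` if it is not
perfect. -/
def countProg : ForProg :=
  .seq (.assign 29 (.lit 0) (.lit 0) (.lit 0)) (.seq (.assign 31 (.lit 0) (.lit 0) (.lit 0))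
    (.loop 26 0 (.seq
      (.ite (neExpr (.read 6 (.lit 0) (.var 26)) (.var 26)) skipProg
        (.assign 31 (.lit 0) (.lit 0) (.lit 1)))
      (.assign 29 (.lit 0) (.lit 0)
        (.add (.var 29) (.read 2 (.var 26) (.read 6 (.lit 0) (.var 26))))))))

/-- Output the matching if it is perfect and has the required number of red edges. -/
def outputProg : ForProg :=
  .seq countProg (.ite (.var 31) skipProg
    (.ite (neExpr (.var 29) (.add (.read 0 (.lit 0) (.lit 1)) (.read 0 (.lit 0) (.lit 1)))) skipProg
      (fillProg 4 (.sub (.lit 1) (neExpr (.read 6 (.lit 0) (.var 26)) (.var 27))))))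

/-- Try to complete the guess by edges that do not have the colour described by `e`. -/
def tryProg (e : Expr) : ForProg := .seq (graphProg e) (.seq matchProg outputProg)

/-- The expression is evaluated while the array is partly filled, so its value must be independent
of this array. -/
theorem fillProg_den {n a : ℕ} {e : Expr} {m : Memory} (hn : m 0 0 0 = n) (ha : a ≠ 26)
    (ha' : a ≠ 27) (ha0 : a ≠ 0) {F : ℕ → ℕ → ℕ}
    (he : ∀ u < n, ∀ v < n, ∀ m' : Memory, m' 26 0 0 = u → m' 27 0 0 = v →
      (∀ c, c ≠ 26 → c ≠ 27 → c ≠ a → m' c = m c) → e.eval m' = F u v) :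
    ∀ x < n, ∀ y < n, (fillProg a e).den m a x y = F x y := by
  refine loop_rule (fun i m' => ∀ x < i, ∀ y < n, m' a x y = F x y) hn ?_ ?_
  · intro x hx; omega
  · intro i m₁ hi hI h26 hfr₁
    have hfr₁' : ∀ c, c ≠ 26 → c ≠ 27 → c ≠ a → m₁ c = m c := fun c h1 h2 h3 =>
      hfr₁ c (by simp [writes, h1, h2, h3])
    have key : ∀ x y, y < n → (x < i ∨ x = i ∧ y < n) →
        (loop 27 0 (.assign a (.var 26) (.var 27) e)).den m₁ a x y = F x y := by
      refine loop_rule (fun j m' => ∀ x y, y < n → (x < i ∨ x = i ∧ y < j) → m' a x y = F x y)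
        (by rw [hfr₁' 0 (by decide) (by decide) ha0.symm, hn]) ?_ ?_
      · intro x y hy h
        rw [write_array_ne _ _ _ _ ha']
        exact hI x (by omega) y hy
      · intro j m₂ hj hJ h27 hfr₂ x y hy hxy
        have hfr₂' : ∀ c, c ≠ 27 → c ≠ a → m₂ c = m₁ c := fun c h1 h2 =>
          hfr₂ c (by simp [writes, h1, h2])
        have h26' : m₂ 26 0 0 = i := by rw [hfr₂' 26 (by decide) ha.symm, h26]
        have hev := he i hi j hj m₂ h26' h27 (fun c h1 h2 h3 => by
          rw [hfr₂' c h2 h3, hfr₁' c h1 h2 h3])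
        rw [write_array_ne _ _ _ _ ha', den_assign, hev]
        simp only [Expr.eval, h26', h27, Memory.write]
        by_cases h : x = i ∧ y = j
        · simp [h.1, h.2]
        · rw [if_neg (by tauto)]; exact hJ x y hy (by omega)
    intro x hx y hy
    rw [write_array_ne _ _ _ _ ha]
    exact key x y hy (by omega)

theorem fillProg_frame {a : ℕ} {e : Expr} (m : Memory) {c : ℕ} (h1 : c ≠ 26) (h2 : c ≠ 27)
    (h3 : c ≠ a) : (fillProg a e).den m c = m c :=
  den_eq_of_not_mem_writes _ _ (by simp [fillProg, writes, h1, h2, h3])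

theorem guessProg_den {n L : ℕ} {m : Memory} (hn : m 0 0 0 = n) (hL : m 0 0 2 = L)
    {x y : ℕ} (hx : x < n) (hy : y < n) : guessProg.den m 21 x y ≤ 1 ∧
      (guessProg.den m 21 x y ≠ 0 ↔ ∃ i < L, m 24 0 i = x ∧ m 25 0 i = y ∨
        m 24 0 i = y ∧ m 25 0 i = x) := by
  rw [guessProg, den_seq]
  have h0 := fillProg_den (a := 21) (e := .lit 0) hn (by decide) (by decide) (by decide)
    (F := fun _ _ => 0) (fun _ _ _ _ _ _ _ _ => rfl)
  have hfr : ∀ c, c ≠ 26 → c ≠ 27 → c ≠ 21 → (fillProg 21 (.lit 0)).den m c = m c :=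
    fun c h1 h2 h3 => fillProg_frame m h1 h2 h3
  set m₁ := (fillProg 21 (.lit 0)).den m with hm₁
  refine loop_rule (fun k m' => m' 21 x y ≤ 1 ∧ (m' 21 x y ≠ 0 ↔ ∃ i < k,
    m 24 0 i = x ∧ m 25 0 i = y ∨ m 24 0 i = y ∧ m 25 0 i = x))
    (by rw [hfr 0 (by decide) (by decide) (by decide), hL]) ?_ ?_
  · rw [write_array_ne _ _ _ _ (by decide), h0 x hx y hy]
    simp
  · intro k m' hk hI h28 hfr'
    have e24 : m' 24 = m 24 := by
      rw [hfr' 24 (by decide), hfr 24 (by decide) (by decide) (by decide)]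
    have e25 : m' 25 = m 25 := by
      rw [hfr' 25 (by decide), hfr 25 (by decide) (by decide) (by decide)]
    have hex : (∃ i < k + 1, m 24 0 i = x ∧ m 25 0 i = y ∨ m 24 0 i = y ∧ m 25 0 i = x) ↔
        (∃ i < k, m 24 0 i = x ∧ m 25 0 i = y ∨ m 24 0 i = y ∧ m 25 0 i = x) ∨
          (m 24 0 k = x ∧ m 25 0 k = y ∨ m 24 0 k = y ∧ m 25 0 k = x) := by
      constructor
      · rintro ⟨i, hi, h⟩
        rcases Nat.lt_succ_iff_lt_or_eq.1 hi with hi | rfl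
        exacts [Or.inl ⟨i, hi, h⟩, Or.inr h]
      · rintro (⟨i, hi, h⟩ | h)
        exacts [⟨i, by omega, h⟩, ⟨k, by omega, h⟩]
    rw [hex, write_array_ne _ _ _ _ (by decide)]
    simp only [den_seq, den_assign, Expr.eval]
    have w24 : ∀ i j, (m'.write 21 i j 1) 24 = m 24 := fun i j => by
      rw [write_array_ne _ _ _ _ (by decide), e24]
    have w25 : ∀ i j, (m'.write 21 i j 1) 25 = m 25 := fun i j => by
      rw [write_array_ne _ _ _ _ (by decide), e25]
    have w28 : ∀ i j, (m'.write 21 i j 1) 28 0 0 = k := fun i j => by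
      rw [write_array_ne _ _ _ _ (by decide), h28]
    rw [w24, w25, w28, h28, e24, e25]
    simp only [Memory.write, true_and]
    by_cases c1 : x = m 25 0 k ∧ y = m 24 0 k
    · rw [if_pos c1]; simp [c1.1, c1.2]
    · rw [if_neg c1]
      by_cases c2 : x = m 24 0 k ∧ y = m 25 0 k
      · rw [if_pos c2]; simp [c2.1, c2.2]
      · rw [if_neg c2]
        refine ⟨hI.1, hI.2.trans ⟨Or.inl, fun h => h.resolve_right ?_⟩⟩
        rintro (h | h)
        · exact c2 ⟨h.1.symm, h.2.symm⟩
        · exact c1 ⟨h.2.symm, h.1.symm⟩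

theorem rowSumProg_den {n : ℕ} {m : Memory} (hn : m 0 0 0 = n) :
    ∀ x < n, rowSumProg.den m 23 0 x = ∑ y ∈ Finset.range n, m 22 x y := by
  refine loop_rule (fun i m' => ∀ x < i, m' 23 0 x = ∑ y ∈ Finset.range n, m 22 x y) hn ?_ ?_
  · intro x hx; omega
  · intro i m₁ hi hI h26 hfr₁
    have e0 : m₁ 0 = m 0 := hfr₁ 0 (by decide)
    have e22 : m₁ 22 = m 22 := hfr₁ 22 (by decide)
    rw [den_seq, den_assign]
    simp only [Expr.eval, h26]
    set m₂ := m₁.write 23 0 i 0 with hm₂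
    have g : ∀ c, c ≠ 23 → m₂ c = m₁ c := fun c hc => write_array_ne _ _ _ _ hc
    have key := loop_rule (x := 27) (j := 0)
      (p := .assign 23 (.lit 0) (.var 26) (.add (.read 23 (.lit 0) (.var 26)) (entry 22)))
      (m := m₂) (b := n) (fun j m' => (∀ x, x ≠ i → m' 23 0 x = m₁ 23 0 x) ∧
        m' 23 0 i = ∑ y ∈ Finset.range j, m 22 i y) (by rw [g 0 (by decide), e0, hn])
      (by
        rw [write_array_ne _ _ _ _ (by decide)]
        refine ⟨fun x hx => ?_, ?_⟩
        · simp [hm₂, Memory.write, hx]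
        · simp [hm₂, Memory.write])
      (by
        intro j m' hj hJ h27 hfr
        have f26 : m' 26 0 0 = i := by rw [hfr 26 (by decide), g 26 (by decide), h26]
        have f22 : m' 22 = m 22 := by rw [hfr 22 (by decide), g 22 (by decide), e22]
        rw [write_array_ne _ _ _ _ (by decide), den_assign]
        simp only [Expr.eval, f26, f22, h27]
        refine ⟨fun x hx => ?_, ?_⟩
        · simp only [Memory.write]; simp [hx, hJ.1 x hx]
        · rw [Finset.sum_range_succ, ← hJ.2]; simp [Memory.write])
    intro x hx
    rw [write_array_ne _ _ _ _ (by decide)]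
    by_cases hxi : x = i
    · rw [hxi]; exact key.2
    · rw [key.1 x hxi]; exact hI x (by omega)

/-- The graph computed by `graphProg`. -/
theorem graphProg_den {n : ℕ} {e : Expr} {m : Memory} (hn : m 0 0 0 = n) {F : ℕ → ℕ → ℕ}
    (he : ∀ u < n, ∀ v < n, ∀ m' : Memory, m' 26 0 0 = u → m' 27 0 0 = v →
      (∀ c, c ≠ 26 → c ≠ 27 → c ≠ 20 → m' c = m c) → e.eval m' = F u v)
    (hF : ∀ x < n, ∀ y < n, F x y ≤ 1) (h1 : ∀ x < n, ∀ y < n, m 1 x y ≤ 1)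
    (h3 : ∀ x < n, ∀ y < n, m 3 x y ≤ 1) (h21 : ∀ x < n, ∀ y < n, m 21 x y ≤ 1)
    {T : ℕ → ℕ → Prop} (hT : ∀ x < n, ∀ y < n, (T x y ↔ F x y ≠ 0 ∧ m 3 x y ≠ m 21 x y)) :
    ∀ x < n, ∀ y < n, ((graphProg e).den m 5 x y ≠ 0 ↔ T x y ∨
      m 1 x y ≠ 0 ∧ F x y = 0 ∧ (∀ z < n, ¬ T x z) ∧ ∀ z < n, ¬ T y z) := by
  rw [graphProg, den_seq, den_seq, den_seq]
  have k20 := fillProg_den (a := 20) hn (by decide) (by decide) (by decide) he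
  have f20 : ∀ c, c ≠ 26 → c ≠ 27 → c ≠ 20 → (fillProg 20 e).den m c = m c :=
    fun c h1 h2 h3 => fillProg_frame m h1 h2 h3
  set m₁ := (fillProg 20 e).den m with hm₁
  have k22 := fillProg_den (a := 22) (m := m₁) (n := n)
    (e := .sub (.add (entry 20) (neExpr (entry 3) (entry 21))) (.lit 1))
    (by rw [f20 0 (by decide) (by decide) (by decide), hn]) (by decide) (by decide) (by decide)
    -- The sum of two bits, truncated after subtracting 1, is their conjunction: the pair has the
    -- colour and lies in exactly one of M and the guess.
    (F := fun x y => F x y + ((m 3 x y - m 21 x y) + (m 21 x y - m 3 x y)) - 1)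
    (fun u hu v hv m' h26 h27 hfr => by
      simp only [Expr.eval, neExpr, h26, h27]
      rw [hfr 20 (by decide) (by decide) (by decide), k20 u hu v hv,
        hfr 3 (by decide) (by decide) (by decide), f20 3 (by decide) (by decide) (by decide),
        hfr 21 (by decide) (by decide) (by decide), f20 21 (by decide) (by decide) (by decide)])
  have f22 : ∀ c, c ≠ 26 → c ≠ 27 → c ≠ 22 → (fillProg 22 (.sub (.add (entry 20)
      (neExpr (entry 3) (entry 21))) (.lit 1))).den m₁ c = m₁ c :=
    fun c h1 h2 h3 => fillProg_frame m₁ h1 h2 h3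
  set m₂ := (fillProg 22 (.sub (.add (entry 20)
      (neExpr (entry 3) (entry 21))) (.lit 1))).den m₁ with hm₂
  have k22' : ∀ x < n, ∀ y < n, (m₂ 22 x y ≠ 0 ↔ T x y) := by
    intro x hx y hy
    rw [k22 x hx y hy, hT x hx y hy]
    have := hF x hx y hy
    have := h3 x hx y hy
    have := h21 x hx y hy
    omega
  have k23 := rowSumProg_den (m := m₂) (n := n) (by rw [f22 0 (by decide) (by decide) (by decide),
    f20 0 (by decide) (by decide) (by decide), hn])
  have f23 : ∀ c, c ≠ 26 → c ≠ 27 → c ≠ 23 → rowSumProg.den m₂ c = m₂ c := fun c h1 h2 h3 =>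
    den_eq_of_not_mem_writes _ _ (by simp [rowSumProg, writes, h1, h2, h3])
  set m₃ := rowSumProg.den m₂ with hm₃
  have k23' : ∀ x < n, (m₃ 23 0 x = 0 ↔ ∀ z < n, ¬ T x z) := by
    intro x hx
    rw [k23 x hx, Finset.sum_eq_zero_iff]
    simp only [Finset.mem_range]
    refine forall₂_congr fun z hz => ?_
    rw [← k22' x hx z hz, not_not]
  have e20 : m₃ 20 = m₁ 20 := by
    rw [f23 20 (by decide) (by decide) (by decide), f22 20 (by decide) (by decide) (by decide)]
  have e1 : m₃ 1 = m 1 := by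
    rw [f23 1 (by decide) (by decide) (by decide), f22 1 (by decide) (by decide) (by decide),
      f20 1 (by decide) (by decide) (by decide)]
  have e22 : m₃ 22 = m₂ 22 := f23 22 (by decide) (by decide) (by decide)
  have k5 := fillProg_den (a := 5) (m := m₃) (n := n)
    (e := .add (entry 22) (.sub (.sub (entry 1) (entry 20))
          (.add (.read 23 (.lit 0) (.var 26)) (.read 23 (.lit 0) (.var 27)))))
    (by rw [f23 0 (by decide) (by decide) (by decide), f22 0 (by decide) (by decide) (by decide),
      f20 0 (by decide) (by decide) (by decide), hn]) (by decide) (by decide) (by decide)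
    -- Truncated subtraction kills an edge of the other colour as soon as a forced edge covers one
    -- of its ends.
    (F := fun x y => m₂ 22 x y + ((m 1 x y - F x y) - (m₃ 23 0 x + m₃ 23 0 y)))
    (fun u hu v hv m' h26 h27 hfr => by
      simp only [Expr.eval, h26, h27]
      rw [hfr 22 (by decide) (by decide) (by decide), e22,
        hfr 1 (by decide) (by decide) (by decide), e1,
        hfr 20 (by decide) (by decide) (by decide), e20, k20 u hu v hv,
        hfr 23 (by decide) (by decide) (by decide)])
  intro x hx y hy
  rw [k5 x hx y hy, ← k22' x hx y hy, ← k23' x hx, ← k23' y hy]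
  have := hF x hx y hy
  have := h1 x hx y hy
  omega

/-- The sum runs over vertices, so for a perfect matching it counts each red edge twice; hence the
comparison with k + k. -/
theorem countProg_den {n : ℕ} {m : Memory} (hn : m 0 0 0 = n) :
    (countProg.den m 31 0 0 = 0 ↔ ∀ x < n, m 6 0 x ≠ x) ∧
      countProg.den m 29 0 0 = ∑ x ∈ Finset.range n, m 2 x (m 6 0 x) := by
  rw [countProg, den_seq, den_seq, den_assign, den_assign]
  simp only [Expr.eval]
  set m₁ := (m.write 29 0 0 0).write 31 0 0 0 with hm₁
  have g : ∀ c, c ≠ 29 → c ≠ 31 → m₁ c = m c := fun c h1 h2 => by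
    rw [hm₁, write_array_ne _ _ _ _ h2, write_array_ne _ _ _ _ h1]
  refine loop_rule (fun i m' => (m' 31 0 0 = 0 ↔ ∀ x < i, m 6 0 x ≠ x) ∧
      m' 29 0 0 = ∑ x ∈ Finset.range i, m 2 x (m 6 0 x))
    (by rw [g 0 (by decide) (by decide), hn]) ?_ ?_
  · rw [write_array_ne _ _ _ _ (by decide), write_array_ne _ _ _ _ (by decide)]
    simp [hm₁, Memory.write]
  · rintro i m' hi ⟨hI, hI'⟩ h26 hfr
    have e6 : m' 6 = m 6 := by rw [hfr 6 (by decide), g 6 (by decide) (by decide)]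
    have e2 : m' 2 = m 2 := by rw [hfr 2 (by decide), g 2 (by decide) (by decide)]
    rw [write_array_ne _ _ _ _ (by decide), write_array_ne _ _ _ _ (by decide), den_seq, den_assign,
      Finset.sum_range_succ, ← hI']
    have hall : (∀ x < i + 1, m 6 0 x ≠ x) ↔ m' 31 0 0 = 0 ∧ m 6 0 i ≠ i := by
      rw [hI]
      exact ⟨fun h => ⟨fun x hx => h x (by omega), h i (by omega)⟩, fun h x hx => by
        rcases Nat.lt_succ_iff_lt_or_eq.1 hx with h1 | rfl
        exacts [h.1 x h1, h.2]⟩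
    rw [hall]
    have hcond : (neExpr (.read 6 (.lit 0) (.var 26)) (.var 26)).eval m' = 0 ↔ m 6 0 i = i := by
      rw [neExpr_eval]; simp [Expr.eval, h26, e6]
    by_cases hc : m 6 0 i = i
    · rw [den_ite_of_eq (hcond.2 hc), den_assign]
      simp only [Expr.eval]
      simp [Memory.write, h26, e6, e2, hc]
    · rw [den_ite_of_ne (fun h => hc (hcond.1 h))]
      have hs : ∀ a, a ≠ 13 → skipProg.den m' a = m' a := fun a ha =>
        den_eq_of_not_mem_writes _ _ (by simp [skipProg, writes, ha])
      simp only [Expr.eval]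
      rw [hs 29 (by decide), hs 2 (by decide), hs 26 (by decide), hs 6 (by decide), h26, e6, e2]
      refine ⟨?_, by simp [Memory.write]⟩
      rw [write_array_ne _ _ _ _ (by decide), hs 31 (by decide)]
      simp [hc]

/-- The array `4` holds the adjacency matrix of a perfect matching with `k` red edges. -/
def ValidOutput (n k : ℕ) (m : Memory) : Prop :=
  ∃ N : ℕ → ℕ, (∀ x, N (N x) = x) ∧ (∀ x < n, N x < n ∧ m 1 x (N x) ≠ 0) ∧
    ∑ x ∈ Finset.range n, m 2 x (N x) = k + k ∧
    ∀ x < n, ∀ y < n, m 4 x y = if N x = y then 1 else 0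

theorem ValidOutput.congr {n k : ℕ} {m m' : Memory} (h : ValidOutput n k m) (h1 : m' 1 = m 1)
    (h2 : m' 2 = m 2) (h4 : m' 4 = m 4) : ValidOutput n k m' := by
  unfold ValidOutput at h ⊢
  rwa [h1, h2, h4]

/-- The output array is overwritten only by a matching that has passed the check, so a valid answer
survives all later attempts. -/
theorem outputProg_den {n k : ℕ} {m : Memory} (hn : m 0 0 0 = n) (hk : m 0 0 1 = k)
    {H : ℕ → ℕ → Prop} (hH : ∀ x y, H x y → x < n ∧ y < n ∧ m 1 x y ≠ 0)
    (hM : MatchingMap H {x | row n m 6 0 x = x} (row n m 6 0)) :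
    (ValidOutput n k m → ValidOutput n k (outputProg.den m)) ∧
    ((∀ x < n, row n m 6 0 x ≠ x) → ∑ x ∈ Finset.range n, m 2 x (row n m 6 0 x) = k + k →
      ValidOutput n k (outputProg.den m)) := by
  obtain ⟨c1, c2⟩ := countProg_den hn
  have hfr : ∀ c, c ∉ countProg.writes → countProg.den m c = m c := fun c hc =>
    den_eq_of_not_mem_writes _ _ hc
  rw [outputProg, den_seq]
  set m₁ := countProg.den m with hm₁
  have hrow : ∀ x < n, row n m 6 0 x = m 6 0 x := fun x hx => by simp [row, hx]
  have hsum : ∑ x ∈ Finset.range n, m 2 x (row n m 6 0 x) =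
      ∑ x ∈ Finset.range n, m 2 x (m 6 0 x) :=
    Finset.sum_congr rfl fun x hx => by rw [hrow x (Finset.mem_range.1 hx)]
  have hperf : (∀ x < n, row n m 6 0 x ≠ x) ↔ ∀ x < n, m 6 0 x ≠ x :=
    forall₂_congr fun x hx => by rw [hrow x hx]
  have e0 : m₁ 0 = m 0 := hfr 0 (by decide)
  have e1 : m₁ 1 = m 1 := hfr 1 (by decide)
  have e2 : m₁ 2 = m 2 := hfr 2 (by decide)
  have e4 : m₁ 4 = m 4 := hfr 4 (by decide)
  have e6 : m₁ 6 = m 6 := hfr 6 (by decide)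
  have hskip : ∀ a, a ≠ 13 → skipProg.den m₁ a = m₁ a := fun a ha =>
    den_eq_of_not_mem_writes _ _ (by simp [skipProg, writes, ha])
  have hsk : ValidOutput n k m → ValidOutput n k (skipProg.den m₁) := fun h =>
    h.congr (by rw [hskip 1 (by decide), e1]) (by rw [hskip 2 (by decide), e2])
      (by rw [hskip 4 (by decide), e4])
  rw [hperf, hsum]
  by_cases h31 : m₁ 31 0 0 = 0
  · rw [den_ite_of_eq (by simpa [Expr.eval] using h31)]
    have hcond : (neExpr (.var 29) (.add (.read 0 (.lit 0) (.lit 1))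
        (.read 0 (.lit 0) (.lit 1)))).eval m₁ = 0 ↔
        ∑ x ∈ Finset.range n, m 2 x (m 6 0 x) = k + k := by
      rw [neExpr_eval]
      simp only [Expr.eval]
      rw [c2, e0, hk]
    by_cases hc : ∑ x ∈ Finset.range n, m 2 x (m 6 0 x) = k + k
    · rw [den_ite_of_eq (hcond.2 hc)]
      have hv : ValidOutput n k ((fillProg 4 (.sub (.lit 1)
          (neExpr (.read 6 (.lit 0) (.var 26)) (.var 27)))).den m₁) := by
        have k4 := fillProg_den (a := 4) (m := m₁) (n := n)
          (e := .sub (.lit 1) (neExpr (.read 6 (.lit 0) (.var 26)) (.var 27)))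
          (by rw [e0, hn]) (by decide) (by decide) (by decide)
          (F := fun x y => if m 6 0 x = y then 1 else 0) (fun u hu v hv m' h26 h27 hf => by
            simp only [Expr.eval, neExpr, h26, h27]
            rw [hf 6 (by decide) (by decide) (by decide), e6]
            split_ifs <;> omega)
        refine ⟨row n m 6 0, hM.invol, fun x hx => ?_, ?_, fun x hx y hy => ?_⟩
        · have hne := hperf.2 (c1.1 h31) x hx
          have := hH _ _ (hM.adj x hne)
          rw [fillProg_frame m₁ (by decide) (by decide) (by decide), e1]
          exact this.2
        · rw [fillProg_frame m₁ (by decide) (by decide) (by decide), e2, hsum, hc]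
        · rw [k4 x hx y hy, hrow x hx]
      exact ⟨fun _ => hv, fun _ _ => hv⟩
    · rw [den_ite_of_ne (fun h => hc (hcond.1 h))]
      exact ⟨hsk, fun _ h => absurd h hc⟩
  · rw [den_ite_of_ne (by simpa [Expr.eval] using h31)]
    exact ⟨hsk, fun h => absurd (c1.2 h) h31⟩

/-- The input matrices and the guess are symmetric zero-one matrices. -/
structure GoodInput (n k : ℕ) (m : Memory) : Prop where
  hn : m 0 0 0 = n
  hk : m 0 0 1 = k
  le_one : ∀ x < n, ∀ y < n, m 1 x y ≤ 1 ∧ m 2 x y ≤ m 1 x y ∧ m 3 x y ≤ 1 ∧ m 21 x y ≤ 1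
  symm : ∀ x < n, ∀ y < n, m 1 x y = m 1 y x ∧ m 2 x y = m 2 y x ∧ m 3 x y = m 3 y x ∧
    m 21 x y = m 21 y x
  irrefl : ∀ x < n, m 1 x x = 0

/-- Here F is the matrix of one colour, and g plays the role of M'. The last hypothesis on g says
that the guess is right: on pairs of this colour, M and the guess differ exactly at the edges of g.
Then g is a perfect matching of the graph that is built, and every perfect matching of this graph
has the red count of g. -/
theorem tryProg_den {n k : ℕ} {e : Expr} {m : Memory} (hm : GoodInput n k m) {F : ℕ → ℕ → ℕ}
    (he : ∀ u < n, ∀ v < n, ∀ m' : Memory, m' 26 0 0 = u → m' 27 0 0 = v →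
      (∀ c, c ≠ 26 → c ≠ 27 → c ≠ 20 → m' c = m c) → e.eval m' = F u v)
    (hF : F = m 2 ∨ F = fun x y => m 1 x y - m 2 x y) :
    (ValidOutput n k m → ValidOutput n k ((tryProg e).den m)) ∧
    ∀ g : ℕ → ℕ, (∀ x, g (g x) = x) → (∀ x < n, g x < n ∧ m 1 x (g x) ≠ 0) →
      ∑ x ∈ Finset.range n, m 2 x (g x) = k + k →
      (∀ x < n, ∀ y < n, F x y ≠ 0 → (m 3 x y ≠ m 21 x y ↔ g x = y)) →
      ValidOutput n k ((tryProg e).den m) := by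
  have hFle : ∀ x < n, ∀ y < n, F x y ≤ m 1 x y := fun x hx y hy => by
    have := hm.le_one x hx y hy
    rcases hF with rfl | rfl
    · exact this.2.1
    · exact Nat.sub_le _ _
  have hFs : ∀ x < n, ∀ y < n, F x y = F y x := fun x hx y hy => by
    have := hm.symm x hx y hy
    rcases hF with rfl | rfl
    · exact this.2.1
    · simp only [this.1, this.2.1]
  let T : ℕ → ℕ → Prop := fun x y => F x y ≠ 0 ∧ m 3 x y ≠ m 21 x y
  have hTs : ∀ x < n, ∀ y < n, (T x y ↔ T y x) := fun x hx y hy => by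
    have := hm.symm x hx y hy
    simp only [T]; rw [hFs x hx y hy, this.2.2.1, this.2.2.2]
  have hg := graphProg_den (T := T) hm.hn he
    (fun x hx y hy => (hFle x hx y hy).trans (hm.le_one x hx y hy).1)
    (fun x hx y hy => (hm.le_one x hx y hy).1) (fun x hx y hy => (hm.le_one x hx y hy).2.2.1)
    (fun x hx y hy => (hm.le_one x hx y hy).2.2.2) (fun x _ y _ => Iff.rfl)
  have hfr : ∀ c, c ≠ 26 → c ≠ 27 → c ≠ 20 → c ≠ 22 → c ≠ 23 → c ≠ 5 →
      (graphProg e).den m c = m c := fun c h1 h2 h3 h4 h5 h6 => den_eq_of_not_mem_writes _ _ (by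
    simp [graphProg, fillProg, rowSumProg, writes, h1, h2, h3, h4, h5, h6])
  rw [tryProg, den_seq, den_seq]
  set m₁ := (graphProg e).den m with hm₁
  let H : ℕ → ℕ → Prop := fun x y => x < n ∧ y < n ∧ m₁ 5 x y ≠ 0
  have hHiff : ∀ x < n, ∀ y < n, (H x y ↔ T x y ∨
      m 1 x y ≠ 0 ∧ F x y = 0 ∧ (∀ z < n, ¬ T x z) ∧ ∀ z < n, ¬ T y z) := fun x hx y hy => by
    simp only [H, hx, hy, true_and]; exact hg x hx y hy
  have hH1 : ∀ x y, H x y → x < n ∧ y < n ∧ m 1 x y ≠ 0 := by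
    intro x y hxy
    have hx := hxy.1
    have hy := hxy.2.1
    refine ⟨hx, hy, ?_⟩
    rcases (hHiff x hx y hy).1 hxy with h1 | h1
    · have := hFle x hx y hy
      have := h1.1
      omega
    · exact h1.1
  have hHs : ∀ x y, H x y → H y x := by
    intro x y hxy
    have hx := hxy.1
    have hy := hxy.2.1
    rw [hHiff x hx y hy] at hxy
    rw [hHiff y hy x hx, ← hTs x hx y hy, ← (hm.symm x hx y hy).1, ← hFs x hx y hy]
    tauto
  have hirr : ∀ x, ¬ H x x := fun x hx => (hH1 x x hx).2.2 (hm.irrefl x hx.1)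
  obtain ⟨hM, hor⟩ := matchProg_den (n := n) (m := m₁)
    (by rw [hfr 0 (by decide) (by decide) (by decide) (by decide) (by decide) (by decide), hm.hn])
    hHs hirr (fun x y => Iff.rfl)
  have hfr₂ : ∀ c, c < 5 → matchProg.den m₁ c = m c := fun c hc => by
    have hw : ∀ a ∈ matchProg.writes, 5 < a := by decide
    rw [den_eq_of_not_mem_writes matchProg m₁ (fun h => by have := hw c h; omega)]
    exact hfr c (by omega) (by omega) (by omega) (by omega) (by omega) (by omega)
  set m₂ := matchProg.den m₁ with hm₂
  obtain ⟨o1, o2⟩ := outputProg_den (n := n) (k := k) (m := m₂)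
    (by rw [hfr₂ 0 (by decide), hm.hn]) (by rw [hfr₂ 0 (by decide), hm.hk]) (H := H)
    (by rw [hfr₂ 1 (by decide)]; exact hH1) hM
  refine ⟨fun h => o1 (h.congr (hfr₂ 1 (by decide)) (hfr₂ 2 (by decide)) (hfr₂ 4 (by decide))),
    fun g hgi hg1 hgs hgT => ?_⟩
  have hT' : ∀ x < n, ∀ y < n, (T x y ↔ F x y ≠ 0 ∧ g x = y) := fun x hx y hy =>
    ⟨fun h => ⟨h.1, (hgT x hx y hy h.1).1 h.2⟩, fun h => ⟨h.1, (hgT x hx y hy h.1).2 h.2⟩⟩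
  have hno : ∀ x < n, F x (g x) = 0 → ∀ z < n, ¬ T x z := fun x hx h0 z hz hT => by
    have := (hT' x hx z hz).1 hT
    rw [this.2] at h0; exact this.1 h0
  have hpm : HasPerfectMatching n H := by
    refine ⟨g, hgi, fun x hx => ?_⟩
    obtain ⟨hgx, hg1x⟩ := hg1 x hx
    rw [hHiff x hx _ hgx]
    by_cases h0 : F x (g x) = 0
    · exact Or.inr ⟨hg1x, h0, hno x hx h0,
        hno _ hgx (by rw [hgi, hFs _ hgx x hx]; exact h0)⟩
    · exact Or.inl ((hT' x hx _ hgx).2 ⟨h0, rfl⟩)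
  have hperf := hor.resolve_right (fun h => h hpm)
  refine o2 hperf ?_
  rw [hfr₂ 2 (by decide), ← hgs]
  -- The colours agree vertex by vertex. If the edge of g at x has colour F, it is forced and is the
  -- only edge at x, so the matching found contains it. Otherwise neither edge at x has colour F, so
  -- both have the other colour.
  refine Finset.sum_congr rfl fun x hx => ?_
  rw [Finset.mem_range] at hx
  set y := row n m₂ 6 0 x with hy
  have hHxy : H x y := hM.adj x (hperf x hx)
  obtain ⟨-, hyn, hy1⟩ := hH1 x y hHxy
  obtain ⟨hgx, hg1x⟩ := hg1 x hx
  rw [hHiff x hx y hyn] at hHxy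
  by_cases h0 : F x (g x) = 0
  · have hn := hno x hx h0
    have hFy := (hHxy.resolve_left (hn y hyn)).2.1
    have l1 := hm.le_one x hx y hyn
    have l2 := hm.le_one x hx _ hgx
    rcases hF with hF | hF
    · rw [hF] at h0 hFy; omega
    · rw [hF] at h0 hFy
      simp only at h0 hFy
      omega
  · have hTx : T x (g x) := (hT' x hx _ hgx).2 ⟨h0, rfl⟩
    rcases hHxy with h1 | h1
    · rw [((hT' x hx y hyn).1 h1).2]
    · exact absurd hTx (h1.2.2.1 _ hgx)

end ExactMatching

/-! ### Enumerating the guesses, and the running time -/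

namespace ExactMatching

open RAM RAM.ForProg

/-- Add the carry in variable `30` to the number in base `n` with digits in array `a`. -/
def incProg (a : ℕ) : ForProg :=
  .loop 28 2 (.ite (.var 30)
    (.ite (neExpr (.add (.read a (.lit 0) (.var 28)) (.lit 1)) (.read 0 (.lit 0) (.lit 0)))
      (.seq (.assign a (.lit 0) (.var 28) (.add (.read a (.lit 0) (.var 28)) (.lit 1)))
        (.assign 30 (.lit 0) (.lit 0) (.lit 0)))
      (.assign a (.lit 0) (.var 28) (.lit 0)))
    skipProg)

/-- Try the current guess for both colours. -/
def attemptProg : ForProg :=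
  .seq guessProg (.seq (tryProg (entry 2)) (tryProg (.sub (entry 1) (entry 2))))

/-- Proceed to the next guess. -/
def nextProg : ForProg :=
  .seq (.assign 30 (.lit 0) (.lit 0) (.lit 1)) (.seq (incProg 24) (incProg 25))

/-- The body of the main loop. -/
def bodyProg : ForProg := .seq attemptProg nextProg

/-- The main loop, which runs through all guesses. -/
def searchLoop : Prog := .while (.sub (.lit 1) (.var 30)) bodyProg.compile

/-- The whole algorithm. -/
def mainProg : Prog := .ite (.read 0 (.lit 0) (.lit 0)) searchLoop .skip

theorem digits_lt {n L : ℕ} {d : ℕ → ℕ} (hd : ∀ i < L, d i < n) :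
    ∑ i ∈ Finset.range L, d i * n ^ i < n ^ L := by
  induction L with
  | zero => simp
  | succ L ih =>
    have h1 := ih fun i hi => hd i (by omega)
    have h2 := Nat.mul_le_mul_right (n ^ L) (Nat.succ_le_of_lt (hd L (by omega)))
    rw [Finset.sum_range_succ, pow_succ]
    rw [Nat.succ_mul] at h2
    rw [mul_comm (n ^ L) n]
    omega

theorem digits_inj {n L : ℕ} {d d' : ℕ → ℕ} (hd : ∀ i < L, d i < n) (hd' : ∀ i < L, d' i < n)
    (h : ∑ i ∈ Finset.range L, d i * n ^ i = ∑ i ∈ Finset.range L, d' i * n ^ i) :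
    ∀ i < L, d i = d' i := by
  induction L with
  | zero => intro i hi; omega
  | succ L ih =>
    have h1 := digits_lt (L := L) fun i hi => hd i (by omega)
    have h2 := digits_lt (L := L) fun i hi => hd' i (by omega)
    rw [Finset.sum_range_succ, Finset.sum_range_succ] at h
    have key : ∀ a b x y p : ℕ, x < p → y < p → x + a * p = y + b * p → a = b := by
      intro a b x y p hx hy e
      have hp : 0 < p := by omega
      have e' := congrArg (· / p) e
      simpa [Nat.add_mul_div_right _ _ hp, Nat.div_eq_of_lt hx, Nat.div_eq_of_lt hy] using e'
    have hL := key _ _ _ _ _ h1 h2 h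
    rw [hL] at h
    intro i hi
    rcases Nat.lt_succ_iff_lt_or_eq.1 hi with hi | rfl
    · exact ih (fun i hi => hd i (by omega)) (fun i hi => hd' i (by omega))
        (Nat.add_right_cancel h) i hi
    · exact hL

/-- The number in base `n` in array `a`. -/
def value (n L : ℕ) (m : Memory) (a : ℕ) : ℕ := ∑ i ∈ Finset.range L, m a 0 i * n ^ i

theorem value_congr {n L : ℕ} {m m' : Memory} {a : ℕ} (h : m' a = m a) :
    value n L m' a = value n L m a := by simp [value, h]

/-- Ripple carry, least significant digit first: after k digits the carry is worth n^k, and this is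
the loop invariant. -/
theorem incProg_den {n L a : ℕ} {m : Memory} (hn : m 0 0 0 = n) (hL : m 0 0 2 = L)
    (ha : a = 24 ∨ a = 25) (hd : ∀ i < L, m a 0 i < n) (hc : m 30 0 0 ≤ 1) :
    (∀ i < L, (incProg a).den m a 0 i < n) ∧ (incProg a).den m 30 0 0 ≤ 1 ∧
      value n L ((incProg a).den m) a + n ^ L * (incProg a).den m 30 0 0 =
        value n L m a + m 30 0 0 := by
  have key := loop_rule (x := 28) (j := 2) (p := .ite (.var 30)
    (.ite (neExpr (.add (.read a (.lit 0) (.var 28)) (.lit 1)) (.read 0 (.lit 0) (.lit 0)))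
      (.seq (.assign a (.lit 0) (.var 28) (.add (.read a (.lit 0) (.var 28)) (.lit 1)))
        (.assign 30 (.lit 0) (.lit 0) (.lit 0)))
      (.assign a (.lit 0) (.var 28) (.lit 0)))
    skipProg) (m := m) (b := L)
    (fun k m' => (∀ i < L, m' a 0 i < n) ∧ m' 30 0 0 ≤ 1 ∧ (∀ i, k ≤ i → m' a 0 i = m a 0 i) ∧
      ∑ i ∈ Finset.range k, m' a 0 i * n ^ i + n ^ k * m' 30 0 0 =
        ∑ i ∈ Finset.range k, m a 0 i * n ^ i + m 30 0 0) hL ?_ ?_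
  · exact ⟨key.1, key.2.1, key.2.2.2⟩
  · rw [write_array_ne _ _ _ _ (by omega), write_array_ne _ _ _ _ (by decide)]
    exact ⟨hd, hc, fun _ _ => rfl, by simp⟩
  · rintro k m' hk ⟨h1, h2, h3, h4⟩ h28 hfr
    have e0 : m' 0 = m 0 := hfr 0 (by simp [writes, skipProg]; omega)
    rw [write_array_ne _ _ _ _ (by omega), write_array_ne _ _ _ _ (by decide),
      Finset.sum_range_succ, Finset.sum_range_succ]
    have hak := h3 k le_rfl
    by_cases h30 : m' 30 0 0 = 0
    · rw [den_ite_of_eq (by simpa [Expr.eval] using h30)]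
      have hs : ∀ c, c ≠ 13 → skipProg.den m' c = m' c := fun c hc =>
        den_eq_of_not_mem_writes _ _ (by simp [skipProg, writes, hc])
      rw [hs a (by omega), hs 30 (by decide)]
      refine ⟨h1, h2, fun i hi => h3 i (by omega), ?_⟩
      rw [h30, hak]
      rw [h30] at h4
      omega
    · have h30' : m' 30 0 0 = 1 := by omega
      rw [den_ite_of_ne (by simpa [Expr.eval] using h30)]
      have hcond : (neExpr (.add (.read a (.lit 0) (.var 28)) (.lit 1))
          (.read 0 (.lit 0) (.lit 0))).eval m' = 0 ↔ m a 0 k + 1 = n := by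
        rw [neExpr_eval]; simp only [Expr.eval, h28, e0, hn, hak]
      rw [h30', mul_one] at h4
      have hsum : ∀ f : ℕ → ℕ, (∀ i < k, f i = m' a 0 i) →
          ∑ i ∈ Finset.range k, f i * n ^ i = ∑ i ∈ Finset.range k, m' a 0 i * n ^ i :=
        fun f hf => Finset.sum_congr rfl fun i hi => by rw [hf i (Finset.mem_range.1 hi)]
      by_cases hc : m a 0 k + 1 = n
      · rw [den_ite_of_eq (hcond.2 hc), den_assign]
        simp only [Expr.eval, h28]
        have w : ∀ i, m'.write a 0 k 0 a 0 i = if i = k then 0 else m' a 0 i := fun i => by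
          simp [Memory.write]
        have w30 : m'.write a 0 k 0 30 0 0 = 1 := by
          rw [write_array_ne _ _ _ _ (by omega), h30']
        rw [w30, hsum _ (fun i hi => by rw [w, if_neg (by omega)])]
        simp only [w, if_true]
        refine ⟨fun i hi => ?_, le_rfl, fun i hi => ?_, ?_⟩
        · split_ifs
          · omega
          · exact h1 i hi
        · rw [if_neg (by omega)]; exact h3 i (by omega)
        · rw [zero_mul, pow_succ, mul_one]
          have : n ^ k * n = m a 0 k * n ^ k + n ^ k := by
            nth_rewrite 2 [← hc]; ring
          omega
      · rw [den_ite_of_ne (fun h => hc (hcond.1 h)), den_seq, den_assign, den_assign]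
        simp only [Expr.eval, h28]
        rw [write_array_ne _ _ _ _ (by omega)]
        have w : ∀ i, m'.write a 0 k (m' a 0 k + 1) a 0 i =
            if i = k then m' a 0 k + 1 else m' a 0 i := fun i => by
          simp [Memory.write]
        rw [hsum _ (fun i hi => by rw [w, if_neg (by omega)])]
        simp only [w, if_true]
        have hlt := hd k hk
        refine ⟨fun i hi => ?_, by simp [Memory.write], fun i hi => ?_, ?_⟩
        · split_ifs
          · omega
          · exact h1 i hi
        · rw [if_neg (by omega)]; exact h3 i (by omega)
        · have : (m'.write a 0 k (m' a 0 k + 1)).write 30 0 0 0 30 0 0 = 0 := by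
            simp [Memory.write]
          rw [this, hak, mul_zero, add_mul]
          omega

/-- The input arrays are those of `m₀`, and the guess consists of numbers below `n`. -/
structure LoopInv (n L : ℕ) (m₀ m : Memory) : Prop where
  input : ∀ a < 4, m a = m₀ a
  digitA : ∀ i < L, m 24 0 i < n
  digitB : ∀ i < L, m 25 0 i < n

/-- With the guess `A`, `B` the algorithm finds a solution. -/
def Succeeds (n k L : ℕ) (m₀ : Memory) (A B : ℕ → ℕ) : Prop :=
  (∀ i < L, A i < n) ∧ (∀ i < L, B i < n) ∧ ∀ m, LoopInv n L m₀ m → (∀ i < L, m 24 0 i = A i) →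
    (∀ i < L, m 25 0 i = B i) → ValidOutput n k (attemptProg.den m)

set_option maxRecDepth 10000 in
-- The carry out of array 24 is passed on to array 25, so the two arrays form one number with 2L
-- digits. A carry out of the second array means that all guesses have been tried.
theorem bodyProg_den {n k L : ℕ} {m₀ m : Memory} (hn : m₀ 0 0 0 = n) (hL : m₀ 0 0 2 = L)
    (hm : LoopInv n L m₀ m)
    (hkeep : ValidOutput n k m → ValidOutput n k (attemptProg.den m)) :
    LoopInv n L m₀ (bodyProg.den m) ∧ bodyProg.den m 30 0 0 ≤ 1 ∧
      value n L (bodyProg.den m) 24 + n ^ L * value n L (bodyProg.den m) 25 +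
        n ^ L * n ^ L * bodyProg.den m 30 0 0 =
        value n L m 24 + n ^ L * value n L m 25 + 1 ∧
      (ValidOutput n k m → ValidOutput n k (bodyProg.den m)) ∧
      (ValidOutput n k (attemptProg.den m) → ValidOutput n k (bodyProg.den m)) := by
  have hwA : ∀ a ∈ attemptProg.writes, 3 < a ∧ a ≠ 24 ∧ a ≠ 25 := by decide
  have hwN : ∀ a ∈ nextProg.writes, 4 < a := by decide
  rw [bodyProg, den_seq]
  set m₁ := attemptProg.den m with hm₁
  have f₁ : ∀ a, a < 4 ∨ a = 24 ∨ a = 25 → m₁ a = m a := fun a ha =>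
    den_eq_of_not_mem_writes _ _ (fun h => by have := hwA a h; omega)
  have f₂ : ∀ a, a < 5 → nextProg.den m₁ a = m₁ a := fun a ha =>
    den_eq_of_not_mem_writes _ _ (fun h => by have := hwN a h; omega)
  have hval : ValidOutput n k m₁ → ValidOutput n k (nextProg.den m₁) := fun h =>
    h.congr (f₂ 1 (by decide)) (f₂ 2 (by decide)) (f₂ 4 (by decide))
  have e0 : m₁ 0 = m₀ 0 := by rw [f₁ 0 (by decide), hm.input 0 (by decide)]
  have e24 := f₁ 24 (by decide)
  have e25 := f₁ 25 (by decide)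
  have hin : ∀ a < 4, nextProg.den m₁ a = m₀ a := fun a ha => by
    rw [f₂ a (by omega), f₁ a (by omega), hm.input a ha]
  suffices hs : (∀ i < L, nextProg.den m₁ 24 0 i < n) ∧ (∀ i < L, nextProg.den m₁ 25 0 i < n) ∧
      nextProg.den m₁ 30 0 0 ≤ 1 ∧
      value n L (nextProg.den m₁) 24 + n ^ L * value n L (nextProg.den m₁) 25 +
        n ^ L * n ^ L * nextProg.den m₁ 30 0 0 = value n L m 24 + n ^ L * value n L m 25 + 1 from
    ⟨⟨hin, hs.1, hs.2.1⟩, hs.2.2.1, hs.2.2.2, fun h => hval (hkeep h), hval⟩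
  rw [nextProg, den_seq, den_seq, den_assign]
  simp only [Expr.eval]
  set m₂ := m₁.write 30 0 0 1 with hm₂
  have g₂ : ∀ a, a ≠ 30 → m₂ a = m₁ a := fun a ha => write_array_ne _ _ _ _ ha
  have h30 : m₂ 30 0 0 = 1 := by simp [hm₂, Memory.write]
  obtain ⟨a1, a2, a3⟩ := incProg_den (n := n) (L := L) (a := 24) (m := m₂)
    (by rw [g₂ 0 (by decide), e0, hn]) (by rw [g₂ 0 (by decide), e0, hL]) (Or.inl rfl)
    (by rw [g₂ 24 (by decide), e24]; exact hm.digitA) h30.le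
  have g₃ : ∀ a, a ≠ 28 → a ≠ 30 → a ≠ 24 → a ≠ 13 → (incProg 24).den m₂ a = m₂ a :=
    fun a h1 h2 h3 h4 => den_eq_of_not_mem_writes _ _ (by
      simp [incProg, skipProg, writes, h1, h2, h3, h4])
  set m₃ := (incProg 24).den m₂ with hm₃
  have e0' : m₃ 0 = m₀ 0 := by
    rw [g₃ 0 (by decide) (by decide) (by decide) (by decide), g₂ 0 (by decide), e0]
  have e25' : m₃ 25 = m 25 := by
    rw [g₃ 25 (by decide) (by decide) (by decide) (by decide), g₂ 25 (by decide), e25]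
  obtain ⟨b1, b2, b3⟩ := incProg_den (n := n) (L := L) (a := 25) (m := m₃)
    (by rw [e0', hn]) (by rw [e0', hL]) (Or.inr rfl) (by rw [e25']; exact hm.digitB) a2
  have g₄ : (incProg 25).den m₃ 24 = m₃ 24 := den_eq_of_not_mem_writes _ _ (by
      simp [incProg, skipProg, writes])
  refine ⟨by rw [g₄]; exact a1, b1, b2, ?_⟩
  rw [value_congr g₄]
  rw [value_congr e25'] at b3
  rw [h30, value_congr (g₂ 24 (by decide)), value_congr e24] at a3
  rw [← Nat.add_right_cancel_iff (n := n ^ L * m₃ 30 0 0)]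
  calc _ = value n L m₃ 24 + n ^ L * m₃ 30 0 0 + n ^ L * (value n L ((incProg 25).den m₃) 25 +
        n ^ L * (incProg 25).den m₃ 30 0 0) := by ring
    _ = _ := by rw [a3, b3]; ring

/-- Induction on the number K of guesses still to be tried. The guesses ahead are those whose number
is at least the current one; once one of them succeeds, `hkeep` preserves the valid output to the
end. -/
theorem searchLoop_runs {n k L b : ℕ} {m₀ : Memory} (hn : m₀ 0 0 0 = n) (hL : m₀ 0 0 2 = L)
    (hb : n ≤ b) (hb' : L ≤ b) (hkeep : ∀ m, LoopInv n L m₀ m → ValidOutput n k m →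
      ValidOutput n k (attemptProg.den m)) (K : ℕ) :
    ∀ m, LoopInv n L m₀ m → m 30 0 0 = 0 →
      value n L m 24 + n ^ L * value n L m 25 + K = n ^ L * n ^ L →
      ∃ t m', Runs searchLoop m t m' ∧ t ≤ K * (bodyProg.time b + 6) + 6 ∧
        (ValidOutput n k m → ValidOutput n k m') ∧ (∀ A B, Succeeds n k L m₀ A B →
          value n L m 24 + n ^ L * value n L m 25 ≤ ∑ i ∈ Finset.range L, A i * n ^ i +
            n ^ L * ∑ i ∈ Finset.range L, B i * n ^ i → ValidOutput n k m') ∧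
        ∀ a < 4, m' a = m₀ a := by
  have hmax : ∀ d d' : ℕ → ℕ, (∀ i < L, d i < n) → (∀ i < L, d' i < n) →
      ∑ i ∈ Finset.range L, d i * n ^ i + n ^ L * ∑ i ∈ Finset.range L, d' i * n ^ i <
        n ^ L * n ^ L := by
    intro d d' hd hd'
    have h1 := digits_lt hd
    have h2 := Nat.mul_le_mul_left (n ^ L) (Nat.succ_le_of_lt (digits_lt hd'))
    rw [Nat.mul_succ] at h2
    omega
  induction K with
  | zero =>
    intro m hm _ hv
    have := hmax _ _ hm.digitA hm.digitB
    simp only [value] at hv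
    omega
  | succ K ih =>
    intro m hm h30 hv
    obtain ⟨s1, s2, s3, s4, s5⟩ := bodyProg_den hn hL hm (hkeep m hm)
    have e0 := hm.input 0 (by decide)
    obtain ⟨t, ht, ht'⟩ := runs_compile bodyProg (by decide) (b := b) m (by rw [e0, hn]; exact hb)
      (by rw [e0, hL]; exact hb')
    have hcond : (Expr.sub (.lit 1) (.var 30)).eval m ≠ 0 := by simp [Expr.eval, h30]
    have hthis : ∀ A B, Succeeds n k L m₀ A B →
        value n L m 24 + n ^ L * value n L m 25 = ∑ i ∈ Finset.range L, A i * n ^ i +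
            n ^ L * ∑ i ∈ Finset.range L, B i * n ^ i → ValidOutput n k (bodyProg.den m) := by
      intro A B hAB e
      have hpos : 0 < n ^ L := lt_of_le_of_lt (Nat.zero_le _) (digits_lt hAB.1)
      have eB : value n L m 25 = ∑ i ∈ Finset.range L, B i * n ^ i := by
        have := congrArg (· / n ^ L) e
        simpa [Nat.add_mul_div_left _ _ hpos, Nat.div_eq_of_lt (digits_lt hAB.1),
          Nat.div_eq_of_lt (digits_lt hm.digitA), value] using this
      rw [eB] at e
      have eA := Nat.add_right_cancel e
      exact s5 (hAB.2.2 m hm (digits_inj hm.digitA hAB.1 eA) (digits_inj hm.digitB hAB.2.1 eB))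
    have hstep : ∀ {t' : ℕ} {m' : Memory}, Runs searchLoop (bodyProg.den m) t' m' →
        Runs searchLoop m (5 + 1 + t + t') m' := fun h => Runs.whileTrue hcond ht h
    by_cases hc : bodyProg.den m 30 0 0 = 0
    · rw [hc, mul_zero, add_zero] at s3
      obtain ⟨t', m', r1, r2, r3, r4, r5⟩ := ih _ s1 hc (by omega)
      refine ⟨_, m', hstep r1, ?_, fun h => r3 (s4 h), fun A B hAB hle => ?_, r5⟩
      · rw [Nat.succ_mul]; omega
      · rcases hle.eq_or_lt with h1 | h1
        · exact r3 (hthis A B hAB h1)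
        · exact r4 A B hAB (by omega)
    · have hc' : bodyProg.den m 30 0 0 = 1 := by omega
      rw [hc', mul_one] at s3
      have hend : Runs searchLoop (bodyProg.den m) 6 (bodyProg.den m) :=
        Runs.whileFalse (e := .sub (.lit 1) (.var 30)) (by simp [Expr.eval, hc'])
      refine ⟨_, _, hstep hend, ?_, s4, fun A B hAB hle => ?_, s1.input⟩
      · rw [Nat.succ_mul]; omega
      · have := hmax A B hAB.1 hAB.2.1
        exact hthis A B hAB (by omega)

/-- With N = max n 2 and l = max L 1, the constant 3c + 7 is made up of 2l for the number of
guesses, 3cl for the body (since n + L + 2 ≤ N^(3l)), 4l for additive constants (since 16 ≤ N^4),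
and l for doubling. The 4 steps in front are the test that n is nonzero; a test of the main loop
takes 6. -/
theorem exists_time_bound (p : ForProg) : ∃ c, ∀ n L : ℕ, 0 < n →
    4 + (n ^ L * n ^ L * (p.time (n + L) + 6) + 6) ≤ max n 2 ^ (c * max L 1) := by
  obtain ⟨c, hc⟩ := p.exists_time_le
  refine ⟨3 * c + 7, fun n L hn => ?_⟩
  set N := max n 2 with hN
  set l := max L 1 with hl
  have hN2 : 2 ≤ N := le_max_right _ _
  have hnN : n ≤ N := le_max_left _ _
  have hl1 : 1 ≤ l := le_max_right _ _
  have hLl : L ≤ l := le_max_left _ _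
  have hpow : ∀ {i j : ℕ}, i ≤ j → N ^ i ≤ N ^ j := fun h => Nat.pow_le_pow_right (by omega) h
  have hnL : n ^ L ≤ N ^ l := (Nat.pow_le_pow_left hnN L).trans (hpow hLl)
  have hV : n ^ L * n ^ L ≤ N ^ (2 * l) := by
    rw [two_mul, pow_add]; exact Nat.mul_le_mul hnL hnL
  have hV1 : 1 ≤ n ^ L * n ^ L := Nat.mul_pos (Nat.pow_pos hn) (Nat.pow_pos hn)
  have h2 : 2 ≤ N ^ l := hN2.trans (by simpa using hpow hl1)
  have hLN : L ≤ N ^ l := (Nat.lt_two_pow_self (n := L)).le.trans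
    ((Nat.pow_le_pow_left hN2 L).trans (hpow hLl))
  have hnN' : n ≤ N ^ l := hnN.trans (by simpa using hpow hl1)
  have hbase : n + L + 2 ≤ N ^ (3 * l) := by
    have h4 : 2 * 2 * N ^ l ≤ N ^ l * N ^ l * N ^ l :=
      Nat.mul_le_mul_right _ (Nat.mul_le_mul h2 h2)
    calc n + L + 2 ≤ 2 * 2 * N ^ l := by omega
      _ ≤ N ^ l * N ^ l * N ^ l := h4
      _ = N ^ (3 * l) := by rw [← pow_add, ← pow_add]; congr 1; ring
  have hT : p.time (n + L) ≤ N ^ (3 * c * l) := by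
    calc p.time (n + L) ≤ (n + L + 2) ^ c := hc _
      _ ≤ (N ^ (3 * l)) ^ c := Nat.pow_le_pow_left hbase c
      _ = N ^ (3 * c * l) := by rw [← pow_mul]; congr 1; ring
  have h16 : 16 ≤ N ^ (4 * l) := by
    have h1 : 2 ^ 4 ≤ N ^ 4 := Nat.pow_le_pow_left hN2 4
    exact (by simpa using h1 : 16 ≤ N ^ 4).trans (hpow (by omega))
  have hT' : p.time (n + L) + 16 ≤ N ^ (3 * c * l + 4 * l + l) := by
    have h5 := hpow (Nat.le_add_right (3 * c * l) (4 * l))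
    have h6 := hpow (Nat.le_add_left (4 * l) (3 * c * l))
    calc p.time (n + L) + 16 ≤ N ^ (3 * c * l + 4 * l) * 2 := by omega
      _ ≤ N ^ (3 * c * l + 4 * l) * N ^ l := Nat.mul_le_mul_left _ h2
      _ = _ := (pow_add _ _ _).symm
  calc 4 + (n ^ L * n ^ L * (p.time (n + L) + 6) + 6)
      ≤ n ^ L * n ^ L * (p.time (n + L) + 16) := by
        rw [Nat.mul_add, Nat.mul_add]; omega
    _ ≤ N ^ (2 * l) * N ^ (3 * c * l + 4 * l + l) := Nat.mul_le_mul hV hT'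
    _ = N ^ ((3 * c + 7) * l) := by rw [← pow_add]; congr 1; ring

end ExactMatching

/-! ### Translation between graphs and memory, and the final assembly -/

namespace ExactMatching

open RAM RAM.ForProg

section Input

variable {n : ℕ}

theorem matrixArray_apply (r : Fin n → Fin n → Prop) [DecidableRel r] (u v : Fin n) :
    matrixArray r u v = if r u v then 1 else 0 := by
  have : (∃ u' v' : Fin n, (u' : ℕ) = u ∧ (v' : ℕ) = v ∧ r u' v') ↔ r u v :=
    ⟨fun ⟨u', v', hu, hv, h⟩ => by rwa [← Fin.ext hu, ← Fin.ext hv], fun h => ⟨u, v, rfl, rfl, h⟩⟩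
  unfold matrixArray
  simp only [this]

theorem matrixArray_ne_zero (r : Fin n → Fin n → Prop) (u v : Fin n) :
    matrixArray r u v ≠ 0 ↔ r u v := by
  classical simp [matrixArray_apply]

theorem matrixArray_le_one (r : Fin n → Fin n → Prop) (i j : ℕ) : matrixArray r i j ≤ 1 := by
  unfold matrixArray; split_ifs <;> simp

theorem matrixArray_mono {r s : Fin n → Fin n → Prop} (h : ∀ u v, r u v → s u v) (i j : ℕ) :
    matrixArray r i j ≤ matrixArray s i j := by
  unfold matrixArray
  split_ifs with h1 h2
  · exact le_rfl
  · obtain ⟨u, v, hu, hv, huv⟩ := h1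
    exact absurd ⟨u, v, hu, hv, h u v huv⟩ h2
  all_goals simp

theorem matrixArray_symm {r : Fin n → Fin n → Prop} (h : ∀ u v, r u v → r v u) (i j : ℕ) :
    matrixArray r i j = matrixArray r j i := by
  have : (∃ u v : Fin n, (u : ℕ) = i ∧ (v : ℕ) = j ∧ r u v) ↔
      ∃ u v : Fin n, (u : ℕ) = j ∧ (v : ℕ) = i ∧ r u v :=
    ⟨fun ⟨u, v, hu, hv, huv⟩ => ⟨v, u, hv, hu, h u v huv⟩,
      fun ⟨u, v, hu, hv, huv⟩ => ⟨v, u, hv, hu, h u v huv⟩⟩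
  classical
  unfold matrixArray
  exact if_congr this rfl rfl

theorem matrixArray_self {r : Fin n → Fin n → Prop} (h : ∀ u, ¬ r u u) (i : ℕ) :
    matrixArray r i i = 0 := by
  unfold matrixArray
  rw [if_neg]
  rintro ⟨u, v, hu, hv, huv⟩
  obtain rfl : u = v := Fin.ext (hu.trans hv.symm)
  exact h u huv

variable {G : SimpleGraph (Fin n)} (C : G.EdgeLabeling Color) (M : G.Subgraph) (k L : ℕ)

theorem labelGraph_adj_le {x : Color} {u v : Fin n} (h : (C.labelGraph x).Adj u v) : G.Adj u v := by
  rw [SimpleGraph.EdgeLabeling.labelGraph_adj] at h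
  exact h.1

theorem blue_iff {u v : Fin n} :
    (C.labelGraph .blue).Adj u v ↔ G.Adj u v ∧ ¬ (C.labelGraph .red).Adj u v := by
  simp only [SimpleGraph.EdgeLabeling.labelGraph_adj]
  constructor
  · rintro ⟨h, e⟩
    refine ⟨h, ?_⟩
    rintro ⟨_, e'⟩
    rw [e] at e'
    cases e'
  · rintro ⟨h, e⟩
    refine ⟨h, ?_⟩
    cases hc : C.get u v h with
    | red => exact absurd ⟨h, hc⟩ e
    | blue => exact hc

/-- The guess `A`, `B` lists the edges of `S`. -/
def Lists (L : ℕ) (S : Set (Sym2 (Fin n))) (A B : ℕ → ℕ) : Prop :=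
  ∀ u v : Fin n, u ≠ v →
    (s(u, v) ∈ S ↔ ∃ i < L, A i = u ∧ B i = v ∨ A i = v ∧ B i = u)

theorem exists_lists (hn : 0 < n) {L : ℕ} {S : Set (Sym2 (Fin n))} (hS : S.ncard ≤ L) :
    ∃ A B : ℕ → ℕ, (∀ i, A i < n) ∧ (∀ i, B i < n) ∧ Lists L S A B := by
  have hrep : ∀ e : Sym2 (Fin n), ∃ a b, e = s(a, b) := fun e => Sym2.ind (fun a b => ⟨a, b, rfl⟩) e
  choose a b hab using hrep
  have hfin := S.toFinite
  set l := hfin.toFinset.toList with hl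
  have hlen : l.length ≤ L := by
    rw [hl, Finset.length_toList, ← Set.ncard_eq_toFinset_card S hfin]; exact hS
  have hmem : ∀ e, e ∈ l ↔ e ∈ S := by simp [hl]
  let o : Fin n := ⟨0, hn⟩
  -- Sets with fewer than L edges are padded by the loop at 0, which never equals a pair of distinct
  -- vertices.
  let f : ℕ → Sym2 (Fin n) := fun i => l.getD i s(o, o)
  refine ⟨fun i => a (f i), fun i => b (f i), fun i => (a _).2, fun i => (b _).2, fun u v huv => ?_⟩
  have hpair : ∀ i, ((a (f i) : ℕ) = u ∧ (b (f i) : ℕ) = v ∨ (a (f i) : ℕ) = v ∧ (b (f i) : ℕ) = u)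
      ↔ f i = s(u, v) := fun i => by
    conv_rhs => rw [hab (f i)]
    simp only [Sym2.eq_iff, Fin.ext_iff]
  simp only [hpair, ← hmem]
  constructor
  · intro h
    obtain ⟨i, hi, e⟩ := List.mem_iff_getElem.1 h
    exact ⟨i, by omega, by simp only [f]; rw [List.getD_eq_getElem _ _ hi, e]⟩
  · rintro ⟨i, _, e⟩
    by_cases hi : i < l.length
    · rw [← e]
      simp only [f]
      rw [List.getD_eq_getElem _ _ hi]
      exact List.getElem_mem hi
    · simp only [f] at e
      rw [List.getD_eq_default _ _ (by omega), Sym2.eq_iff] at e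
      rcases e with ⟨e1, e2⟩ | ⟨e1, e2⟩ <;> exact absurd (by rw [← e1, ← e2]) huv

theorem exists_partner {M : G.Subgraph} (hM : M.IsPerfectMatching) :
    ∃ g : ℕ → ℕ, (∀ x, g (g x) = x) ∧ (∀ x < n, g x < n) ∧
      ∀ u v : Fin n, M.Adj u v ↔ g u = v := by
  rw [SimpleGraph.Subgraph.isPerfectMatching_iff] at hM
  choose p hp hp' using hM
  have hpp : ∀ u, p (p u) = u := fun u => (hp' (p u) u (hp u).symm).symm
  have hg : ∀ u : Fin n, (if h : (u : ℕ) < n then ((p ⟨u, h⟩ : Fin n) : ℕ) else u) = p u :=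
    fun u => dif_pos u.2
  refine ⟨fun x => if h : x < n then p ⟨x, h⟩ else x, fun x => ?_, fun x hx => ?_, fun u v => ?_⟩
  · by_cases hx : x < n
    · simp only [dif_pos hx]
      rw [hg, hpp]
    · simp only [dif_neg hx]
  · simp only [dif_pos hx]
    exact (p _).2
  · simp only [hg]
    exact ⟨fun h => by rw [hp' u v h], fun h => by rw [← Fin.ext h]; exact hp u⟩

/-- This is the handshake lemma for the graph of red edges of M: the term at x is the degree of x.
-/
theorem sum_red {M : G.Subgraph} {g : ℕ → ℕ} (hg : ∀ x < n, g x < n)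
    (hgM : ∀ u v : Fin n, M.Adj u v ↔ g u = v) :
    ∑ x ∈ Finset.range n, matrixArray (C.labelGraph .red).Adj x (g x) =
      redCount C M + redCount C M := by
  classical
  set K : SimpleGraph (Fin n) := M.spanningCoe ⊓ C.labelGraph .red with hK
  have hadj : ∀ u v, K.Adj u v ↔ g u = v ∧ (C.labelGraph .red).Adj u v := fun u v => by
    rw [← hgM]; simp [hK]
  have hset : ofColor C .red M.edgeSet = (K.edgeFinset : Set (Sym2 (Fin n))) := by
    ext e
    induction e using Sym2.ind with
    | _ u v => simp [ofColor, hadj, hgM]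
  have hdeg : ∀ u : Fin n, matrixArray (C.labelGraph .red).Adj u (g u) = K.degree u := fun u => by
    have := matrixArray_apply (C.labelGraph .red).Adj u ⟨g u, hg u u.2⟩
    rw [show ((⟨g u, hg u u.2⟩ : Fin n) : ℕ) = g u from rfl] at this
    rw [this, ← SimpleGraph.card_neighborFinset_eq_degree]
    split_ifs with h
    · symm
      rw [Finset.card_eq_one]
      refine ⟨⟨g u, hg u u.2⟩, ?_⟩
      ext v
      simp only [SimpleGraph.mem_neighborFinset, hadj, Finset.mem_singleton, Fin.ext_iff]
      refine ⟨fun h => h.1.symm, fun e => ⟨e.symm, ?_⟩⟩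
      rwa [show v = ⟨g u, hg u u.2⟩ from Fin.ext e]
    · symm
      rw [Finset.card_eq_zero, Finset.eq_empty_iff_forall_notMem]
      intro v hv
      rw [SimpleGraph.mem_neighborFinset, hadj] at hv
      exact h (by rw [show (⟨g u, hg u u.2⟩ : Fin n) = v from Fin.ext hv.1]; exact hv.2)
  rw [Finset.sum_range fun x => matrixArray (C.labelGraph .red).Adj x (g x),
    Finset.sum_congr rfl fun u _ => hdeg u, K.sum_degrees_eq_twice_card_edges, redCount, hset,
    Set.ncard_coe_finset, two_mul]
  congr!

/-- An involution along the edges of `G` is a perfect matching. -/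
theorem exists_perfectMatching {g : ℕ → ℕ} (hg : ∀ x, g (g x) = x) (hn : ∀ x < n, g x < n)
    (hG : ∀ u v : Fin n, g u = v → G.Adj u v) :
    ∃ M : G.Subgraph, M.IsPerfectMatching ∧ ∀ u v : Fin n, M.Adj u v ↔ g u = v := by
  refine ⟨⟨Set.univ, fun u v => g u = v, fun {u v} h => hG u v h, fun _ => trivial,
    ⟨fun u v h => ?_⟩⟩, ?_, fun u v => Iff.rfl⟩
  · rw [← h, hg]
  · rw [SimpleGraph.Subgraph.isPerfectMatching_iff]
    exact fun u => ⟨⟨g u, hn u u.2⟩, rfl, fun v (hv : g u = v) => Fin.ext hv.symm⟩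

theorem guessProg_frame (m : Memory) {c : ℕ} (h : c < 21) : guessProg.den m c = m c :=
  den_eq_of_not_mem_writes _ _ (by simp [guessProg, fillProg, writes]; omega)

set_option maxRecDepth 10000 in
theorem tryProg_frame (e : Expr) (m : Memory) {c : ℕ} (h : c < 4 ∨ c = 21) :
    (tryProg e).den m c = m c := by
  have hw : ∀ a ∈ (tryProg e).writes, 3 < a ∧ a ≠ 21 := by
    simp only [tryProg, graphProg, writes, fillProg]
    decide
  exact den_eq_of_not_mem_writes _ _ fun hc => by have := hw c hc; omega

variable {C M k L} in
theorem goodInput_guess {m : Memory} (hm : LoopInv n L (inputMemory G C M k L) m) :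
    GoodInput n k (guessProg.den m) := by
  have h0 : m 0 = inputMemory G C M k L 0 := hm.input 0 (by decide)
  have h1 : m 1 = matrixArray G.Adj := hm.input 1 (by decide)
  have h2 : m 2 = matrixArray (C.labelGraph .red).Adj := hm.input 2 (by decide)
  have h3 : m 3 = matrixArray M.Adj := hm.input 3 (by decide)
  have hn : m 0 0 0 = n := by rw [h0]; rfl
  have hL : m 0 0 2 = L := by rw [h0]; rfl
  refine ⟨?_, ?_, fun x hx y hy => ?_, fun x hx y hy => ?_, fun x hx => ?_⟩
  · rw [guessProg_frame m (by decide), hn]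
  · rw [guessProg_frame m (by decide), h0]; rfl
  · rw [guessProg_frame m (by decide), guessProg_frame m (by decide),
      guessProg_frame m (by decide), h1, h2, h3]
    exact ⟨matrixArray_le_one _ _ _, matrixArray_mono (fun u v h => labelGraph_adj_le C h) _ _,
      matrixArray_le_one _ _ _, (guessProg_den hn hL hx hy).1⟩
  · rw [guessProg_frame m (by decide), guessProg_frame m (by decide),
      guessProg_frame m (by decide), h1, h2, h3]
    refine ⟨matrixArray_symm (fun _ _ h => h.symm) _ _, matrixArray_symm (fun _ _ h => h.symm) _ _,
      matrixArray_symm (fun _ _ h => h.symm) _ _, ?_⟩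
    have a := guessProg_den hn hL hx hy
    have b := guessProg_den hn hL hy hx
    have : guessProg.den m 21 x y ≠ 0 ↔ guessProg.den m 21 y x ≠ 0 := by
      rw [a.2, b.2]; simp only [or_comm]
    omega
  · rw [guessProg_frame m (by decide), h1]
    exact matrixArray_self (fun u => G.irrefl) x

theorem GoodInput.congr {m m' : Memory} (hm : GoodInput n k m)
    (h : ∀ c, c < 4 ∨ c = 21 → m' c = m c) : GoodInput n k m' := by
  have h0 := h 0 (by decide)
  have h1 := h 1 (by decide)
  have h2 := h 2 (by decide)
  have h3 := h 3 (by decide)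
  have h21 := h 21 (by decide)
  refine ⟨?_, ?_, ?_, ?_, ?_⟩
  · rw [h0]; exact hm.hn
  · rw [h0]; exact hm.hk
  · rw [h1, h2, h3, h21]; exact hm.le_one
  · rw [h1, h2, h3, h21]; exact hm.symm
  · rw [h1]; exact hm.irrefl

/-- The two colours are tried one after the other. -/
theorem attemptProg_den {k : ℕ} {m : Memory} (hm : GoodInput n k (guessProg.den m)) :
    (ValidOutput n k m → ValidOutput n k (attemptProg.den m)) ∧
    ∀ g : ℕ → ℕ, (∀ x, g (g x) = x) → (∀ x < n, g x < n ∧ m 1 x (g x) ≠ 0) →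
      ∑ x ∈ Finset.range n, m 2 x (g x) = k + k →
      ((∀ x < n, ∀ y < n, m 2 x y ≠ 0 → (m 3 x y ≠ guessProg.den m 21 x y ↔ g x = y)) ∨
        ∀ x < n, ∀ y < n, m 1 x y - m 2 x y ≠ 0 →
          (m 3 x y ≠ guessProg.den m 21 x y ↔ g x = y)) →
      ValidOutput n k (attemptProg.den m) := by
  rw [attemptProg, den_seq, den_seq]
  have f : ∀ c < 21, guessProg.den m c = m c := fun c hc => guessProg_frame m hc
  set m₁ := guessProg.den m with hm₁
  have f' : ∀ c, c < 4 ∨ c = 21 → (tryProg (entry 2)).den m₁ c = m₁ c :=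
    fun c hc => tryProg_frame _ _ hc
  obtain ⟨a1, a2⟩ := tryProg_den (e := entry 2) hm (F := m₁ 2)
    (fun u _ v _ m' h h' hc => by simp [Expr.eval, h, h', hc 2]) (Or.inl rfl)
  set m₂ := (tryProg (entry 2)).den m₁ with hm₂
  obtain ⟨b1, b2⟩ := tryProg_den (e := .sub (entry 1) (entry 2)) (hm.congr k f')
    (F := fun x y => m₂ 1 x y - m₂ 2 x y)
    (fun u _ v _ m' h h' hc => by simp [Expr.eval, h, h', hc 1, hc 2]) (Or.inr rfl)
  rw [f' 1 (by decide), f' 2 (by decide), f' 3 (by decide), f' 21 (by decide), f 1 (by decide),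
    f 2 (by decide), f 3 (by decide)] at b2
  rw [f 1 (by decide), f 2 (by decide), f 3 (by decide)] at a2
  refine ⟨fun h => b1 (a1 (h.congr (f 1 (by decide)) (f 2 (by decide)) (f 4 (by decide)))),
    fun g hg hG hr h => ?_⟩
  rcases h with h | h
  · exact b1 (a2 g hg hG hr h)
  · exact b2 g hg hG hr h

variable {C M k L} in
-- Among the edges of colour x, M' is the symmetric difference of M and the listed set. This is the
-- hypothesis under which an attempt must succeed, for red in its first half and for blue in its
-- second.
theorem succeeds_of_lists {M' : G.Subgraph} {x : Color} {A B g : ℕ → ℕ} (hA : ∀ i, A i < n)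
    (hB : ∀ i, B i < n) (hg : ∀ x, g (g x) = x) (hgn : ∀ x < n, g x < n)
    (hgM : ∀ u v : Fin n, M'.Adj u v ↔ g u = v) (hk : redCount C M' = k)
    (hl : Lists L (ofColor C x (symmDiff M.edgeSet M'.edgeSet)) A B) :
    Succeeds n k L (inputMemory G C M k L) A B := by
  classical
  refine ⟨fun i _ => hA i, fun i _ => hB i, fun m hm mA mB => ?_⟩
  have h0 : m 0 = inputMemory G C M k L 0 := hm.input 0 (by decide)
  have h1 : m 1 = matrixArray G.Adj := hm.input 1 (by decide)
  have h2 : m 2 = matrixArray (C.labelGraph .red).Adj := hm.input 2 (by decide)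
  have h3 : m 3 = matrixArray M.Adj := hm.input 3 (by decide)
  have hn : m 0 0 0 = n := by rw [h0]; rfl
  have hL : m 0 0 2 = L := by rw [h0]; rfl
  have key : ∀ u v : Fin n, (C.labelGraph x).Adj u v →
      (m 3 u v ≠ guessProg.den m 21 u v ↔ g u = v) := fun u v huv => by
    obtain ⟨q1, q2⟩ := guessProg_den hn hL u.2 v.2
    have hex : (∃ i < L, m 24 0 i = u ∧ m 25 0 i = v ∨ m 24 0 i = v ∧ m 25 0 i = u) ↔
        ∃ i < L, A i = u ∧ B i = v ∨ A i = v ∧ B i = u :=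
      exists_congr fun i => and_congr_right fun hi => by rw [mA i hi, mB i hi]
    rw [hex, ← hl u v huv.ne] at q2
    have hS : s(u, v) ∈ ofColor C x (symmDiff M.edgeSet M'.edgeSet) ↔
        (M.Adj u v ∧ ¬ M'.Adj u v ∨ M'.Adj u v ∧ ¬ M.Adj u v) := by
      simp [ofColor, Set.mem_symmDiff, huv]
    rw [hS] at q2
    rw [← hgM, h3, matrixArray_apply]
    by_cases p1 : M.Adj u v <;> by_cases p2 : M'.Adj u v <;>
      simp only [p1, p2, not_true, not_false_iff, and_self, and_true, and_false, or_true, or_false,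
        if_true, if_false, iff_true, iff_false] at q2 ⊢ <;> omega
  refine (attemptProg_den (goodInput_guess hm)).2 g hg (fun x hx => ⟨hgn x hx, ?_⟩) ?_ ?_
  · rw [h1]
    have := (matrixArray_ne_zero G.Adj ⟨x, hx⟩ ⟨g x, hgn x hx⟩).2
      (M'.adj_sub ((hgM _ _).2 rfl))
    exact this
  · rw [h2, sum_red C hgn hgM, hk]
  · cases x with
    | red =>
      refine Or.inl fun x hx y hy h => key ⟨x, hx⟩ ⟨y, hy⟩ ?_
      rw [h2] at h
      exact (matrixArray_ne_zero _ ⟨x, hx⟩ ⟨y, hy⟩).1 h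
    | blue =>
      refine Or.inr fun x hx y hy h => key ⟨x, hx⟩ ⟨y, hy⟩ ?_
      rw [h1, h2] at h
      rw [blue_iff, ← matrixArray_ne_zero (C.labelGraph .red).Adj, ← matrixArray_ne_zero G.Adj]
      have := matrixArray_le_one G.Adj x y
      simp only at *
      omega

theorem ValidOutput.exists_perfectMatching {k : ℕ} {m : Memory} (h : ValidOutput n k m)
    (h1 : m 1 = matrixArray G.Adj) (h2 : m 2 = matrixArray (C.labelGraph .red).Adj) :
    ∃ M : G.Subgraph, M.IsPerfectMatching ∧ redCount C M = k ∧ Outputs m M := by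
  classical
  obtain ⟨N, hN, hn, hr, h4⟩ := h
  rw [h1] at hn
  obtain ⟨M, hM, hNM⟩ := ExactMatching.exists_perfectMatching (G := G) hN (fun x hx => (hn x hx).1)
    fun u v h => by
      have := (hn u u.2).2
      rw [h] at this
      exact (matrixArray_ne_zero _ _ _).1 this
  refine ⟨M, hM, ?_, fun u v => ?_⟩
  · rw [h2, sum_red C (fun x hx => (hn x hx).1) hNM] at hr
    omega
  · rw [h4 u u.2 v v.2, matrixArray_apply]
    simp only [hNM]

theorem inputMemory_loopInv (hn : 0 < n) :
    LoopInv n L (inputMemory G C M k L) (inputMemory G C M k L) :=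
  ⟨fun _ _ => rfl, fun _ _ => hn, fun _ _ => hn⟩

end Input

/-- The algorithm runs within the time bound, and its output is a perfect matching with `k` red
edges if there is one that differs from the given matching in few edges of one colour. -/
theorem exists_mainProg_runs : ∃ c : ℕ, ∀ (n : ℕ) (G : SimpleGraph (Fin n))
    (C : G.EdgeLabeling Color) (M : G.Subgraph) (k L : ℕ), ∃ (t : ℕ) (m : Memory),
      Runs mainProg (inputMemory G C M k L) t m ∧ t ≤ (max n 2) ^ (c * max L 1) ∧
      ∀ M' : G.Subgraph, M'.IsPerfectMatching → redCount C M' = k →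
        ((ofColor C .blue (symmDiff M.edgeSet M'.edgeSet)).ncard ≤ L ∨
          (ofColor C .red (symmDiff M.edgeSet M'.edgeSet)).ncard ≤ L) →
        ∃ M'' : G.Subgraph, M''.IsPerfectMatching ∧ redCount C M'' = redCount C M' ∧
          Outputs m M'' := by
  obtain ⟨c, hc⟩ := exists_time_bound bodyProg
  refine ⟨c + 3, fun n G C M k L => ?_⟩
  -- For n = 0 there are no digits in base n, and if L is positive the counter would never overflow.
  -- The program halts at once instead, after 5 ≤ 2^3 steps, whence c + 3.
  rcases Nat.eq_zero_or_pos n with rfl | hn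
  · refine ⟨_, _, Runs.iteFalse rfl (Runs.skip _), ?_, fun M' hM' _ _ => ⟨M', hM', rfl, nofun⟩⟩
    have h3 : 3 ≤ (c + 3) * max L 1 :=
      (Nat.le_add_left 3 c).trans
        (Nat.le_mul_of_pos_right _ (Nat.lt_of_lt_of_le Nat.zero_lt_one (le_max_right _ _)))
    exact le_trans (by decide : 5 ≤ 2 ^ 3) (Nat.pow_le_pow_right (by decide) h3)
  · set m₀ := inputMemory G C M k L with hm₀
    have h1 : m₀ 1 = matrixArray G.Adj := rfl
    have h2 : m₀ 2 = matrixArray (C.labelGraph .red).Adj := rfl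
    have hpos := digits_lt (n := n) (L := L) (d := fun _ => 0) fun _ _ => hn
    have hv : ∀ a, 23 < a → value n L m₀ a = 0 := fun a ha => by
      obtain ⟨b, rfl⟩ : ∃ b, a = b + 24 := ⟨a - 24, by omega⟩
      exact Finset.sum_eq_zero fun i _ => Nat.zero_mul _
    -- All scratch arrays are initially zero, so the enumeration starts at guess 0 with all n^L *
    -- n^L guesses ahead.
    obtain ⟨t, m, r1, r2, -, r4, hm⟩ := searchLoop_runs (n := n) (k := k) (L := L) (b := n + L)
      (m₀ := m₀) rfl rfl (by omega) (by omega)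
      (fun m hm => (attemptProg_den (goodInput_guess hm)).1) (n ^ L * n ^ L) m₀
      (inputMemory_loopInv C M k L hn) rfl (by rw [hv 24 (by decide), hv 25 (by decide)]; omega)
    refine ⟨_, m, Runs.iteTrue (by simpa [Expr.eval, hm₀, inputMemory] using hn.ne') r1, ?_,
      fun M' hM' hk hS => ?_⟩
    · calc _ ≤ 4 + (n ^ L * n ^ L * (bodyProg.time (n + L) + 6) + 6) := Nat.add_le_add_left r2 4
        _ ≤ _ := hc n L hn
        _ ≤ _ := Nat.pow_le_pow_right (by omega) (Nat.mul_le_mul_right _ (by omega))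
    · obtain ⟨g, hg, hgn, hgM⟩ := exists_partner hM'
      obtain ⟨x, hx⟩ : ∃ x, (ofColor C x (symmDiff M.edgeSet M'.edgeSet)).ncard ≤ L :=
        hS.elim (fun h => ⟨_, h⟩) fun h => ⟨_, h⟩
      obtain ⟨A, B, hA, hB, hl⟩ := exists_lists hn hx
      have := r4 A B (succeeds_of_lists hA hB hg hgn hgM hk hl)
        (by rw [hv 24 (by decide), hv 25 (by decide)]; omega)
      rw [hk]
      exact this.exists_perfectMatching C (hm 1 (by decide)) (hm 2 (by decide))

end ExactMatching

theorem mainTheorem4 :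
    ∃ (P : RAM.Prog) (c : ℕ),
      ∀ (n : ℕ) (G : SimpleGraph (Fin n)) (C : G.EdgeLabeling ExactMatching.Color)
        (M : G.Subgraph) (_ : M.IsPerfectMatching) (k L : ℕ),
        ∃ (t : ℕ) (m : RAM.Memory),
          RAM.Runs P (ExactMatching.inputMemory G C M k L) t m ∧
          t ≤ (max n 2) ^ (c * max L 1) ∧
          ∀ M' : G.Subgraph, M'.IsPerfectMatching →
            ExactMatching.redCount C M' = k →
            ((ExactMatching.ofColor C .blue (symmDiff M.edgeSet M'.edgeSet)).ncard ≤ L ∨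
              (ExactMatching.ofColor C .red (symmDiff M.edgeSet M'.edgeSet)).ncard ≤ L) →
            ∃ M'' : G.Subgraph, M''.IsPerfectMatching ∧
              ExactMatching.redCount C M'' = ExactMatching.redCount C M' ∧
              ExactMatching.Outputs m M'' := by
  obtain ⟨c, hc⟩ := ExactMatching.exists_mainProg_runs
  exact ⟨ExactMatching.mainProg, c, fun n G C M _ k L => hc n G C M k L⟩
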